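/- A $k$-ranking of a finite graph $G$ is a labeling $f:V(G)\to\{1,\dots,k\}$ such that every path between two distinct vertices with the same label passes through a vertex with a larger label; the rank number $\chi_r(G)$ is the smallest $k$ for which a $k$-ranking of $G$ exists. Let $r(m,n)$ denote the rank number of the $m\times n$ grid graph $G_{m,n}$ (the Cartesian product of the paths on $m$ and $n$ vertices). Then for every integer $m\ge 5$, $$r(m,m)\ \ge\ m+r\!\left(\left\lceil \tfrac{2m}{5}\right\rceil-1,\ \left\lceil \tfrac{2m}{5}\right\rceil-1\right).$$ -/

import Mathlib

/-- A labeling `f` of the vertices of `G` by natural numbers is a `k`-ranking if all labels lie in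
`{1, …, k}` and every path joining two distinct vertices with the same label passes through a vertex
with a greater label. -/
def SimpleGraph.IsRanking {V : Type*} (G : SimpleGraph V) (k : ℕ) (f : V → ℕ) : Prop :=
  (∀ v, 1 ≤ f v ∧ f v ≤ k) ∧
    ∀ u v : V, u ≠ v → f u = f v → ∀ p : G.Walk u v, p.IsPath → ∃ w ∈ p.support, f u < f w

/-- Every finite graph has a ranking: label the vertices injectively by `1, …, |V|`. -/
theorem SimpleGraph.exists_isRanking {V : Type*} [Finite V] (G : SimpleGraph V) :
    ∃ (k : ℕ) (f : V → ℕ), G.IsRanking k f := by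
  obtain ⟨n, ⟨e⟩⟩ := Finite.exists_equiv_fin V
  refine ⟨n, fun v => (e v : ℕ) + 1, fun v => ⟨Nat.succ_pos _, (e v).isLt⟩, ?_⟩
  intro u v huv h
  exact absurd (e.injective (Fin.ext (by simpa using h))) huv

/-- The rank number of a finite graph: the least `k` for which a `k`-ranking exists
(the infimum is over a nonempty set of natural numbers, hence a minimum). -/
noncomputable def SimpleGraph.rankNumber {V : Type*} [Finite V] (G : SimpleGraph V) : ℕ :=
  sInf {k : ℕ | ∃ f : V → ℕ, G.IsRanking k f}

/-- The `m × n` grid graph: the Cartesian (box) product of the paths on `m` and `n` vertices. -/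
def gridGraph (m n : ℕ) : SimpleGraph (Fin m × Fin n) :=
  (SimpleGraph.pathGraph m).boxProd (SimpleGraph.pathGraph n)

/-- The rank number `r(m, n)` of the `m × n` grid graph. -/
noncomputable def gridRank (m n : ℕ) : ℕ :=
  (gridGraph m n).rankNumber

/-! Let a = ⌈2m/5⌉ - 1 and suppose fewer than m + r(a,a) labels suffice. Since r(n+1,n+1) ≥ r(n,n) +
1, only the least m for each a matters (`Params`). A connected set has at most one cell with the top
label, so deleting one cell saves a label (`Rk.exists_top`). Repeat this, collecting the deleted
cells (hits) in S, and continue inside the component D of the rest that meets every connected set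
joining opposite sides (`State`). Such a component survives while some Z-shaped path in each
direction avoids S (`State.step`). Both outcomes are impossible: blocking too early (`not_blocked`),
and reaching m + t hits with t = ⌊(a-1)/2⌋ (`not_state`).

Both contradictions rest on `rk_square`. If a b × b square has q ≤ 2b/3 hits and the part containing
its hit-free lines needs k labels, then k + q labels suffice for the whole square. The free lines
form a grid minor of side at least b - q, so every other component (pocket) fitting into that side
needs only k labels. At most one pocket is too wide and at most one too tall. Such a pocket has a
copy elsewhere in the square, by point reflection or translation, away from itself, so only the hits
next to it cost labels (`Rk.readd`).

Hence, when D needs ρ labels and ρ + q < r(b,b), the free lines of the square lie in a component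
other than D (`exists_captured`). That component is no crossing, so a captured square on a side is
fenced by about 2b hits. Components captured at opposite sides share no neighbouring hit, since
together with it they would form a crossing avoiding D. Thus too many hits are needed for captured
squares at opposite sides.

If S is blocked, every row has a hit, |S| = m + s, and a strip of a rows has at most a + s hits. It
follows that all a × a squares on the left and right sides have more than s hits. Then every strip
of a rows has a row with hits only near the right end and one with hits only near the left end. Such
rows alternate, and the Z-paths between them force 2(m - 2a) hits in a strip part that holds at most
a - 1. This contradicts 5a < 2m, the source of the ratio 2/5. In the other outcome every corner
square of side about m/2 carries so many hits that the four together exceed or exactly exhaust S,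
and the exact case fails as well. -/

namespace GridRank

/-! ### Connectivity in sets of cells -/

/-- Cells of the infinite square grid. -/
abbrev Cell := ℤ × ℤ

/-- Two cells are adjacent if they are at distance one. -/
def Adj (p q : Cell) : Prop :=
  (p.1 = q.1 ∧ (p.2 = q.2 + 1 ∨ q.2 = p.2 + 1)) ∨ (p.2 = q.2 ∧ (p.1 = q.1 + 1 ∨ q.1 = p.1 + 1))

theorem Adj.symm {p q : Cell} (h : Adj p q) : Adj q p := by
  unfold Adj at *; omega

/-- Two cells are joined by a walk inside `A`. -/
def Conn (A : Set Cell) (p q : Cell) : Prop :=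
  Relation.ReflTransGen (fun u v => Adj u v ∧ u ∈ A ∧ v ∈ A) p q

theorem Conn.refl (A : Set Cell) (p : Cell) : Conn A p p := Relation.ReflTransGen.refl

theorem Conn.trans {A : Set Cell} {p q r : Cell} (h : Conn A p q) (h' : Conn A q r) :
    Conn A p r := Relation.ReflTransGen.trans h h'

theorem Conn.of_adj {A : Set Cell} {p q : Cell} (h : Adj p q) (hp : p ∈ A) (hq : q ∈ A) :
    Conn A p q := Relation.ReflTransGen.single ⟨h, hp, hq⟩

theorem Conn.symm {A : Set Cell} {p q : Cell} (h : Conn A p q) : Conn A q p := by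
  induction h with
  | refl => exact Conn.refl _ _
  | tail _ h ih => exact (Conn.of_adj h.1.symm h.2.2 h.2.1).trans ih

theorem Conn.mono {A B : Set Cell} (hAB : A ⊆ B) {p q : Cell} (h : Conn A p q) : Conn B p q :=
  Relation.ReflTransGen.mono (fun _ _ h => ⟨h.1, hAB h.2.1, hAB h.2.2⟩) _ _ h

theorem Conn.mem {A : Set Cell} {p q : Cell} (h : Conn A p q) (hp : p ∈ A) : q ∈ A := by
  induction h with
  | refl => exact hp
  | tail _ h _ => exact h.2.2

/-- A walk that leaves `B` traverses an edge from `B` to its complement. -/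
theorem Conn.exit {A : Set Cell} {p q : Cell} (h : Conn A p q) {B : Set Cell} (hp : p ∈ B)
    (hq : q ∉ B) : ∃ u v, Adj u v ∧ u ∈ A ∧ v ∈ A ∧ u ∈ B ∧ v ∉ B := by
  induction h with
  | refl => exact absurd hp hq
  | @tail b c _ h ih =>
    by_cases hb : b ∈ B
    · exact ⟨b, c, h.1, h.2.1, h.2.2, hb, hq⟩
    · exact ih hb

/-- A set of cells any two of which are joined inside the set. -/
def IsConn (K : Set Cell) : Prop := ∀ p ∈ K, ∀ q ∈ K, Conn K p q

theorem IsConn.union {K L : Set Cell} (hK : IsConn K) (hL : IsConn L) {p q : Cell} (hp : p ∈ K)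
    (hq : q ∈ L) (h : p = q ∨ Adj p q) : IsConn (K ∪ L) := by
  have hpq : Conn (K ∪ L) p q := by
    rcases h with rfl | h
    · exact Conn.refl _ _
    · exact Conn.of_adj h (Or.inl hp) (Or.inr hq)
  have h1 : ∀ u ∈ K ∪ L, Conn (K ∪ L) u p := by
    rintro u (hu | hu)
    · exact (hK u hu p hp).mono Set.subset_union_left
    · exact ((hL u hu q hq).mono Set.subset_union_right).trans hpq.symm
  intro u hu v hv
  exact (h1 u hu).trans (h1 v hv).symm

theorem isConn_singleton (v : Cell) : IsConn {v} := by
  rintro p rfl q rfl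
  exact Conn.refl _ _

/-- The component of `p` in `A`. -/
def comp (A : Set Cell) (p : Cell) : Set Cell := {q | q ∈ A ∧ Conn A p q}

theorem mem_comp_self {A : Set Cell} {p : Cell} (hp : p ∈ A) : p ∈ comp A p := ⟨hp, Conn.refl _ _⟩

theorem comp_subset (A : Set Cell) (p : Cell) : comp A p ⊆ A := fun _ h => h.1

theorem comp_closed {A : Set Cell} {p u v : Cell} (hu : u ∈ comp A p) (h : Adj u v) (hv : v ∈ A) :
    v ∈ comp A p := ⟨hv, hu.2.trans (Conn.of_adj h hu.1 hv)⟩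

theorem Conn.comp {A : Set Cell} {p q : Cell} (h : Conn A p q) : Conn (comp A p) p q := by
  induction h with
  | refl => exact Conn.refl _ _
  | @tail b c hb h ih => exact ih.trans (Conn.of_adj h.1 ⟨h.2.1, hb⟩ ⟨h.2.2, Conn.trans hb
      (Conn.of_adj h.1 h.2.1 h.2.2)⟩)

theorem isConn_comp (A : Set Cell) (p : Cell) : IsConn (comp A p) := fun _ hu _ hv =>
  hu.2.comp.symm.trans hv.2.comp

theorem IsConn.subset_comp {A K : Set Cell} (hK : IsConn K) (hKA : K ⊆ A) {p : Cell} (hp : p ∈ K) :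
    K ⊆ comp A p := fun q hq => ⟨hKA hq, (hK p hp q hq).mono hKA⟩

theorem comp_eq_of_mem {A : Set Cell} {p q : Cell} (h : q ∈ comp A p) : comp A q = comp A p := by
  ext r
  exact ⟨fun hr => ⟨hr.1, h.2.trans hr.2⟩, fun hr => ⟨hr.1, h.2.symm.trans hr.2⟩⟩

/-! ### Rankings of sets of cells and their behaviour under deletion, union and minors -/

/-- `A` has a ranking with labels less than `k`. -/
def Rk (k : ℕ) (A : Set Cell) : Prop :=
  ∃ f : Cell → ℕ, (∀ p ∈ A, f p < k) ∧
    ∀ p ∈ A, ∀ q ∈ A, p ≠ q → f p = f q → ¬ Conn {r | r ∈ A ∧ f r ≤ f p} p q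

theorem Rk.mono {k l : ℕ} (hkl : k ≤ l) {A : Set Cell} (h : Rk k A) : Rk l A := by
  obtain ⟨f, h1, h2⟩ := h
  exact ⟨f, fun p hp => (h1 p hp).trans_le hkl, h2⟩

theorem Rk.mono_set {k : ℕ} {A B : Set Cell} (hAB : A ⊆ B) (h : Rk k B) : Rk k A := by
  obtain ⟨f, h1, h2⟩ := h
  refine ⟨f, fun p hp => h1 p (hAB hp), fun p hp q hq hpq hf hc => ?_⟩
  refine h2 p (hAB hp) q (hAB hq) hpq hf (hc.mono ?_)
  exact fun r hr => ⟨hAB hr.1, hr.2⟩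

theorem rk_empty (k : ℕ) : Rk k ∅ := ⟨fun _ => 0, by simp, by simp⟩

theorem Rk.pos {k : ℕ} {A : Set Cell} (h : Rk k A) {p : Cell} (hp : p ∈ A) : 0 < k := by
  obtain ⟨f, h1, _⟩ := h
  exact (Nat.zero_le _).trans_lt (h1 p hp)

/-- The cell `v` receives the new top label `k`, so low-label walks between other cells still avoid
it. -/
theorem Rk.insert {k : ℕ} {A : Set Cell} {v : Cell} (h : Rk k (A \ {v})) : Rk (k + 1) A := by
  classical
  obtain ⟨f, h1, h2⟩ := h
  have hlt : ∀ p ∈ A, p ≠ v → f p < k := fun p hp hpv => h1 p ⟨hp, hpv⟩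
  refine ⟨fun p => if p = v then k else f p, ?_, ?_⟩
  · intro p hp
    dsimp only
    split_ifs with hpv
    · omega
    · have := hlt p hp hpv; omega
  · intro p hp q hq hpq hf hc
    dsimp only at hf hc
    by_cases hpv : p = v
    · have hqv : q ≠ v := fun h => hpq (hpv.trans h.symm)
      have := hlt q hq hqv
      simp [hpv, hqv] at hf
      omega
    · by_cases hqv : q = v
      · have := hlt p hp hpv
        simp [hpv, hqv] at hf
        omega
      · simp only [hpv, hqv, if_false] at hf hc
        refine h2 p ⟨hp, hpv⟩ q ⟨hq, hqv⟩ hpq hf (hc.mono ?_)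
        rintro r ⟨hr, hr'⟩
        have := hlt p hp hpv
        by_cases hrv : r = v
        · simp only [hrv, if_true] at hr'
          omega
        · simp only [hrv, if_false] at hr'
          exact ⟨⟨hr, hrv⟩, hr'⟩

theorem Rk.add_finset {k : ℕ} {A : Set Cell} (S : Finset Cell) (h : Rk k (A \ S)) :
    Rk (k + S.card) A := by
  classical
  induction S using Finset.induction_on generalizing A with
  | empty => simpa using h
  | insert a s ha ih =>
    rw [Finset.card_insert_of_notMem ha, ← add_assoc]
    refine Rk.insert (v := a) (ih (A := A \ {a}) (h.mono_set ?_))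
    rintro p ⟨⟨hp, hpa⟩, hps⟩
    refine ⟨hp, ?_⟩
    simp only [Finset.coe_insert, Set.mem_insert_iff, not_or]
    exact ⟨hpa, hps⟩

/-- A labelling is chosen once for each set, not for each base point, so that cells of one component
use the same labelling. -/
theorem Rk.of_comps {k : ℕ} {A : Set Cell} (h : ∀ p ∈ A, Rk k (comp A p)) : Rk k A := by
  have h' : ∀ C : Set Cell, ∃ f : Cell → ℕ, Rk k C → ((∀ p ∈ C, f p < k) ∧
    ∀ p ∈ C, ∀ q ∈ C, p ≠ q → f p = f q → ¬ Conn {r | r ∈ C ∧ f r ≤ f p} p q) := by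
    intro C
    by_cases hC : Rk k C
    · obtain ⟨f, hf⟩ := hC
      exact ⟨f, fun _ => hf⟩
    · exact ⟨fun _ => 0, fun h => absurd h hC⟩
  choose F hF using h'
  refine ⟨fun p => F (comp A p) p, fun p hp => (hF _ (h p hp)).1 p (mem_comp_self hp), ?_⟩
  intro p hp q hq hpq hf hc
  have hqp : q ∈ comp A p := ⟨hq, hc.mono fun r hr => hr.1⟩
  have hcq := comp_eq_of_mem hqp
  dsimp only at hf hc
  rw [hcq] at hf
  refine (hF _ (h p hp)).2 p (mem_comp_self hp) q hqp hpq hf (hc.comp.mono ?_)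
  rintro r ⟨⟨hrA, hr'⟩, hr⟩
  have hrp : r ∈ comp A p := ⟨hrA, hr.mono fun r hr => hr.1⟩
  rw [comp_eq_of_mem hrp] at hr'
  exact ⟨hrp, hr'⟩

theorem Rk.union {k : ℕ} {A B : Set Cell} (hA : Rk k A) (hB : Rk k B)
    (hAB : ∀ u ∈ A, ∀ v ∈ B, ¬ Adj u v) : Rk k (A ∪ B) := by
  refine Rk.of_comps fun p hp => ?_
  rcases hp with hp | hp
  · refine hA.mono_set fun q hq => ?_
    by_contra hqA
    obtain ⟨u, v, huv, -, hv, hu, hv'⟩ := hq.2.exit hp hqA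
    exact hAB u hu v (hv.resolve_left hv') huv
  · refine hB.mono_set fun q hq => ?_
    by_contra hqA
    obtain ⟨u, v, huv, -, hv, hu, hv'⟩ := hq.2.exit hp hqA
    exact hAB v (hv.resolve_right hv') u hu huv.symm

/-- In a connected set two cells with the top label `k` would be joined by a walk with no larger
label. If no cell has label `k`, any cell serves. -/
theorem Rk.exists_top {k : ℕ} {A : Set Cell} (hA : IsConn A) (hne : A.Nonempty)
    (h : Rk (k + 1) A) : ∃ v ∈ A, Rk k (A \ {v}) := by
  obtain ⟨f, h1, h2⟩ := h
  obtain ⟨p, hp⟩ := hne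
  by_cases hv : ∃ v ∈ A, f v = k
  · obtain ⟨v, hv, hfv⟩ := hv
    refine ⟨v, hv, f, ?_, ?_⟩
    · rintro q ⟨hq, hqv⟩
      have := h1 q hq
      refine lt_of_le_of_ne (by omega) fun hqk => ?_
      refine h2 v hv q hq (fun h => hqv h.symm) (by omega) ((hA v hv q hq).mono ?_)
      intro r hr
      have := h1 r hr
      exact ⟨hr, by omega⟩
    · rintro q ⟨hq, hqv⟩ r ⟨hr, hrv⟩ hqr hf hc
      refine h2 q hq r hr hqr hf (hc.mono ?_)
      exact fun r hr => ⟨hr.1.1, hr.2⟩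
  · push Not at hv
    refine ⟨p, hp, Rk.mono_set Set.sdiff_subset ⟨f, fun q hq => ?_, h2⟩⟩
    have := h1 q hq
    have := hv q hq
    omega

/-- Rankings pass to minors. -/
theorem Rk.minor {k : ℕ} {A A' : Set Cell} (B : Cell → Set Cell) (h : Rk k A)
    (hne : ∀ a ∈ A', (B a).Nonempty) (hsub : ∀ a ∈ A', B a ⊆ A) (hconn : ∀ a ∈ A', IsConn (B a))
    (hdisj : ∀ a ∈ A', ∀ b ∈ A', ∀ u, u ∈ B a → u ∈ B b → a = b)
    (hadj : ∀ a ∈ A', ∀ b ∈ A', Adj a b → ∃ u ∈ B a, ∃ v ∈ B b, Adj u v) : Rk k A' := by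
  obtain ⟨f, h1, h2⟩ := h
  -- A vertex of the minor gets the largest label on its branch set. A walk of the minor below some
  -- level then lifts to a walk of `A` below that level.
  have key : ∀ a, ∃ n, a ∈ A' → (∃ u ∈ B a, f u = n) ∧ ∀ u ∈ B a, f u ≤ n := by
    intro a
    by_cases ha : a ∈ A'
    · refine ⟨sSup (f '' B a), fun _ => ?_⟩
      have hbdd : BddAbove (f '' B a) := by
        refine ⟨k, ?_⟩
        rintro _ ⟨u, hu, rfl⟩
        exact (h1 u (hsub a ha hu)).le
      refine ⟨?_, fun u hu => le_csSup hbdd ⟨u, hu, rfl⟩⟩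
      obtain ⟨u, hu, hfu⟩ := Nat.sSup_mem ((hne a ha).image f) hbdd
      exact ⟨u, hu, hfu⟩
    · exact ⟨0, fun h => absurd h ha⟩
  choose g hg using key
  refine ⟨g, ?_, ?_⟩
  · intro a ha
    obtain ⟨u, hu, hfu⟩ := (hg a ha).1
    exact hfu ▸ h1 u (hsub a ha hu)
  · intro a ha b hb hab hgab hc
    obtain ⟨u, hu, hfu⟩ := (hg a ha).1
    obtain ⟨v, hv, hfv⟩ := (hg b hb).1
    have hkey : ∀ c, Conn {r | r ∈ A' ∧ g r ≤ g a} a c → c ∈ A' → ∀ w ∈ B c,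
        Conn {r | r ∈ A ∧ f r ≤ g a} u w := by
      have hin : ∀ c ∈ A', g c ≤ g a → B c ⊆ {r | r ∈ A ∧ f r ≤ g a} := fun c hc hgc w hw =>
        ⟨hsub c hc hw, ((hg c hc).2 w hw).trans hgc⟩
      intro c hc
      induction hc with
      | refl =>
        intro _ w hw
        exact (hconn a ha u hu w hw).mono (hin a ha le_rfl)
      | @tail c d hc hcd ih =>
        intro hd w hw
        obtain ⟨x, hx, y, hy, hxy⟩ := hadj c hcd.2.1.1 d hd hcd.1
        have hx' := hin c hcd.2.1.1 hcd.2.1.2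
        have hy' := hin d hd hcd.2.2.2
        exact ((ih hcd.2.1.1 x hx).trans (Conn.of_adj hxy (hx' hx) (hy' hy))).trans
          ((hconn d hd y hy w hw).mono hy')
    refine h2 u (hsub a ha hu) v (hsub b hb hv) ?_ (by omega) ?_
    · rintro rfl
      exact hab (hdisj a ha b hb u hu hv)
    · rw [hfu]
      exact hkey b hc hb v hv

theorem Rk.comap {k : ℕ} {A A' : Set Cell} (φ : Cell → Cell) (h : Rk k A)
    (hmaps : ∀ a ∈ A', φ a ∈ A) (hinj : ∀ a ∈ A', ∀ b ∈ A', φ a = φ b → a = b)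
    (hadj : ∀ a b, Adj a b → Adj (φ a) (φ b)) : Rk k A' := by
  refine h.minor (fun a => {φ a}) (fun a _ => ⟨_, rfl⟩) ?_ (fun a _ => isConn_singleton _) ?_ ?_
  · rintro a ha _ rfl
    exact hmaps a ha
  · rintro a ha b hb _ rfl h
    exact hinj a ha b hb h
  · intro a _ b _ hab
    exact ⟨_, rfl, _, rfl, hadj a b hab⟩

/-! ### Rows, columns and boxes; translation from and to the grid graph -/

theorem conn_row_of_le {A : Set Cell} {x₁ y : ℤ} (n : ℕ)
    (h : ∀ x, x₁ ≤ x → x ≤ x₁ + n → (x, y) ∈ A) : Conn A (x₁, y) (x₁ + n, y) := by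
  induction n with
  | zero => simpa using Conn.refl A (x₁, y)
  | succ n ih =>
    refine (ih fun x h1 h2 => h x h1 (by push_cast; omega)).trans (Conn.of_adj ?_ ?_ ?_)
    · simp [Adj]; omega
    · exact h _ (by omega) (by push_cast; omega)
    · exact h _ (by push_cast; omega) (by push_cast; omega)

theorem conn_row {A : Set Cell} {x₁ x₂ y : ℤ}
    (h : ∀ x, (x₁ ≤ x ∧ x ≤ x₂ ∨ x₂ ≤ x ∧ x ≤ x₁) → (x, y) ∈ A) : Conn A (x₁, y) (x₂, y) := by
  rcases le_total x₁ x₂ with hle | hle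
  · have := conn_row_of_le (A := A) (x₁ := x₁) (y := y) (x₂ - x₁).toNat
      fun x h1 h2 => h x (by omega)
    have e : x₁ + ((x₂ - x₁).toNat : ℤ) = x₂ := by omega
    rwa [e] at this
  · have := conn_row_of_le (A := A) (x₁ := x₂) (y := y) (x₁ - x₂).toNat
      fun x h1 h2 => h x (by omega)
    have e : x₂ + ((x₁ - x₂).toNat : ℤ) = x₁ := by omega
    rw [e] at this
    exact this.symm

theorem Adj.swap {p q : Cell} (h : Adj p q) : Adj p.swap q.swap := by
  unfold Adj at *; simp only [Prod.fst_swap, Prod.snd_swap]; omega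

theorem Conn.map {A B : Set Cell} (φ : Cell → Cell) (hadj : ∀ a b, Adj a b → Adj (φ a) (φ b))
    (hAB : ∀ a ∈ A, φ a ∈ B) {p q : Cell} (h : Conn A p q) : Conn B (φ p) (φ q) := by
  induction h with
  | refl => exact Conn.refl _ _
  | tail _ h ih => exact ih.trans (Conn.of_adj (hadj _ _ h.1) (hAB _ h.2.1) (hAB _ h.2.2))

theorem conn_col {A : Set Cell} {x y₁ y₂ : ℤ}
    (h : ∀ y, (y₁ ≤ y ∧ y ≤ y₂ ∨ y₂ ≤ y ∧ y ≤ y₁) → (x, y) ∈ A) : Conn A (x, y₁) (x, y₂) := by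
  have := conn_row (A := {p : Cell | p.swap ∈ A}) (x₁ := y₁) (x₂ := y₂) (y := x) h
  exact this.map Prod.swap (fun _ _ h => h.swap) fun a ha => ha

/-- The `w × h` box with lower left corner `(x, y)`. -/
def Box (x y w h : ℤ) : Set Cell := {p | x ≤ p.1 ∧ p.1 < x + w ∧ y ≤ p.2 ∧ p.2 < y + h}

theorem mem_Box {x y w h : ℤ} {p : Cell} :
    p ∈ Box x y w h ↔ x ≤ p.1 ∧ p.1 < x + w ∧ y ≤ p.2 ∧ p.2 < y + h := Iff.rfl

theorem adj_of_adj_grid {m n : ℕ} {u v : Fin m × Fin n} :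
    (gridGraph m n).Adj u v ↔ Adj ((u.1 : ℕ), (u.2 : ℕ)) ((v.1 : ℕ), (v.2 : ℕ)) := by
  simp only [gridGraph, SimpleGraph.boxProd_adj, SimpleGraph.pathGraph_adj, Adj, Fin.ext_iff]
  omega

/-- Labels `0, …, k - 1` are shifted by one to match `IsRanking`. -/
theorem gridRank_le_of_rk {n k : ℕ} (h : Rk k (Box 0 0 n n)) : gridRank n n ≤ k := by
  obtain ⟨f, h1, h2⟩ := h
  have hbox : ∀ v : Fin n × Fin n, (((v.1 : ℕ) : ℤ), ((v.2 : ℕ) : ℤ)) ∈ Box 0 0 n n := by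
    intro v
    have := v.1.2
    have := v.2.2
    refine ⟨?_, ?_, ?_, ?_⟩ <;> dsimp only <;> omega
  refine Nat.sInf_le ⟨fun v => f ((v.1 : ℕ), (v.2 : ℕ)) + 1, fun v => ⟨Nat.le_add_left _ _, h1 _ (hbox v)⟩, ?_⟩
  intro u v huv hf p _
  by_contra hcon
  push Not at hcon
  have key : ∀ (N : ℕ) (u v : Fin n × Fin n) (p : (gridGraph n n).Walk u v),
      (∀ w ∈ p.support, f ((w.1 : ℕ), (w.2 : ℕ)) ≤ N) →
      Conn {r | r ∈ Box 0 0 n n ∧ f r ≤ N} ((u.1 : ℕ), (u.2 : ℕ)) ((v.1 : ℕ), (v.2 : ℕ)) := by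
    intro N u v p
    induction p with
    | nil => exact fun _ => Conn.refl _ _
    | @cons a b c hab p ih =>
      intro h
      have ha : f ((a.1 : ℕ), (a.2 : ℕ)) ≤ N := h a (by simp)
      have hb : f ((b.1 : ℕ), (b.2 : ℕ)) ≤ N := h b (by simp)
      refine Conn.trans (Conn.of_adj (adj_of_adj_grid.1 hab) ?_ ?_)
        (ih fun w hw => h w (by simp [hw]))
      · exact ⟨hbox a, ha⟩
      · exact ⟨hbox b, hb⟩
  refine h2 _ (hbox u) _ (hbox v) ?_ (Nat.succ_injective hf) (key _ u v p fun w hw => ?_)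
  · intro h
    apply huv
    simp only [Prod.mk.injEq] at h
    ext <;> omega
  · have := hcon w hw
    omega

theorem rk_gridRank (n : ℕ) : Rk (gridRank n n) (Box 0 0 n n) := by
  obtain ⟨f, h1, h2⟩ : ∃ f, (gridGraph n n).IsRanking (gridRank n n) f :=
    Nat.sInf_mem (gridGraph n n).exists_isRanking
  rcases Nat.eq_zero_or_pos n with rfl | hn
  · refine (rk_empty _).mono_set ?_
    rintro p ⟨h1, h2, -, -⟩
    simp at h2
    omega
  -- The reduction modulo `n` only makes the map total; it does nothing on the box.
  let c : Cell → Fin n × Fin n := fun p =>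
    (⟨p.1.toNat % n, Nat.mod_lt _ hn⟩, ⟨p.2.toNat % n, Nat.mod_lt _ hn⟩)
  have hc : ∀ p ∈ Box 0 0 n n, (((c p).1 : ℕ) : ℤ) = p.1 ∧ (((c p).2 : ℕ) : ℤ) = p.2 := by
    rintro p ⟨h1, h2, h3, h4⟩
    simp only [c]
    rw [Nat.mod_eq_of_lt (by omega), Nat.mod_eq_of_lt (by omega)]
    omega
  refine ⟨fun p => f (c p) - 1, fun p _ => ?_, ?_⟩
  · have := h1 (c p)
    dsimp only
    omega
  · intro p hp q hq hpq hf hconn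
    have key : ∀ r, Conn {r | r ∈ Box 0 0 n n ∧ f (c r) - 1 ≤ f (c p) - 1} p r →
        ∃ w : (gridGraph n n).Walk (c p) (c r), ∀ x ∈ w.support, f x ≤ f (c p) := by
      intro r hr
      induction hr with
      | refl => exact ⟨SimpleGraph.Walk.nil, by simp⟩
      | @tail a b _ hab ih =>
        obtain ⟨w, hw⟩ := ih
        have hadj : (gridGraph n n).Adj (c a) (c b) := by
          rw [adj_of_adj_grid]
          have h1 := hc a hab.2.1.1
          have h2 := hc b hab.2.2.1
          rw [h1.1, h1.2, h2.1, h2.2]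
          exact hab.1
        refine ⟨w.concat hadj, fun x hx => ?_⟩
        rw [SimpleGraph.Walk.support_concat, List.mem_append, List.mem_singleton] at hx
        rcases hx with hx | rfl
        · exact hw x hx
        · have := h1 (c b)
          have := h1 (c p)
          have := hab.2.2.2
          omega
    obtain ⟨w, hw⟩ := key q hconn
    have hne : c p ≠ c q := by
      intro h
      have h1 := hc p hp
      have h2 := hc q hq
      rw [h] at h1
      exact hpq (Prod.ext (by omega) (by omega))
    classical
    have hfe : f (c p) = f (c q) := by
      have := h1 (c p)
      have := h1 (c q)
      dsimp only at hf
      omega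
    -- `IsRanking` speaks of paths, so the walk is shortened to a path inside its own support.
    obtain ⟨x, hx, hlt⟩ := h2 _ _ hne hfe w.bypass w.bypass_isPath
    have := hw x (w.support_bypass_subset_support hx)
    omega

end GridRank

namespace GridRank

/-! ### Grid minors formed by marked lines; monotonicity of the rank number -/

theorem exists_enum (F : Finset ℤ) : ∃ c : ℤ → ℤ, (∀ i, 0 ≤ i → i < (F.card : ℤ) → c i ∈ F) ∧
    ∀ i j, 0 ≤ i → i < j → j < (F.card : ℤ) → c i < c j := by
  refine ⟨fun i => if h : i.toNat < F.card then F.orderEmbOfFin rfl ⟨i.toNat, h⟩ else 0, ?_, ?_⟩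
  · intro i h0 h1
    have h : i.toNat < F.card := by omega
    simp only [h, dif_pos]
    exact F.orderEmbOfFin_mem rfl _
  · intro i j h0 hij hj
    have h : i.toNat < F.card := by omega
    have h' : j.toNat < F.card := by omega
    simp only [h, h', dif_pos]
    apply (F.orderEmbOfFin rfl).strictMono
    simp only [Fin.mk_lt_mk]
    omega

/-- The stretch of coordinates from the `i`-th marked one up to, not including, the next. -/
def Stretch (c : ℤ → ℤ) (p i : ℤ) : Set ℤ := {x | c i ≤ x ∧ (x = c i ∨ (i + 1 < p ∧ x < c (i + 1)))}

theorem stretch_self (c : ℤ → ℤ) (p i : ℤ) : c i ∈ Stretch c p i := ⟨le_rfl, Or.inl rfl⟩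

theorem stretch_disj {c : ℤ → ℤ} {p : ℤ} (hc : ∀ i j, 0 ≤ i → i < j → j < p → c i < c j)
    {i j x : ℤ} (hi : 0 ≤ i) (hi' : i < p) (hj : 0 ≤ j) (hj' : j < p) (hx : x ∈ Stretch c p i)
    (hx' : x ∈ Stretch c p j) : i = j := by
  have aux : ∀ i j, 0 ≤ i → j < p → i < j → x ∈ Stretch c p i → x ∈ Stretch c p j → False := by
    rintro i j hi hj hij ⟨h1, h2⟩ ⟨h3, h4⟩
    have h5 := hc i j hi hij hj
    rcases eq_or_lt_of_le (show i + 1 ≤ j by omega) with rfl | h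
    · omega
    · have := hc (i + 1) j (by omega) h hj
      omega
  rcases lt_trichotomy i j with h | h | h
  · exact (aux i j hi hj' h hx hx').elim
  · exact h
  · exact (aux j i hj hi' h hx' hx).elim

theorem stretch_between {c : ℤ → ℤ} {p i x x' : ℤ} (hx : x ∈ Stretch c p i) (h1 : c i ≤ x')
    (h2 : x' ≤ x) : x' ∈ Stretch c p i := by
  obtain ⟨h3, h4⟩ := hx
  exact ⟨h1, by omega⟩

theorem mem_stretch_succ {c : ℤ → ℤ} {p : ℤ} (hc : ∀ i j, 0 ≤ i → i < j → j < p → c i < c j)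
    {i : ℤ} (hi : 0 ≤ i) (hi' : i + 1 < p) : c (i + 1) - 1 ∈ Stretch c p i := by
  have := hc i (i + 1) hi (by omega) hi'
  exact ⟨by omega, by omega⟩

/-- If the marked columns and rows of a box lie in `A`, then `A` has a grid minor formed by them. -/
theorem Rk.lines {k : ℕ} {A : Set Cell} {x₀ y₀ w h : ℤ} (Fc Fr : Finset ℤ)
    (hFc : ∀ x ∈ Fc, x₀ ≤ x ∧ x < x₀ + w) (hFr : ∀ y ∈ Fr, y₀ ≤ y ∧ y < y₀ + h)
    (hcol : ∀ x ∈ Fc, ∀ y, y₀ ≤ y → y < y₀ + h → (x, y) ∈ A)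
    (hrow : ∀ y ∈ Fr, ∀ x, x₀ ≤ x → x < x₀ + w → (x, y) ∈ A) (hA : Rk k A) :
    Rk k (Box 0 0 Fc.card Fr.card) := by
  obtain ⟨c, hcm, hc⟩ := exists_enum Fc
  obtain ⟨r, hrm, hr⟩ := exists_enum Fr
  set p : ℤ := (Fc.card : ℤ) with hp_def
  set q : ℤ := (Fr.card : ℤ) with hq_def
  have hin : ∀ i, 0 ≤ i → i < p → ∀ x ∈ Stretch c p i, x₀ ≤ x ∧ x < x₀ + w := by
    rintro i h0 h1 x ⟨hx, hx'⟩
    have := hFc _ (hcm i h0 h1)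
    rcases hx' with rfl | ⟨h2, h3⟩
    · exact this
    · have := hFc _ (hcm (i + 1) (by omega) h2)
      omega
  have hin' : ∀ i, 0 ≤ i → i < q → ∀ x ∈ Stretch r q i, y₀ ≤ x ∧ x < y₀ + h := by
    rintro i h0 h1 x ⟨hx, hx'⟩
    have := hFr _ (hrm i h0 h1)
    rcases hx' with rfl | ⟨h2, h3⟩
    · exact this
    · have := hFr _ (hrm (i + 1) (by omega) h2)
      omega
  -- The branch set of a crossing of two marked lines is the hook that runs from it along both lines
  -- up to the next crossing, exclusive.
  refine hA.minor (fun a => {u | (u.1 ∈ Stretch c p a.1 ∧ u.2 = r a.2) ∨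
    (u.1 = c a.1 ∧ u.2 ∈ Stretch r q a.2)}) ?_ ?_ ?_ ?_ ?_
  · intro a _
    exact ⟨(c a.1, r a.2), Or.inl ⟨stretch_self _ _ _, rfl⟩⟩
  · rintro ⟨i, j⟩ ⟨h1, h2, h3, h4⟩ ⟨x, y⟩ (⟨h5, h6⟩ | ⟨h5, h6⟩) <;> dsimp only at *
    · subst h6
      have := hin i h1 (by omega) x h5
      exact hrow _ (hrm j h3 (by omega)) x this.1 this.2
    · subst h5
      have := hin' j h3 (by omega) y h6
      exact hcol _ (hcm i h1 (by omega)) y this.1 this.2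
  · rintro ⟨i, j⟩ ⟨h1, h2, h3, h4⟩
    have key : ∀ u ∈ {u : Cell | (u.1 ∈ Stretch c p i ∧ u.2 = r j) ∨
        (u.1 = c i ∧ u.2 ∈ Stretch r q j)}, Conn {u : Cell | (u.1 ∈ Stretch c p i ∧ u.2 = r j) ∨
        (u.1 = c i ∧ u.2 ∈ Stretch r q j)} u (c i, r j) := by
      rintro ⟨x, y⟩ (⟨h5, h6⟩ | ⟨h5, h6⟩) <;> dsimp only at h5 h6
      · subst h6
        refine conn_row fun x' hx' => Or.inl ⟨stretch_between h5 ?_ ?_, rfl⟩ <;>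
        · have := h5.1
          dsimp only
          omega
      · subst h5
        refine conn_col fun x' hx' => Or.inr ⟨rfl, stretch_between h6 ?_ ?_⟩ <;>
        · have := h6.1
          dsimp only
          omega
    exact fun u hu v hv => (key u hu).trans (key v hv).symm
  · rintro ⟨i, j⟩ ⟨h1, h2, h3, h4⟩ ⟨i', j'⟩ ⟨h1', h2', h3', h4'⟩ ⟨x, y⟩ hu hv
    have e1 : x ∈ Stretch c p i := by
      rcases hu with ⟨h5, h6⟩ | ⟨h5, h6⟩
      · exact h5
      · dsimp only at h5; rw [h5]; exact stretch_self _ _ _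
    have e2 : x ∈ Stretch c p i' := by
      rcases hv with ⟨h5, h6⟩ | ⟨h5, h6⟩
      · exact h5
      · dsimp only at h5; rw [h5]; exact stretch_self _ _ _
    have e3 : y ∈ Stretch r q j := by
      rcases hu with ⟨h5, h6⟩ | ⟨h5, h6⟩
      · dsimp only at h6; rw [h6]; exact stretch_self _ _ _
      · exact h6
    have e4 : y ∈ Stretch r q j' := by
      rcases hv with ⟨h5, h6⟩ | ⟨h5, h6⟩
      · dsimp only at h6; rw [h6]; exact stretch_self _ _ _
      · exact h6
    dsimp only at *
    exact Prod.ext (stretch_disj hc h1 (by omega) h1' (by omega) e1 e2)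
      (stretch_disj hr h3 (by omega) h3' (by omega) e3 e4)
  · have hx : ∀ i j, 0 ≤ i → i + 1 < p → ∃ u : Cell, ((u.1 ∈ Stretch c p i ∧ u.2 = r j) ∨
        (u.1 = c i ∧ u.2 ∈ Stretch r q j)) ∧ ∃ v : Cell, ((v.1 ∈ Stretch c p (i + 1) ∧ v.2 = r j) ∨
        (v.1 = c (i + 1) ∧ v.2 ∈ Stretch r q j)) ∧ Adj u v := fun i j h0 h1 =>
      ⟨(c (i + 1) - 1, r j), Or.inl ⟨mem_stretch_succ hc h0 h1, rfl⟩, (c (i + 1), r j),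
        Or.inl ⟨stretch_self _ _ _, rfl⟩, by simp [Adj]⟩
    have hy : ∀ i j, 0 ≤ j → j + 1 < q → ∃ u : Cell, ((u.1 ∈ Stretch c p i ∧ u.2 = r j) ∨
        (u.1 = c i ∧ u.2 ∈ Stretch r q j)) ∧ ∃ v : Cell, ((v.1 ∈ Stretch c p i ∧ v.2 = r (j + 1)) ∨
        (v.1 = c i ∧ v.2 ∈ Stretch r q (j + 1))) ∧ Adj u v := fun i j h0 h1 =>
      ⟨(c i, r (j + 1) - 1), Or.inr ⟨rfl, mem_stretch_succ hr h0 h1⟩, (c i, r (j + 1)),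
        Or.inr ⟨rfl, stretch_self _ _ _⟩, by simp [Adj]⟩
    rintro ⟨i, j⟩ ⟨h1, h2, h3, h4⟩ ⟨i', j'⟩ ⟨h1', h2', h3', h4'⟩ hadj
    dsimp only at *
    rcases hadj with ⟨h5, h6 | h6⟩ | ⟨h5, h6 | h6⟩ <;> dsimp only at h5 h6 <;> subst h5 <;> subst h6
    · obtain ⟨u, hu, v, hv, huv⟩ := hy i j' h3' (by omega)
      exact ⟨v, hv, u, hu, huv.symm⟩
    · obtain ⟨u, hu, v, hv, huv⟩ := hy i j h3 (by omega)
      exact ⟨u, hu, v, hv, huv⟩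
    · obtain ⟨u, hu, v, hv, huv⟩ := hx i' j h1' (by omega)
      exact ⟨v, hv, u, hu, huv.symm⟩
    · obtain ⟨u, hu, v, hv, huv⟩ := hx i j h1 (by omega)
      exact ⟨u, hu, v, hv, huv⟩

theorem Rk.translate {k : ℕ} {x y w h : ℤ} (x' y' : ℤ) (hA : Rk k (Box x y w h)) :
    Rk k (Box x' y' w h) := by
  refine hA.comap (fun p => (p.1 + (x - x'), p.2 + (y - y'))) ?_ ?_ ?_
  · rintro a ⟨h1, h2, h3, h4⟩
    refine ⟨?_, ?_, ?_, ?_⟩ <;> dsimp only <;> omega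
  · intro a _ b _ hab
    simp only [Prod.mk.injEq] at hab
    exact Prod.ext (by omega) (by omega)
  · intro a b hab
    unfold Adj at *
    dsimp only
    omega

theorem isConn_box (x y w h : ℤ) : IsConn (Box x y w h) := by
  rintro ⟨p1, p2⟩ ⟨h1, h2, h3, h4⟩ ⟨q1, q2⟩ ⟨h1', h2', h3', h4'⟩
  dsimp only at *
  refine Conn.trans (q := (q1, p2)) (conn_row fun x' hx' => ?_) (conn_col fun y' hy' => ?_)
  · exact ⟨by dsimp only; omega, by dsimp only; omega, h3, h4⟩
  · exact ⟨h1', h2', by dsimp only; omega, by dsimp only; omega⟩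

/-- Deleting the top cell saves a label, and the rows and columns missing that cell still form an `n
× n` grid minor. -/
theorem gridRank_succ (n : ℕ) : gridRank n n + 1 ≤ gridRank (n + 1) (n + 1) := by
  have h := rk_gridRank (n + 1)
  obtain ⟨k, hk⟩ : ∃ k, gridRank (n + 1) (n + 1) = k + 1 := by
    have := h.pos (p := (0, 0)) ⟨le_rfl, by simp, le_rfl, by simp⟩
    exact ⟨gridRank (n + 1) (n + 1) - 1, by omega⟩
  rw [hk] at h ⊢
  obtain ⟨v, hv, h⟩ := h.exists_top (isConn_box _ _ _ _) ⟨(0, 0), le_rfl, by simp, le_rfl, by simp⟩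
  have hcard : ∀ a : ℤ, 0 ≤ a → a < n + 1 → ((Finset.Ico (0 : ℤ) (n + 1)).erase a).card = n := by
    intro a h0 h1
    rw [Finset.card_erase_of_mem (by simp; omega)]
    simp
  obtain ⟨h1, h2, h3, h4⟩ := hv
  have := h.lines (x₀ := 0) (y₀ := 0) (w := n + 1) (h := n + 1)
    ((Finset.Ico (0 : ℤ) (n + 1)).erase v.1) ((Finset.Ico (0 : ℤ) (n + 1)).erase v.2)
    (by simp) (by simp) ?_ ?_
  · rw [hcard _ h1 (by push_cast at h2; omega), hcard _ h3 (by push_cast at h4; omega)] at this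
    have := gridRank_le_of_rk this
    omega
  · intro x hx y hy hy'
    simp only [Finset.mem_erase, Finset.mem_Ico] at hx
    refine ⟨⟨hx.2.1, by push_cast; simp; omega, hy, by push_cast; exact hy'⟩, ?_⟩
    rintro rfl
    exact hx.1 rfl
  · intro x hx y hy hy'
    simp only [Finset.mem_erase, Finset.mem_Ico] at hx
    refine ⟨⟨hy, by push_cast; exact hy', hx.2.1, by push_cast; simp; omega⟩, ?_⟩
    rintro rfl
    exact hx.1 rfl

theorem gridRank_add_le (n d : ℕ) : gridRank n n + d ≤ gridRank (n + d) (n + d) := by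
  induction d with
  | zero => simp
  | succ d ih =>
    have := gridRank_succ (n + d)
    rw [← add_assoc, ← add_assoc]
    omega

end GridRank

namespace GridRank

/-! ### Counting hits around a single pocket -/

theorem finite_box (x y w h : ℤ) : (Box x y w h).Finite :=
  (Set.finite_Icc (x, y) (x + w, y + h)).subset fun _ hp =>
    ⟨⟨hp.1, hp.2.2.1⟩, ⟨hp.2.1.le, hp.2.2.2.le⟩⟩

theorem card_ge_of_cols (F : Finset Cell) (a b : ℤ)
    (h : ∀ x, a ≤ x → x < b → ∃ y, (x, y) ∈ F) : b - a ≤ F.card := by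
  have h1 : Finset.Ico a b ⊆ F.image Prod.fst := by
    intro x hx
    rw [Finset.mem_Ico] at hx
    obtain ⟨y, hy⟩ := h x hx.1 hx.2
    exact Finset.mem_image.2 ⟨_, hy, rfl⟩
  have h2 := Finset.card_le_card h1
  have h3 : (F.image Prod.fst).card ≤ F.card := Finset.card_image_le
  rw [Int.card_Ico] at h2
  omega

theorem card_ge_of_rows (F : Finset Cell) (a b : ℤ)
    (h : ∀ y, a ≤ y → y < b → ∃ x, (x, y) ∈ F) : b - a ≤ F.card := by
  have := card_ge_of_cols (F.image Prod.swap) a b fun y h1 h2 => by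
    obtain ⟨x, hx⟩ := h y h1 h2
    exact ⟨x, Finset.mem_image.2 ⟨_, hx, rfl⟩⟩
  rwa [Finset.card_image_of_injective _ Prod.swap_injective] at this

theorem card_add_le_of_disjoint {F G S : Finset Cell} (hF : F ⊆ S) (hG : G ⊆ S)
    (h : ∀ s ∈ F, s ∉ G) : (F.card : ℤ) + G.card ≤ S.card := by
  rw [← Nat.cast_add, ← Finset.card_union_of_disjoint (Finset.disjoint_left.2 h)]
  exact_mod_cast Finset.card_le_card (Finset.union_subset hF hG)

theorem IsConn.exists_col {K : Set Cell} (hK : IsConn K) {u v : Cell} (hu : u ∈ K) (hv : v ∈ K)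
    {x : ℤ} (h1 : u.1 ≤ x) (h2 : x ≤ v.1) : ∃ y, (x, y) ∈ K := by
  rcases eq_or_lt_of_le h1 with rfl | h1
  · exact ⟨u.2, hu⟩
  obtain ⟨⟨a, b⟩, ⟨c, d⟩, hab, -, hb, ha', hb'⟩ := (hK u hu v hv).exit (B := {p | p.1 < x}) h1
    (not_lt.2 h2)
  have : c = x := by
    simp only [Adj, Set.mem_ofPred_eq] at *
    omega
  exact ⟨d, this ▸ hb⟩

/-- The mirror image of a set of cells under the exchange of coordinates. -/
def tr (K : Set Cell) : Set Cell := {p | p.swap ∈ K}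

theorem IsConn.preimage {K : Set Cell} (hK : IsConn K) (φ : Cell → Cell) (hφ : ∀ p, φ (φ p) = p)
    (hadj : ∀ a b, Adj a b → Adj (φ a) (φ b)) : IsConn {p | φ p ∈ K} := by
  intro p hp q hq
  have := (hK _ hp _ hq).map (B := {p | φ p ∈ K}) φ hadj fun a ha => by
    rw [Set.mem_ofPred_eq, hφ]; exact ha
  rwa [hφ, hφ] at this

theorem IsConn.tr {K : Set Cell} (hK : IsConn K) : IsConn (tr K) :=
  hK.preimage Prod.swap Prod.swap_swap fun _ _ h => h.swap

theorem IsConn.exists_row {K : Set Cell} (hK : IsConn K) {u v : Cell} (hu : u ∈ K) (hv : v ∈ K)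
    {y : ℤ} (h1 : u.2 ≤ y) (h2 : y ≤ v.2) : ∃ x, (x, y) ∈ K :=
  hK.tr.exists_col (u := u.swap) (v := v.swap) hu hv h1 h2

/-- If a cell `w` lies just above the top of `K` in its column and just right of the end of `K` in
its row, then `K` has no cell to the upper right of `w`. -/
theorem IsConn.no_upper_right {K : Set Cell} (hK : IsConn K) {w : Cell} (hw : (w.1, w.2 - 1) ∈ K)
    (h1 : ∀ u ∈ K, u.1 = w.1 → u.2 < w.2) (h2 : ∀ u ∈ K, u.2 = w.2 → u.1 < w.1) {p : Cell}
    (hp : p ∈ K) : ¬ (w.1 ≤ p.1 ∧ w.2 ≤ p.2) := by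
  intro h
  -- A walk of `K` leaves the quadrant through its left column, which `h1` forbids, or through its
  -- bottom row, which `h2` forbids.
  obtain ⟨u, v, huv, hu, hv, hu', hv'⟩ := (hK p hp _ hw).exit
    (B := {p | w.1 ≤ p.1 ∧ w.2 ≤ p.2}) h (fun h => by have := h.2; dsimp only at this; omega)
  have h3 := h1 u hu
  have h4 := h2 u hu
  simp only [Adj, Set.mem_ofPred_eq] at *
  omega

/-- A component of a square minus the hits `S` that avoids a free column and a free row. -/
structure Pocket (x₀ y₀ b : ℤ) (S : Finset Cell) (K : Set Cell) : Prop where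
  sub : K ⊆ Box x₀ y₀ b b
  disj : ∀ u ∈ K, u ∉ S
  conn : IsConn K
  bdry : ∀ u ∈ K, ∀ v ∈ Box x₀ y₀ b b, Adj u v → v ∉ K → v ∈ S
  col : ∃ γ, x₀ ≤ γ ∧ γ < x₀ + b ∧ (∀ s ∈ S, s.1 ≠ γ) ∧ ∀ u ∈ K, u.1 ≠ γ
  row : ∃ ϱ, y₀ ≤ ϱ ∧ ϱ < y₀ + b ∧ (∀ s ∈ S, s.2 ≠ ϱ) ∧ ∀ u ∈ K, u.2 ≠ ϱ

variable {x₀ y₀ b : ℤ} {S : Finset Cell} {K : Set Cell}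

/-- The hits just above the top cell of `K` in their column. -/
def Above (S : Finset Cell) (K : Set Cell) (s : Cell) : Prop :=
  s ∈ S ∧ (s.1, s.2 - 1) ∈ K ∧ ∀ u ∈ K, u.1 = s.1 → u.2 < s.2

/-- The hits just below the bottom cell of `K` in their column. -/
def Below (S : Finset Cell) (K : Set Cell) (s : Cell) : Prop :=
  s ∈ S ∧ (s.1, s.2 + 1) ∈ K ∧ ∀ u ∈ K, u.1 = s.1 → s.2 < u.2

/-- The hits just right of the last cell of `K` in their row. -/
def RightOf (S : Finset Cell) (K : Set Cell) (s : Cell) : Prop :=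
  s ∈ S ∧ (s.1 - 1, s.2) ∈ K ∧ ∀ u ∈ K, u.2 = s.2 → u.1 < s.1

/-- The hits just left of the first cell of `K` in their row. -/
def LeftOf (S : Finset Cell) (K : Set Cell) (s : Cell) : Prop :=
  s ∈ S ∧ (s.1 + 1, s.2) ∈ K ∧ ∀ u ∈ K, u.2 = s.2 → s.1 < u.1

/-- The topmost cell of `K` in the column is not in the last row, so the cell above it lies in the
box outside `K`, hence in `S`. -/
theorem exists_above {X Y W H : ℤ} (sub : K ⊆ Box X Y W H)
    (bdry : ∀ u ∈ K, ∀ v ∈ Box X Y W H, Adj u v → v ∉ K → v ∈ S)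
    (h : ∀ u ∈ K, u.2 < Y + H - 1) {u : Cell} (hu : u ∈ K) : ∃ y, Above S K (u.1, y) := by
  obtain ⟨v, ⟨hv, hv1⟩, hmax⟩ := Set.exists_max_image {v | v ∈ K ∧ v.1 = u.1} Prod.snd
    ((finite_box X Y W H).subset fun v hv => sub hv.1) ⟨u, hu, rfl⟩
  have hlt : ∀ w ∈ K, w.1 = u.1 → w.2 < v.2 + 1 := fun w hw hw1 => by
    have := hmax w ⟨hw, hw1⟩
    omega
  refine ⟨v.2 + 1, ?_, ?_, hlt⟩
  · obtain ⟨h1, h2, h3, h4⟩ := sub hv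
    have := h v hv
    refine bdry v hv _ ⟨?_, ?_, ?_, ?_⟩ ?_ ?_
    · dsimp only; omega
    · dsimp only; omega
    · dsimp only; omega
    · dsimp only; omega
    · exact Or.inl ⟨hv1, by dsimp only; omega⟩
    · intro hmem
      exact lt_irrefl _ (hlt _ hmem rfl)
  · rw [← hv1]
    simpa using hv

theorem exists_below {X Y W H : ℤ} (sub : K ⊆ Box X Y W H)
    (bdry : ∀ u ∈ K, ∀ v ∈ Box X Y W H, Adj u v → v ∉ K → v ∈ S)
    (h : ∀ u ∈ K, Y < u.2) {u : Cell} (hu : u ∈ K) : ∃ y, Below S K (u.1, y) := by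
  obtain ⟨v, ⟨hv, hv1⟩, hmax⟩ := Set.exists_min_image {v | v ∈ K ∧ v.1 = u.1} Prod.snd
    ((finite_box X Y W H).subset fun v hv => sub hv.1) ⟨u, hu, rfl⟩
  have hlt : ∀ w ∈ K, w.1 = u.1 → v.2 - 1 < w.2 := fun w hw hw1 => by
    have := hmax w ⟨hw, hw1⟩
    omega
  refine ⟨v.2 - 1, ?_, ?_, hlt⟩
  · obtain ⟨h1, h2, h3, h4⟩ := sub hv
    have := h v hv
    refine bdry v hv _ ⟨?_, ?_, ?_, ?_⟩ ?_ ?_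
    · dsimp only; omega
    · dsimp only; omega
    · dsimp only; omega
    · dsimp only; omega
    · exact Or.inl ⟨hv1, by dsimp only; omega⟩
    · intro hmem
      exact lt_irrefl _ (hlt _ hmem rfl)
  · rw [← hv1]
    simpa using hv

theorem tr_box {X Y W H : ℤ} {p : Cell} : p.swap ∈ Box X Y W H ↔ p ∈ Box Y X H W := by
  simp only [mem_Box, Prod.fst_swap, Prod.snd_swap]; omega

theorem mem_image_swap {p : Cell} : p ∈ S.image Prod.swap ↔ p.swap ∈ S := by
  simp only [Finset.mem_image]
  constructor
  · rintro ⟨a, ha, rfl⟩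
    simpa using ha
  · intro h
    exact ⟨_, h, by simp⟩

theorem exists_rightOf {X Y W H : ℤ} (sub : K ⊆ Box X Y W H)
    (bdry : ∀ u ∈ K, ∀ v ∈ Box X Y W H, Adj u v → v ∉ K → v ∈ S)
    (h : ∀ u ∈ K, u.1 < X + W - 1) {u : Cell} (hu : u ∈ K) : ∃ x, RightOf S K (x, u.2) := by
  obtain ⟨x, h1, h2, h3⟩ := exists_above (K := tr K) (S := S.image Prod.swap) (X := Y) (Y := X)
    (W := H) (H := W) (fun p hp => tr_box.1 (sub hp)) (fun u hu v hv huv hvK =>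
      mem_image_swap.2 (bdry u.swap hu v.swap (tr_box.2 hv) huv.swap hvK)) (fun u hu => h _ hu)
    (u := u.swap) hu
  exact ⟨x, mem_image_swap.1 h1, h2, fun v hv hv' => h3 v.swap hv hv'⟩

theorem exists_leftOf {X Y W H : ℤ} (sub : K ⊆ Box X Y W H)
    (bdry : ∀ u ∈ K, ∀ v ∈ Box X Y W H, Adj u v → v ∉ K → v ∈ S)
    (h : ∀ u ∈ K, X < u.1) {u : Cell} (hu : u ∈ K) : ∃ x, LeftOf S K (x, u.2) := by
  obtain ⟨x, h1, h2, h3⟩ := exists_below (K := tr K) (S := S.image Prod.swap) (X := Y) (Y := X)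
    (W := H) (H := W) (fun p hp => tr_box.1 (sub hp)) (fun u hu v hv huv hvK =>
      mem_image_swap.2 (bdry u.swap hu v.swap (tr_box.2 hv) huv.swap hvK)) (fun u hu => h _ hu)
    (u := u.swap) hu
  exact ⟨x, mem_image_swap.1 h1, h2, fun v hv hv' => h3 v.swap hv hv'⟩

namespace Pocket

theorem tr (h : Pocket x₀ y₀ b S K) : Pocket y₀ x₀ b (S.image Prod.swap) (tr K) where
  sub p hp := tr_box.1 (h.sub hp)
  disj p hp hs := h.disj _ hp (mem_image_swap.1 hs)
  conn := h.conn.tr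
  bdry u hu v hv huv hvK :=
    mem_image_swap.2 (h.bdry u.swap hu v.swap (tr_box.2 hv) huv.swap hvK)
  col := by
    obtain ⟨γ, h1, h2, h3, h4⟩ := h.row
    exact ⟨γ, h1, h2, fun s hs => h3 s.swap (mem_image_swap.1 hs), fun u hu => h4 u.swap hu⟩
  row := by
    obtain ⟨γ, h1, h2, h3, h4⟩ := h.col
    exact ⟨γ, h1, h2, fun s hs => h3 s.swap (mem_image_swap.1 hs), fun u hu => h4 u.swap hu⟩

/-- If `K` touches neither vertical side, then every row it meets has two hits. -/
theorem two_mul_rows_le (h : Pocket x₀ y₀ b S K) (hl : ∀ u ∈ K, x₀ < u.1)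
    (hr : ∀ u ∈ K, u.1 < x₀ + b - 1) {d t : ℤ} (hdt : ∀ y, d ≤ y → y < t → ∃ x, (x, y) ∈ K) :
    2 * (t - d) ≤ S.card := by
  classical
  have h1 := card_ge_of_rows (S.filter (LeftOf S K)) d t fun y h1 h2 => by
    obtain ⟨x, hx⟩ := hdt y h1 h2
    obtain ⟨x', hx'⟩ := exists_leftOf h.sub h.bdry hl hx
    exact ⟨x', Finset.mem_filter.2 ⟨hx'.1, hx'⟩⟩
  have h2 := card_ge_of_rows (S.filter (RightOf S K)) d t fun y h1 h2 => by
    obtain ⟨x, hx⟩ := hdt y h1 h2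
    obtain ⟨x', hx'⟩ := exists_rightOf h.sub h.bdry hr hx
    exact ⟨x', Finset.mem_filter.2 ⟨hx'.1, hx'⟩⟩
  have h3 := card_add_le_of_disjoint (Finset.filter_subset (LeftOf S K) S)
    (Finset.filter_subset (RightOf S K) S) fun s hs hs' => by
      obtain ⟨-, -, h3, -⟩ := Finset.mem_filter.1 hs
      obtain ⟨-, -, -, h4⟩ := Finset.mem_filter.1 hs'
      have := h4 _ h3 rfl
      dsimp only at this
      omega
  omega

theorem two_mul_width_le (h : Pocket x₀ y₀ b S K) (hd : ∀ u ∈ K, y₀ < u.2)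
    (ht : ∀ u ∈ K, u.2 < y₀ + b - 1) {u v : Cell} (hu : u ∈ K) (hv : v ∈ K) :
    2 * (v.1 - u.1 + 1) ≤ S.card := by
  have := h.tr.two_mul_rows_le (fun u hu => hd _ hu) (fun u hu => ht _ hu) (d := u.1)
    (t := v.1 + 1) fun y h1 h2 => by
      obtain ⟨x, hx⟩ := h.conn.exists_col hu hv h1 (by omega)
      exact ⟨x, hx⟩
  rw [Finset.card_image_of_injective _ Prod.swap_injective] at this
  omega

theorem two_mul_height_le (h : Pocket x₀ y₀ b S K) (hl : ∀ u ∈ K, x₀ < u.1)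
    (hr : ∀ u ∈ K, u.1 < x₀ + b - 1) {u v : Cell} (hu : u ∈ K) (hv : v ∈ K) :
    2 * (v.2 - u.2 + 1) ≤ S.card := by
  have := h.two_mul_rows_le hl hr (d := u.2) (t := v.2 + 1) fun y h1 h2 =>
    h.conn.exists_row hu hv h1 (by omega)
  omega

/-- A cell of the square is within distance one of its own point reflection only through many
hits: the case of a pocket touching neither vertical side. -/
theorem not_near_anti_of_misses (h : Pocket x₀ y₀ b S K) (hS : 3 * (S.card : ℤ) ≤ 2 * b)
    (hb : 0 < b)
    (hl : ∀ u ∈ K, x₀ < u.1) (hr : ∀ u ∈ K, u.1 < x₀ + b - 1) (ht : ∀ u ∈ K, u.2 < y₀ + b - 1)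
    (hlarge : ∃ u ∈ K, ∃ v ∈ K, b + 1 ≤ S.card + (v.1 - u.1 + 1) ∨
      b + 1 ≤ S.card + (v.2 - u.2 + 1)) {p v : Cell} (hp : p ∈ K) (hv : v ∈ K) :
    2 * y₀ + b - 2 ≤ p.2 + v.2 → False := by
  intro hpv
  obtain ⟨a, ha, c, hc, hac⟩ := hlarge
  have h1 := h.two_mul_height_le hl hr ha hc
  -- The height is at most |S|/2. If the bottom were missed too, so would be the width, and b + 1 ≤
  -- 3|S|/2 ≤ b. So the pocket touches the bottom, and `p` and `v` both have height at most |S|/2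
  -- above it, too little to be near each other's reflection.
  obtain ⟨d, hd, hd'⟩ : ∃ d ∈ K, d.2 = y₀ := by
    by_contra hcon
    push Not at hcon
    have h2 := h.two_mul_width_le (fun u hu => lt_of_le_of_ne (h.sub hu).2.2.1 (hcon u hu).symm) ht
      ha hc
    omega
  have h2 := h.two_mul_height_le hl hr hd hp
  have h3 := h.two_mul_height_le hl hr hd hv
  omega

/-- A pocket that touches the left and the bottom side is cut off by a staircase of hits, which
keeps it below the antidiagonal through the centre. The other positions reduce to a pocket missing
two opposite sides. -/
theorem not_near_anti_of_misses_upper_right (h : Pocket x₀ y₀ b S K)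
    (hS : 3 * (S.card : ℤ) ≤ 2 * b) (hb : 0 < b)
    (hr : ∀ u ∈ K, u.1 < x₀ + b - 1) (ht : ∀ u ∈ K, u.2 < y₀ + b - 1)
    (hlarge : ∃ u ∈ K, ∃ v ∈ K, b + 1 ≤ S.card + (v.1 - u.1 + 1) ∨
      b + 1 ≤ S.card + (v.2 - u.2 + 1)) {p v : Cell} (hp : p ∈ K) (hv : v ∈ K)
    (h1 : 2 * x₀ + b - 2 ≤ p.1 + v.1) (h2 : 2 * y₀ + b - 2 ≤ p.2 + v.2)
    (h3 : 2 * x₀ + 2 * y₀ + 2 * b - 3 ≤ p.1 + v.1 + p.2 + v.2) : False := by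
  classical
  by_cases hl : ∀ u ∈ K, x₀ < u.1
  · exact h.not_near_anti_of_misses hS hb hl hr ht hlarge hp hv h2
  by_cases hd : ∀ u ∈ K, y₀ < u.2
  · have hc : (S.image Prod.swap).card = S.card :=
      Finset.card_image_of_injective _ Prod.swap_injective
    obtain ⟨a, ha, c, hc', hac⟩ := hlarge
    refine h.tr.not_near_anti_of_misses (by rwa [hc]) hb (fun u hu => hd _ hu)
      (fun u hu => ht _ hu) (fun u hu => hr _ hu) ⟨a.swap, ha, c.swap, hc', ?_⟩ (p := p.swap)
      (v := v.swap) hp hv h1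
    rw [hc]
    exact hac.symm
  push Not at hl hd
  obtain ⟨l, hl, hl'⟩ := hl
  obtain ⟨d, hd, hd'⟩ := hd
  -- Every column up to `p` has a hit above `K` and every row up to `p` a hit to the right of `K`. A
  -- hit playing both roles would have `p` to its upper right.
  have key : ∀ p ∈ K, (p.1 - x₀ + 1) + (p.2 - y₀ + 1) ≤ S.card := by
    intro p hp
    have h1 := card_ge_of_cols (S.filter fun s => s.1 ≤ p.1 ∧ Above S K s) x₀ (p.1 + 1)
      fun x h1 h2 => by
        obtain ⟨y, hy⟩ := h.conn.exists_col hl hp (hl'.trans h1) (by omega)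
        obtain ⟨y', hy'⟩ := exists_above h.sub h.bdry ht hy
        exact ⟨y', Finset.mem_filter.2 ⟨hy'.1, by dsimp only; omega, hy'⟩⟩
    have h2 := card_ge_of_rows (S.filter fun s => s.2 ≤ p.2 ∧ RightOf S K s) y₀ (p.2 + 1)
      fun x h1 h2 => by
        obtain ⟨y, hy⟩ := h.conn.exists_row hd hp (hd'.trans h1) (by omega)
        obtain ⟨y', hy'⟩ := exists_rightOf h.sub h.bdry hr hy
        exact ⟨y', Finset.mem_filter.2 ⟨hy'.1, by dsimp only; omega, hy'⟩⟩
    have h3 := card_add_le_of_disjoint (Finset.filter_subset (fun s => s.1 ≤ p.1 ∧ Above S K s) S)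
      (Finset.filter_subset (fun s => s.2 ≤ p.2 ∧ RightOf S K s) S) fun s hs hs' => by
        obtain ⟨-, h4, -, h5, h6⟩ := Finset.mem_filter.1 hs
        obtain ⟨-, h7, -, h8, h9⟩ := Finset.mem_filter.1 hs'
        exact h.conn.no_upper_right h5 h6 h9 hp ⟨h4, h7⟩
    omega
  have h4 := key p hp
  have h5 := key v hv
  omega

/-- The symmetry has to act on each coordinate separately for the free column and the free row to
stay lines of the same kind. -/
theorem preimage (h : Pocket x₀ y₀ b S K) {φ : Cell → Cell} (hφ : ∀ p, φ (φ p) = p)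
    (hadj : ∀ a b, Adj a b → Adj (φ a) (φ b)) (hQ : ∀ p ∈ Box x₀ y₀ b b, φ p ∈ Box x₀ y₀ b b)
    (α β : ℤ → ℤ) (hα : ∀ x, α (α x) = x) (hβ : ∀ x, β (β x) = x) (hαβ : ∀ p, φ p = (α p.1, β p.2)) :
    Pocket x₀ y₀ b (S.image φ) {p | φ p ∈ K} := by
  have hmem : ∀ p, p ∈ S.image φ ↔ φ p ∈ S := by
    intro p
    simp only [Finset.mem_image]
    constructor
    · rintro ⟨a, ha, rfl⟩
      rwa [hφ]
    · exact fun h => ⟨_, h, hφ p⟩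
  refine ⟨fun p hp => ?_, fun p hp hs => h.disj _ hp ((hmem p).1 hs), h.conn.preimage φ hφ hadj,
    fun u hu v hv huv hvK => (hmem v).2 (h.bdry _ hu _ (hQ v hv) (hadj _ _ huv) hvK), ?_, ?_⟩
  · have := hQ _ (h.sub hp)
    rwa [hφ] at this
  · obtain ⟨γ, h1, h2, h3, h4⟩ := h.col
    obtain ⟨ϱ, h1', h2', -, -⟩ := h.row
    have := hQ (γ, ϱ) ⟨h1, h2, h1', h2'⟩
    rw [hαβ] at this
    refine ⟨α γ, this.1, this.2.1, fun s hs he => h3 _ ((hmem s).1 hs) ?_, fun u hu he =>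
      h4 _ hu ?_⟩ <;> rw [hαβ] <;> dsimp only <;> rw [he, hα]
  · obtain ⟨γ, h1, h2, -, -⟩ := h.col
    obtain ⟨ϱ, h1', h2', h3, h4⟩ := h.row
    have := hQ (γ, ϱ) ⟨h1, h2, h1', h2'⟩
    rw [hαβ] at this
    refine ⟨β ϱ, this.2.2.1, this.2.2.2, fun s hs he => h3 _ ((hmem s).1 hs) ?_, fun u hu he =>
      h4 _ hu ?_⟩ <;> rw [hαβ] <;> dsimp only <;> rw [he, hβ]

/-- A connected set touching both sides would cross the free column. -/
theorem left_or_right (h : Pocket x₀ y₀ b S K) :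
    (∀ u ∈ K, x₀ < u.1) ∨ ∀ u ∈ K, u.1 < x₀ + b - 1 := by
  obtain ⟨γ, h1, h2, -, h3⟩ := h.col
  by_contra hcon
  push Not at hcon
  obtain ⟨⟨u, hu, hu'⟩, v, hv, hv'⟩ := hcon
  obtain ⟨y, hy⟩ := h.conn.exists_col hu hv (x := γ) (by omega) (by omega)
  exact h3 _ hy rfl

theorem bottom_or_top (h : Pocket x₀ y₀ b S K) :
    (∀ u ∈ K, y₀ < u.2) ∨ ∀ u ∈ K, u.2 < y₀ + b - 1 :=
  h.tr.left_or_right.imp (fun h u hu => h u.swap hu) (fun h u hu => h u.swap hu)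

/-- A large pocket is disjoint and non-adjacent from its own point reflection. -/
theorem not_near_anti (h : Pocket x₀ y₀ b S K) (hS : 3 * (S.card : ℤ) ≤ 2 * b) (hb : 0 < b)
    (hlarge : ∃ u ∈ K, ∃ v ∈ K, b + 1 ≤ S.card + (v.1 - u.1 + 1) ∨
      b + 1 ≤ S.card + (v.2 - u.2 + 1)) {p v : Cell} (hp : p ∈ K) (hv : v ∈ K)
    (hpv : (2 * x₀ + b - 1 - p.1, 2 * y₀ + b - 1 - p.2) = v ∨
      Adj (2 * x₀ + b - 1 - p.1, 2 * y₀ + b - 1 - p.2) v) : False := by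
  have hinj : ∀ φ : Cell → Cell, (∀ p, φ (φ p) = p) → (S.image φ).card = S.card := fun φ hφ =>
    Finset.card_image_of_injective _ (Function.LeftInverse.injective hφ)
  obtain ⟨a, ha, c, hc, hac⟩ := hlarge
  have hpv' : (p.1 + v.1 = 2 * x₀ + b - 1 ∧ 2 * y₀ + b - 2 ≤ p.2 + v.2 ∧ p.2 + v.2 ≤ 2 * y₀ + b) ∨
      (p.2 + v.2 = 2 * y₀ + b - 1 ∧ 2 * x₀ + b - 2 ≤ p.1 + v.1 ∧ p.1 + v.1 ≤ 2 * x₀ + b) := by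
    simp only [Adj, Prod.ext_iff] at hpv
    omega
  clear hpv
  -- A reflection moves the missed sides to the right and the top. It commutes with the point
  -- reflection, and a largest extent may have its end cells exchanged.
  have hflip : ∀ φ : Cell → Cell, ((φ = fun p => (2 * x₀ + b - 1 - p.1, p.2)) ∨
      (φ = fun p => (p.1, 2 * y₀ + b - 1 - p.2)) ∨
      (φ = fun p => (2 * x₀ + b - 1 - p.1, 2 * y₀ + b - 1 - p.2))) →
      (∀ u, φ u ∈ K → u.1 < x₀ + b - 1) → (∀ u, φ u ∈ K → u.2 < y₀ + b - 1) → False := by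
    intro φ hφ hr ht
    have hφφ : ∀ p, φ (φ p) = p := by
      intro p
      rcases hφ with rfl | rfl | rfl <;> ext <;> dsimp only <;> omega
    have hp' : Pocket x₀ y₀ b (S.image φ) {p | φ p ∈ K} := by
      rcases hφ with rfl | rfl | rfl
      · refine h.preimage hφφ ?_ ?_ (fun x => 2 * x₀ + b - 1 - x) (fun y => y) ?_ ?_ ?_
        · intro a b hab; unfold Adj at *; dsimp only; omega
        · rintro p ⟨h1, h2, h3, h4⟩
          refine ⟨?_, ?_, ?_, ?_⟩ <;> dsimp only <;> omega
        all_goals intros; first | rfl | omega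
      · refine h.preimage hφφ ?_ ?_ (fun x => x) (fun y => 2 * y₀ + b - 1 - y) ?_ ?_ ?_
        · intro a b hab; unfold Adj at *; dsimp only; omega
        · rintro p ⟨h1, h2, h3, h4⟩
          refine ⟨?_, ?_, ?_, ?_⟩ <;> dsimp only <;> omega
        all_goals intros; first | rfl | omega
      · refine h.preimage hφφ ?_ ?_ (fun x => 2 * x₀ + b - 1 - x) (fun y => 2 * y₀ + b - 1 - y)
          ?_ ?_ ?_
        · intro a b hab; unfold Adj at *; dsimp only; omega
        · rintro p ⟨h1, h2, h3, h4⟩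
          refine ⟨?_, ?_, ?_, ?_⟩ <;> dsimp only <;> omega
        all_goals intros; first | rfl | omega
    have hm : ∀ u ∈ K, φ u ∈ {p | φ p ∈ K} := fun u hu => by
      rw [Set.mem_ofPred_eq, hφφ]; exact hu
    have hcard := hinj φ hφφ
    have hcases : ((φ a).1 = a.1 ∧ (φ c).1 = c.1 ∨ (φ a).1 = 2 * x₀ + b - 1 - a.1 ∧
          (φ c).1 = 2 * x₀ + b - 1 - c.1) ∧ ((φ a).2 = a.2 ∧ (φ c).2 = c.2 ∨
          (φ a).2 = 2 * y₀ + b - 1 - a.2 ∧ (φ c).2 = 2 * y₀ + b - 1 - c.2) := by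
      rcases hφ with rfl | rfl | rfl <;> simp
    have hlarge : ∃ u ∈ {p | φ p ∈ K}, ∃ v ∈ {p | φ p ∈ K},
        b + 1 ≤ (S.image φ).card + (v.1 - u.1 + 1) ∨
        b + 1 ≤ (S.image φ).card + (v.2 - u.2 + 1) := by
      rw [hcard]
      rcases hac with hac | hac
      · rcases hcases.1 with h1 | h1
        · exact ⟨φ a, hm a ha, φ c, hm c hc, by omega⟩
        · exact ⟨φ c, hm c hc, φ a, hm a ha, by omega⟩
      · rcases hcases.2 with h1 | h1
        · exact ⟨φ a, hm a ha, φ c, hm c hc, by omega⟩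
        · exact ⟨φ c, hm c hc, φ a, hm a ha, by omega⟩
    refine hp'.not_near_anti_of_misses_upper_right (by rwa [hcard]) hb hr ht hlarge (hm p hp)
      (hm v hv) ?_ ?_ ?_ <;> rcases hφ with rfl | rfl | rfl <;> dsimp only <;> omega
  rcases h.left_or_right with hl | hr <;> rcases h.bottom_or_top with hd | ht
  · refine hflip _ (Or.inr (Or.inr rfl)) (fun u hu => ?_) (fun u hu => ?_)
    · have := hl _ hu; dsimp only at this; omega
    · have := hd _ hu; dsimp only at this; omega
  · refine hflip _ (Or.inl rfl) (fun u hu => ?_) (fun u hu => ?_)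
    · have := hl _ hu; dsimp only at this; omega
    · have := ht _ hu; dsimp only at this; omega
  · refine hflip _ (Or.inr (Or.inl rfl)) (fun u hu => ?_) (fun u hu => ?_)
    · have := hr _ hu; dsimp only at this; omega
    · have := hd _ hu; dsimp only at this; omega
  · exact h.not_near_anti_of_misses_upper_right hS hb hr ht ⟨a, ha, c, hc, hac⟩ hp hv
      (by omega) (by omega) (by omega)

end Pocket

end GridRank

namespace GridRank

/-! ### Two pockets in one square -/

variable {x₀ y₀ b : ℤ} {S : Finset Cell} {K : Set Cell}

namespace Pocket

variable {K' : Set Cell}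

/-- Each pocket lies on one side of the free row, and each of its columns has a hit on the side
facing that row. Such a hit determines the cell behind it, so disjoint pockets do not share one. -/
theorem width_add_width_le (h : Pocket x₀ y₀ b S K) (h' : Pocket x₀ y₀ b S K')
    (hdisj : ∀ u ∈ K, u ∉ K') {ϱ : ℤ} (h0 : y₀ ≤ ϱ) (h1 : ϱ < y₀ + b) (hS : ∀ s ∈ S, s.2 ≠ ϱ)
    (hK : ∀ u ∈ K, u.2 ≠ ϱ) (hK' : ∀ u ∈ K', u.2 ≠ ϱ) {u v u' v' : Cell} (hu : u ∈ K) (hv : v ∈ K)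
    (hu' : u' ∈ K') (hv' : v' ∈ K') : (v.1 - u.1 + 1) + (v'.1 - u'.1 + 1) ≤ S.card := by
  classical
  have key : ∀ K : Set Cell, Pocket x₀ y₀ b S K → (∀ u ∈ K, u.2 ≠ ϱ) → ∀ u ∈ K, ∀ v ∈ K,
      v.1 - u.1 + 1 ≤ (S.filter fun s => (s.2 < ϱ ∧ (s.1, s.2 - 1) ∈ K) ∨
        (ϱ < s.2 ∧ (s.1, s.2 + 1) ∈ K)).card := by
    intro K h hK u hu v hv
    have := card_ge_of_cols (S.filter fun s => (s.2 < ϱ ∧ (s.1, s.2 - 1) ∈ K) ∨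
        (ϱ < s.2 ∧ (s.1, s.2 + 1) ∈ K)) u.1 (v.1 + 1) fun x hx hx' => by
      obtain ⟨y, hy⟩ := h.conn.exists_col hu hv hx (by omega)
      by_cases hlt : ∀ u ∈ K, u.2 < ϱ
      · obtain ⟨y', h2, h3, -⟩ := exists_above h.sub h.bdry
          (fun u hu => by have := hlt u hu; omega) hy
        have h4 := hlt _ h3
        have h5 := hS _ h2
        dsimp only at h2 h3 h4 h5
        exact ⟨y', Finset.mem_filter.2 ⟨h2, Or.inl ⟨by dsimp only; omega, h3⟩⟩⟩
      · push Not at hlt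
        obtain ⟨w, hw, hw'⟩ := hlt
        have hgt : ∀ u ∈ K, ϱ < u.2 := by
          intro u hu
          by_contra hcon
          obtain ⟨z, hz⟩ := h.conn.exists_row hu hw (y := ϱ) (by omega) hw'
          exact hK _ hz rfl
        obtain ⟨y', h2, h3, -⟩ := exists_below h.sub h.bdry
          (fun u hu => by have := hgt u hu; omega) hy
        have h4 := hgt _ h3
        have h5 := hS _ h2
        dsimp only at h2 h3 h4 h5
        exact ⟨y', Finset.mem_filter.2 ⟨h2, Or.inr ⟨by dsimp only; omega, h3⟩⟩⟩
    omega
  have h2 := key K h hK u hu v hv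
  have h3 := key K' h' hK' u' hu' v' hv'
  have h4 := card_add_le_of_disjoint (Finset.filter_subset (fun s : Cell => (s.2 < ϱ ∧
    (s.1, s.2 - 1) ∈ K) ∨ (ϱ < s.2 ∧ (s.1, s.2 + 1) ∈ K)) S) (Finset.filter_subset (fun s : Cell =>
    (s.2 < ϱ ∧ (s.1, s.2 - 1) ∈ K') ∨ (ϱ < s.2 ∧ (s.1, s.2 + 1) ∈ K')) S) fun s hs hs' => by
      obtain ⟨-, h5 | h5⟩ := Finset.mem_filter.1 hs <;>
        obtain ⟨-, h6 | h6⟩ := Finset.mem_filter.1 hs'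
      · exact hdisj _ h5.2 h6.2
      · omega
      · omega
      · exact hdisj _ h5.2 h6.2
  omega

theorem height_add_height_le (h : Pocket x₀ y₀ b S K) (h' : Pocket x₀ y₀ b S K')
    (hdisj : ∀ u ∈ K, u ∉ K') {γ : ℤ} (h0 : x₀ ≤ γ) (h1 : γ < x₀ + b) (hS : ∀ s ∈ S, s.1 ≠ γ)
    (hK : ∀ u ∈ K, u.1 ≠ γ) (hK' : ∀ u ∈ K', u.1 ≠ γ) {u v u' v' : Cell} (hu : u ∈ K) (hv : v ∈ K)
    (hu' : u' ∈ K') (hv' : v' ∈ K') : (v.2 - u.2 + 1) + (v'.2 - u'.2 + 1) ≤ S.card := by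
  have := h.tr.width_add_width_le h'.tr (fun u hu => hdisj _ hu) h0 h1
    (fun s hs => hS _ (mem_image_swap.1 hs)) (fun u hu => hK _ hu) (fun u hu => hK' _ hu)
    (u := u.swap) (v := v.swap) (u' := u'.swap) (v' := v'.swap) hu hv hu' hv'
  rwa [Finset.card_image_of_injective _ Prod.swap_injective] at this

/-- Two pockets separated by a column have disjoint sets of neighbouring hits. -/
theorem width_add_height_le_of_separated (h : Pocket x₀ y₀ b S K) (h' : Pocket x₀ y₀ b S K')
    (hsep : (∀ u ∈ K, ∀ v ∈ K', u.1 + 1 < v.1) ∨ ∀ u ∈ K, ∀ v ∈ K', v.1 + 1 < u.1)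
    {u v u' v' : Cell} (hu : u ∈ K) (hv : v ∈ K) (hu' : u' ∈ K') (hv' : v' ∈ K') :
    (v.1 - u.1 + 1) + (v'.2 - u'.2 + 1) ≤ S.card := by
  classical
  have h1 := card_ge_of_cols (S.filter fun s => ∃ y, (s.1, y) ∈ K) u.1 (v.1 + 1) fun x hx hx' => by
    obtain ⟨y, hy⟩ := h.conn.exists_col hu hv hx (by omega)
    rcases h.bottom_or_top with hd | ht
    · obtain ⟨z, hz⟩ := exists_below h.sub h.bdry hd hy
      exact ⟨z, Finset.mem_filter.2 ⟨hz.1, y, hy⟩⟩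
    · obtain ⟨z, hz⟩ := exists_above h.sub h.bdry ht hy
      exact ⟨z, Finset.mem_filter.2 ⟨hz.1, y, hy⟩⟩
  have h2 := card_ge_of_rows (S.filter fun s => (s.1 + 1, s.2) ∈ K' ∨ (s.1 - 1, s.2) ∈ K')
    u'.2 (v'.2 + 1) fun x hx hx' => by
    obtain ⟨y, hy⟩ := h'.conn.exists_row hu' hv' hx (by omega)
    rcases h'.left_or_right with hd | ht
    · obtain ⟨z, hz⟩ := exists_leftOf h'.sub h'.bdry hd hy
      exact ⟨z, Finset.mem_filter.2 ⟨hz.1, Or.inl hz.2.1⟩⟩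
    · obtain ⟨z, hz⟩ := exists_rightOf h'.sub h'.bdry ht hy
      exact ⟨z, Finset.mem_filter.2 ⟨hz.1, Or.inr hz.2.1⟩⟩
  -- A hit in a column of `K` and beside a cell of `K'` would bring columns of the two pockets
  -- within distance one.
  have h3 := card_add_le_of_disjoint (Finset.filter_subset (fun s : Cell => ∃ y, (s.1, y) ∈ K) S)
    (Finset.filter_subset (fun s : Cell => (s.1 + 1, s.2) ∈ K' ∨ (s.1 - 1, s.2) ∈ K') S)
    fun s hs hs' => by
      obtain ⟨-, y, hy⟩ := Finset.mem_filter.1 hs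
      obtain ⟨-, h6 | h6⟩ := Finset.mem_filter.1 hs' <;> rcases hsep with hsep | hsep <;>
      · have := hsep _ hy _ h6
        dsimp only at this
        omega
  omega

theorem exists_hit_left (h : Pocket x₀ y₀ b S K) {u : Cell} (hu : u ∈ K) (hmin : ∀ v ∈ K, u.1 ≤ v.1)
    (hx : x₀ < u.1) : (u.1 - 1, u.2) ∈ S := by
  obtain ⟨h1, h2, h3, h4⟩ := h.sub hu
  refine h.bdry u hu _ ⟨?_, ?_, h3, h4⟩ (Or.inr ⟨rfl, Or.inl ?_⟩) fun hm => ?_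
  · dsimp only; omega
  · dsimp only; omega
  · dsimp only; omega
  · have := hmin _ hm
    dsimp only at this; omega

theorem exists_hit_right (h : Pocket x₀ y₀ b S K) {u : Cell} (hu : u ∈ K)
    (hmax : ∀ v ∈ K, v.1 ≤ u.1) (hx : u.1 < x₀ + b - 1) : (u.1 + 1, u.2) ∈ S := by
  obtain ⟨h1, h2, h3, h4⟩ := h.sub hu
  refine h.bdry u hu _ ⟨?_, ?_, h3, h4⟩ (Or.inr ⟨rfl, Or.inr ?_⟩) fun hm => ?_
  · dsimp only; omega
  · dsimp only; omega
  · dsimp only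
  · have := hmax _ hm
    dsimp only at this; omega

theorem exists_hit_col (h : Pocket x₀ y₀ b S K) {u v : Cell} (hu : u ∈ K) (hv : v ∈ K) {x : ℤ}
    (h1 : u.1 ≤ x) (h2 : x ≤ v.1) : ∃ y, (x, y) ∈ S := by
  obtain ⟨y, hy⟩ := h.conn.exists_col hu hv h1 h2
  rcases h.bottom_or_top with hd | ht
  · obtain ⟨z, hz⟩ := exists_below h.sub h.bdry hd hy
    exact ⟨z, hz.1⟩
  · obtain ⟨z, hz⟩ := exists_above h.sub h.bdry ht hy
    exact ⟨z, hz.1⟩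

/-- Of two pockets, one wide and one tall, the tall one can be translated horizontally to a place
where it is away from both. -/
theorem exists_translate (h : Pocket x₀ y₀ b S K) (h' : Pocket x₀ y₀ b S K')
    (hSb : 3 * (S.card : ℤ) ≤ 2 * b)
    (hdisj : ∀ u ∈ K, u ∉ K') {ϱ : ℤ} (h0 : y₀ ≤ ϱ) (h1 : ϱ < y₀ + b) (hS : ∀ s ∈ S, s.2 ≠ ϱ)
    (hK : ∀ u ∈ K, u.2 ≠ ϱ) (hK' : ∀ u ∈ K', u.2 ≠ ϱ)
    (hwide : ∃ u ∈ K, ∃ v ∈ K, b + 1 ≤ S.card + (v.1 - u.1 + 1))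
    (htall : ∃ u ∈ K', ∃ v ∈ K', b + 1 ≤ S.card + (v.2 - u.2 + 1)) :
    ∃ d : ℤ, ∀ u ∈ K', x₀ ≤ u.1 + d ∧ u.1 + d < x₀ + b ∧
      (∀ v ∈ K, v.1 + 1 < u.1 + d ∨ u.1 + d < v.1 - 1) ∧
      ∀ v ∈ K', v.1 + 1 < u.1 + d ∨ u.1 + d < v.1 - 1 := by
  obtain ⟨a, ha, c, hc, hac⟩ := hwide
  obtain ⟨a', ha', c', hc', hac'⟩ := htall
  have hfin : K.Finite := (finite_box _ _ _ _).subset h.sub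
  have hfin' : K'.Finite := (finite_box _ _ _ _).subset h'.sub
  obtain ⟨l, hl, hl'⟩ := Set.exists_min_image K Prod.fst hfin ⟨a, ha⟩
  obtain ⟨r, hr, hr'⟩ := Set.exists_max_image K Prod.fst hfin ⟨a, ha⟩
  obtain ⟨m, hm, hm'⟩ := Set.exists_min_image K' Prod.fst hfin' ⟨a', ha'⟩
  obtain ⟨n, hn, hn'⟩ := Set.exists_max_image K' Prod.fst hfin' ⟨a', ha'⟩
  -- Try to move the tall pocket against the left side, then against the right side, with one column
  -- of clearance from both pockets.
  by_cases c1 : n.1 - m.1 + 1 ≤ min l.1 m.1 - 1 - x₀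
  · refine ⟨x₀ - m.1, fun u hu => ?_⟩
    have e1 := hm' u hu
    have e2 := hn' u hu
    have e3 := h.sub hl
    have e4 := h'.sub hm
    rw [mem_Box] at e3 e4
    refine ⟨by omega, by omega, fun v hv => ?_, fun v hv => ?_⟩
    · have := hl' v hv; omega
    · have := hm' v hv; omega
  by_cases c2 : n.1 - m.1 + 1 ≤ x₀ + b - 2 - max r.1 n.1
  · refine ⟨x₀ + b - 1 - n.1, fun u hu => ?_⟩
    have e1 := hm' u hu
    have e2 := hn' u hu
    have e3 := h.sub hr
    have e4 := h'.sub hn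
    rw [mem_Box] at e3 e4
    refine ⟨by omega, by omega, fun v hv => ?_, fun v hv => ?_⟩
    · have := hr' v hv; omega
    · have := hn' v hv; omega
  exfalso
  have hww := h.width_add_width_le h' hdisj h0 h1 hS hK hK' ha hc hm hn
  have hB1 := h.sub hl
  have hB2 := h.sub hr
  have hB3 := h'.sub hm
  have hB4 := h'.sub hn
  rw [mem_Box] at hB1 hB2 hB3 hB4
  have hlr := hl' r hr
  have hmn := hm' n hn
  -- Separation would give 2(b + 1 - |S|) ≤ |S|, against 3|S| ≤ 2b.
  have hsep : ¬ ((∀ u ∈ K, ∀ v ∈ K', u.1 + 1 < v.1) ∨ ∀ u ∈ K, ∀ v ∈ K', v.1 + 1 < u.1) := by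
    intro hsep
    have := h.width_add_height_le_of_separated h' hsep ha hc ha' hc'
    omega
  have hgap : ¬ (r.1 + 2 < m.1) ∧ ¬ (n.1 + 2 < l.1) := by
    constructor <;> intro hcon <;> apply hsep
    · refine Or.inl fun u hu v hv => ?_
      have := hr' u hu
      have := hm' v hv
      omega
    · refine Or.inr fun u hu v hv => ?_
      have := hl' u hu
      have := hn' v hv
      omega
  -- At most one column lies between the pockets, so every column of their joint span, widened by
  -- one on each side within the square, contains a hit.
  have hcols := card_ge_of_cols S (max x₀ (min l.1 m.1 - 1)) (min (x₀ + b - 1) (max r.1 n.1 + 1) + 1)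
    fun x hx hx' => by
      by_cases q1 : l.1 ≤ x ∧ x ≤ r.1
      · exact h.exists_hit_col hl hr q1.1 q1.2
      by_cases q2 : m.1 ≤ x ∧ x ≤ n.1
      · exact h'.exists_hit_col hm hn q2.1 q2.2
      by_cases q3 : x = l.1 - 1
      · exact ⟨_, q3 ▸ h.exists_hit_left hl hl' (by omega)⟩
      by_cases q4 : x = r.1 + 1
      · exact ⟨_, q4 ▸ h.exists_hit_right hr hr' (by omega)⟩
      by_cases q5 : x = m.1 - 1
      · exact ⟨_, q5 ▸ h'.exists_hit_left hm hm' (by omega)⟩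
      by_cases q6 : x = n.1 + 1
      · exact ⟨_, q6 ▸ h'.exists_hit_right hn hn' (by omega)⟩
      omega
  -- Missing both vertical sides makes the pocket too low to be tall. If it touches one, the
  -- opposite margin is shorter than its width, so `hcols` and `hww` force 3|S| > 2b.
  by_cases q1 : x₀ < m.1 ∧ n.1 < x₀ + b - 1
  · have := h'.two_mul_height_le (fun u hu => by have := hm' u hu; omega)
      (fun u hu => by have := hn' u hu; omega) ha' hc'
    omega
  · omega

end Pocket

/-! ### The rank of a square with few hits -/

/-- The closed neighbourhood of a set of cells. -/
def cl (K : Set Cell) : Set Cell := {v | v ∈ K ∨ ∃ u ∈ K, Adj u v}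

/-- If `K` embeds into the rest of `A` away from `K`, then only the neighbours of `K` cost labels. -/
theorem Rk.readd {k : ℕ} {A K : Set Cell} (N : Finset Cell) (φ : Cell → Cell)
    (h : Rk k (A \ cl K)) (hφ : ∀ p ∈ K, φ p ∈ A \ cl K) (hinj : Function.Injective φ)
    (hadj : ∀ a b, Adj a b → Adj (φ a) (φ b)) (hN : ∀ p ∈ A, p ∉ N → p ∈ cl K → p ∈ K) :
    Rk (k + N.card) A := by
  -- `K` inherits a `k`-ranking through `φ` and is not adjacent to `A \ cl K`, so both use the same
  -- labels; only `N` needs new ones.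
  refine Rk.add_finset N (Rk.mono_set ?_
    ((h.comap φ hφ (fun a _ b _ e => hinj e) hadj).union h ?_))
  · rintro p ⟨hp, hpN⟩
    by_cases hpK : p ∈ cl K
    · exact Or.inl (hN p hp hpN hpK)
    · exact Or.inr ⟨hp, hpK⟩
  · intro u hu v hv huv
    exact hv.2 (Or.inr ⟨u, hu, huv⟩)

theorem exists_free (F : Finset ℤ) (a c : ℤ) (h : (F.card : ℤ) < c) :
    ∃ x, a ≤ x ∧ x < a + c ∧ x ∉ F := by
  by_contra hcon
  push Not at hcon
  have : Finset.Ico a (a + c) ⊆ F := by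
    intro x hx
    rw [Finset.mem_Ico] at hx
    exact hcon x hx.1 hx.2
  have := Finset.card_le_card this
  rw [Int.card_Ico] at this
  omega

/-- The main estimate: the part of a square connected to the free lines determines the rank of
the square up to the number of hits. -/
theorem rk_square {k : ℕ} {X : Set Cell} (hSb : 3 * (S.card : ℤ) ≤ 2 * b) (hb : 0 < b)
    (hcol : ∀ x, x₀ ≤ x → x < x₀ + b → (∀ s ∈ S, s.1 ≠ x) → ∀ y, y₀ ≤ y → y < y₀ + b → (x, y) ∈ X)
    (hrow : ∀ y, y₀ ≤ y → y < y₀ + b → (∀ s ∈ S, s.2 ≠ y) → ∀ x, x₀ ≤ x → x < x₀ + b → (x, y) ∈ X)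
    (hclosed : ∀ u ∈ X, ∀ v ∈ Box x₀ y₀ b b, v ∉ S → Adj u v → v ∈ X) (hX : Rk k X) :
    Rk (k + S.card) (Box x₀ y₀ b b) := by
  classical
  set T : Set Cell := Box x₀ y₀ b b \ S with hT
  have hfree : ∃ γ, x₀ ≤ γ ∧ γ < x₀ + b ∧ ∀ s ∈ S, s.1 ≠ γ := by
    obtain ⟨γ, h1, h2, h3⟩ := exists_free (S.image Prod.fst) x₀ b (by
      have : (S.image Prod.fst).card ≤ S.card := Finset.card_image_le
      omega)
    exact ⟨γ, h1, h2, fun s hs he => h3 (Finset.mem_image.2 ⟨s, hs, he⟩)⟩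
  have hfree' : ∃ γ, y₀ ≤ γ ∧ γ < y₀ + b ∧ ∀ s ∈ S, s.2 ≠ γ := by
    obtain ⟨γ, h1, h2, h3⟩ := exists_free (S.image Prod.snd) y₀ b (by
      have : (S.image Prod.snd).card ≤ S.card := Finset.card_image_le
      omega)
    exact ⟨γ, h1, h2, fun s hs he => h3 (Finset.mem_image.2 ⟨s, hs, he⟩)⟩
  obtain ⟨γ, hγ1, hγ2, hγ⟩ := hfree
  obtain ⟨ϱ, hϱ1, hϱ2, hϱ⟩ := hfree'
  have hmiss : ∀ p ∈ T, p ∉ X → ∀ u ∈ comp T p, u ∉ X := by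
    intro p _ hpX u hu huX
    obtain ⟨c, d, hcd, -, hd, hc', hd'⟩ := hu.2.symm.exit huX hpX
    exact hd' (hclosed c hc' d hd.1 hd.2 hcd)
  have havc : ∀ p ∈ T, p ∉ X → ∀ u ∈ comp T p, u.1 ≠ γ := by
    intro p hp hpX u hu he
    refine hmiss p hp hpX u hu ?_
    have := hcol γ hγ1 hγ2 hγ u.2 hu.1.1.2.2.1 hu.1.1.2.2.2
    rwa [← he] at this
  have havr : ∀ p ∈ T, p ∉ X → ∀ u ∈ comp T p, u.2 ≠ ϱ := by
    intro p hp hpX u hu he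
    refine hmiss p hp hpX u hu ?_
    have := hrow ϱ hϱ1 hϱ2 hϱ u.1 hu.1.1.1 hu.1.1.2.1
    rwa [← he] at this
  have hpocket : ∀ p ∈ T, p ∉ X → Pocket x₀ y₀ b S (comp T p) := by
    intro p hp hpX
    refine ⟨fun u hu => hu.1.1, fun u hu => hu.1.2, isConn_comp _ _, ?_,
      ⟨γ, hγ1, hγ2, hγ, havc p hp hpX⟩, ⟨ϱ, hϱ1, hϱ2, hϱ, havr p hp hpX⟩⟩
    intro u hu v hv huv hvK
    by_contra hvS
    exact hvK (comp_closed hu huv ⟨hv, hvS⟩)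
  -- At least b - |S| columns and as many rows are free, so `X` has a grid minor of that side, into
  -- which a set of no larger extent can be translated.
  have hsmall : ∀ K : Set Cell, K.Finite → (¬ ∃ u ∈ K, ∃ v ∈ K, b + 1 ≤ S.card + (v.1 - u.1 + 1)) →
      (¬ ∃ u ∈ K, ∃ v ∈ K, b + 1 ≤ S.card + (v.2 - u.2 + 1)) → Rk k K := by
    intro K hfin hw ht
    rcases K.eq_empty_or_nonempty with rfl | hne
    · exact rk_empty _
    have h1 := hX.lines (Finset.Ico x₀ (x₀ + b) \ S.image Prod.fst)
      (Finset.Ico y₀ (y₀ + b) \ S.image Prod.snd) (x₀ := x₀) (y₀ := y₀) (w := b) (h := b)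
      (fun x hx => Finset.mem_Ico.1 (Finset.mem_sdiff.1 hx).1)
      (fun x hx => Finset.mem_Ico.1 (Finset.mem_sdiff.1 hx).1)
      (fun x hx => by
        rw [Finset.mem_sdiff, Finset.mem_Ico] at hx
        exact hcol x hx.1.1 hx.1.2 fun s hs he => hx.2 (Finset.mem_image.2 ⟨s, hs, he⟩))
      (fun x hx => by
        rw [Finset.mem_sdiff, Finset.mem_Ico] at hx
        exact hrow x hx.1.1 hx.1.2 fun s hs he => hx.2 (Finset.mem_image.2 ⟨s, hs, he⟩))
    have h2 := Finset.le_card_sdiff (S.image Prod.fst) (Finset.Ico x₀ (x₀ + b))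
    have h3 := Finset.le_card_sdiff (S.image Prod.snd) (Finset.Ico y₀ (y₀ + b))
    have h4 : (S.image Prod.fst).card ≤ S.card := Finset.card_image_le
    have h5 : (S.image Prod.snd).card ≤ S.card := Finset.card_image_le
    rw [Int.card_Ico] at h2 h3
    obtain ⟨l, hl, hl'⟩ := Set.exists_min_image K Prod.fst hfin hne
    obtain ⟨d, hd, hd'⟩ := Set.exists_min_image K Prod.snd hfin hne
    refine (h1.translate l.1 d.2).mono_set fun u hu => ?_
    push Not at hw ht
    have h6 := hw l hl u hu
    have h7 := ht d hd u hu
    have h8 := hl' u hu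
    have h9 := hd' u hu
    refine ⟨h8, ?_, h9, ?_⟩ <;> omega
  have hlow : ∀ L : Set Cell, (∀ p ∈ T, p ∉ X → p ∉ L →
      (¬ ∃ u ∈ comp T p, ∃ v ∈ comp T p, b + 1 ≤ S.card + (v.1 - u.1 + 1)) ∧
      (¬ ∃ u ∈ comp T p, ∃ v ∈ comp T p, b + 1 ≤ S.card + (v.2 - u.2 + 1))) → Rk k (T \ L) := by
    intro L hL
    refine Rk.of_comps fun p hp => ?_
    by_cases hpX : p ∈ X
    · refine hX.mono_set fun u hu => ?_
      by_contra huX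
      obtain ⟨c, d, hcd, -, hd, hc', hd'⟩ := hu.2.exit hpX huX
      exact hd' (hclosed c hc' d hd.1.1 hd.1.2 hcd)
    · obtain ⟨h1, h2⟩ := hL p hp.1 hpX hp.2
      refine (hsmall (comp T p) ((finite_box _ _ _ _).subset fun u hu => hu.1.1) h1 h2).mono_set ?_
      exact fun u hu => ⟨hu.1.1, hu.2.mono Set.sdiff_subset⟩
  have hanti : ∀ p ∈ T, p ∉ X → (∃ u ∈ comp T p, ∃ v ∈ comp T p,
      b + 1 ≤ S.card + (v.1 - u.1 + 1) ∨ b + 1 ≤ S.card + (v.2 - u.2 + 1)) → ∀ k' : ℕ,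
      Rk k' (Box x₀ y₀ b b \ cl (comp T p)) →
      Rk (k' + (S.filter (· ∈ cl (comp T p))).card) (Box x₀ y₀ b b) := by
    intro p hp hpX hlarge k' hk'
    have hP := hpocket p hp hpX
    refine hk'.readd _ (fun u => (2 * x₀ + b - 1 - u.1, 2 * y₀ + b - 1 - u.2)) ?_ ?_ ?_ ?_
    · intro u hu
      refine ⟨?_, ?_⟩
      · obtain ⟨h1, h2, h3, h4⟩ := hP.sub hu
        refine ⟨?_, ?_, ?_, ?_⟩ <;> dsimp only <;> omega
      · rintro (hm | ⟨v, hv, huv⟩)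
        · exact hP.not_near_anti hSb hb hlarge hu hm (Or.inl rfl)
        · exact hP.not_near_anti hSb hb hlarge hu hv (Or.inr huv.symm)
    · intro u v huv
      simp only [Prod.mk.injEq] at huv
      exact Prod.ext (by omega) (by omega)
    · intro u v huv
      unfold Adj at *
      dsimp only
      omega
    · rintro q hq hqN (hqK | ⟨u, hu, huq⟩)
      · exact hqK
      · by_contra hqK
        exact hqN (Finset.mem_filter.2 ⟨hP.bdry u hu q hq huq hqK, Or.inr ⟨u, hu, huq⟩⟩)
  -- For a single large pocket, the hits away from it are added before the pocket and the hits
  -- beside it after, so each hit costs one label.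
  have hone : ∀ p ∈ T, p ∉ X → (∃ u ∈ comp T p, ∃ v ∈ comp T p,
      b + 1 ≤ S.card + (v.1 - u.1 + 1) ∨ b + 1 ≤ S.card + (v.2 - u.2 + 1)) →
      Rk k (T \ comp T p) → Rk (k + S.card) (Box x₀ y₀ b b) := by
    intro p hp hpX hlarge hk
    have h1 : Rk (k + (S.filter (· ∉ cl (comp T p))).card) (Box x₀ y₀ b b \ cl (comp T p)) := by
      refine Rk.add_finset _ (hk.mono_set ?_)
      rintro q ⟨⟨hq, hqc⟩, hqS⟩
      refine ⟨⟨hq, fun hq' => hqS ?_⟩, fun h => hqc (Or.inl h)⟩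
      exact Finset.mem_coe.2 (Finset.mem_filter.2 ⟨hq', hqc⟩)
    have h2 := hanti p hp hpX hlarge _ h1
    have h3 := Finset.card_filter_add_card_filter_not (s := S) (· ∈ cl (comp T p))
    rwa [show k + S.card = k + (S.filter (· ∉ cl (comp T p))).card +
      (S.filter (· ∈ cl (comp T p))).card by omega]
  have hdis : ∀ p p' : Cell, p' ∉ comp T p → ∀ u ∈ comp T p', u ∉ comp T p := by
    intro p p' hpp u hu hu'
    apply hpp
    have h1 := comp_eq_of_mem hu
    rw [comp_eq_of_mem hu'] at h1
    rw [h1]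
    exact ⟨hu.2.symm.mem hu.1, Conn.refl _ _⟩
  by_cases hwide : ∃ p ∈ T, p ∉ X ∧
      ∃ u ∈ comp T p, ∃ v ∈ comp T p, b + 1 ≤ S.card + (v.1 - u.1 + 1)
  · obtain ⟨p, hp, hpX, hw⟩ := hwide
    -- Two wide pockets would have total width at least 2(b + 1 - |S|), which exceeds |S|.
    have hw' : ∀ p' ∈ T, p' ∉ X → p' ∉ comp T p →
        ¬ ∃ u ∈ comp T p', ∃ v ∈ comp T p', b + 1 ≤ S.card + (v.1 - u.1 + 1) := by
      rintro p' hp' hp'X hpp ⟨u', hu', v', hv', huv'⟩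
      obtain ⟨u, hu, v, hv, huv⟩ := hw
      have := (hpocket p' hp' hp'X).width_add_width_le (hpocket p hp hpX) (hdis p p' hpp) hϱ1 hϱ2 hϱ
        (havr p' hp' hp'X) (havr p hp hpX) hu' hv' hu hv
      omega
    have hlarge : ∃ u ∈ comp T p, ∃ v ∈ comp T p,
      b + 1 ≤ S.card + (v.1 - u.1 + 1) ∨ b + 1 ≤ S.card + (v.2 - u.2 + 1) := by
      obtain ⟨u, hu, v, hv, huv⟩ := hw
      exact ⟨u, hu, v, hv, Or.inl huv⟩
    by_cases htall : ∃ p' ∈ T, p' ∉ X ∧ p' ∉ comp T p ∧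
        ∃ u ∈ comp T p', ∃ v ∈ comp T p', b + 1 ≤ S.card + (v.2 - u.2 + 1)
    · obtain ⟨p', hp', hp'X, hpp, ht⟩ := htall
      have hP := hpocket p hp hpX
      have hP' := hpocket p' hp' hp'X
      have hk : Rk k (T \ (comp T p ∪ comp T p')) := by
        refine hlow _ fun r hr hrX hrL => ⟨hw' r hr hrX fun h => hrL (Or.inl h), ?_⟩
        rintro ⟨u', hu', v', hv', huv'⟩
        obtain ⟨u, hu, v, hv, huv⟩ := ht
        have := (hpocket r hr hrX).height_add_height_le hP'
          (hdis p' r fun h => hrL (Or.inr h)) hγ1 hγ2 hγ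
          (havc r hr hrX) (havc p' hp' hp'X) hu' hv' hu hv
        omega
      obtain ⟨d, hd⟩ := hP.exists_translate hP' hSb
        (fun u hu hu' => hdis p p' hpp u hu' hu) hϱ1 hϱ2 hϱ (havr p hp hpX) (havr p' hp' hp'X) hw ht
      -- The hits are split so that none is paid for twice: beside the wide pocket, beside the tall
      -- pocket only, and the rest. The tall pocket is restored first, by translation, then the wide
      -- one, by point reflection.
      set N₁ := S.filter (· ∈ cl (comp T p))
      set N₂ := (S.filter (· ∉ cl (comp T p))).filter (· ∈ cl (comp T p'))
      set N₃ := (S.filter (· ∉ cl (comp T p))).filter (· ∉ cl (comp T p'))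
      have h1 : Rk (k + N₃.card) ((Box x₀ y₀ b b \ cl (comp T p)) \ cl (comp T p')) := by
        refine Rk.add_finset _ (hk.mono_set ?_)
        rintro q ⟨⟨⟨hq, hqc⟩, hqc'⟩, hqS⟩
        refine ⟨⟨hq, fun hq' => hqS ?_⟩, fun h => ?_⟩
        · exact Finset.mem_coe.2 (Finset.mem_filter.2 ⟨Finset.mem_filter.2 ⟨hq', hqc⟩, hqc'⟩)
        · rcases h with h | h
          · exact hqc (Or.inl h)
          · exact hqc' (Or.inl h)
      have h2 : Rk (k + N₃.card + N₂.card) (Box x₀ y₀ b b \ cl (comp T p)) := by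
        refine h1.readd _ (fun u => (u.1 + d, u.2)) ?_ ?_ ?_ ?_
        · intro u hu
          obtain ⟨h3, h4, h5, h6⟩ := hd u hu
          have h7 := hP'.sub hu
          refine ⟨⟨⟨h3, h4, h7.2.2⟩, ?_⟩, ?_⟩
          · rintro (hm | ⟨v, hv, huv⟩)
            · have := h5 _ hm; dsimp only at this; omega
            · have := h5 _ hv; simp only [Adj] at huv; omega
          · rintro (hm | ⟨v, hv, huv⟩)
            · have := h6 _ hm; dsimp only at this; omega
            · have := h6 _ hv; simp only [Adj] at huv; omega
        · intro u v huv
          simp only [Prod.mk.injEq] at huv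
          exact Prod.ext (by omega) (by omega)
        · intro u v huv
          unfold Adj at *
          dsimp only
          omega
        · rintro q ⟨hq, hqc⟩ hqN (hqK | ⟨u, hu, huq⟩)
          · exact hqK
          · by_contra hqK
            exact hqN (Finset.mem_filter.2 ⟨Finset.mem_filter.2
              ⟨hP'.bdry u hu q hq huq hqK, hqc⟩, Or.inr ⟨u, hu, huq⟩⟩)
      have h3 := hanti p hp hpX hlarge _ h2
      have h4 : (S.filter (· ∈ cl (comp T p))).card + (S.filter (· ∉ cl (comp T p))).card = S.card :=
        Finset.card_filter_add_card_filter_not (s := S) (· ∈ cl (comp T p))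
      have h5 : N₂.card + N₃.card = (S.filter (· ∉ cl (comp T p))).card :=
        Finset.card_filter_add_card_filter_not (· ∈ cl (comp T p'))
      have h6 : N₁.card + (S.filter (· ∉ cl (comp T p))).card = S.card := h4
      rwa [show k + S.card = k + N₃.card + N₂.card + N₁.card by omega]
    · refine hone p hp hpX hlarge (hlow _ fun r hr hrX hrL => ⟨hw' r hr hrX hrL, fun h => ?_⟩)
      exact htall ⟨r, hr, hrX, hrL, h⟩
  · by_cases htall : ∃ p ∈ T, p ∉ X ∧
        ∃ u ∈ comp T p, ∃ v ∈ comp T p, b + 1 ≤ S.card + (v.2 - u.2 + 1)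
    · obtain ⟨p, hp, hpX, ht⟩ := htall
      obtain ⟨u, hu, v, hv, huv⟩ := ht
      refine hone p hp hpX ⟨u, hu, v, hv, Or.inr huv⟩ (hlow _ fun r hr hrX hrL =>
        ⟨fun h => hwide ⟨r, hr, hrX, h⟩, ?_⟩)
      rintro ⟨u', hu', v', hv', huv'⟩
      have := (hpocket r hr hrX).height_add_height_le (hpocket p hp hpX) (hdis p r hrL) hγ1 hγ2 hγ
        (havc r hr hrX) (havc p hp hpX) hu' hv' hu hv
      omega
    · refine Rk.add_finset S ((hlow ∅ fun r hr hrX _ => ⟨fun h => hwide ⟨r, hr, hrX, h⟩,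
        fun h => htall ⟨r, hr, hrX, h⟩⟩).mono_set ?_)
      rintro p hp
      exact ⟨hp, by simp⟩

end GridRank

namespace GridRank

/-! ### States of the deletion process and captured components -/

/-- A set that joins opposite sides of the `m × m` square. -/
def Crossing (m : ℤ) (A : Set Cell) : Prop :=
  ((∃ u ∈ A, u.1 = 0) ∧ ∃ u ∈ A, u.1 = m - 1) ∨ ((∃ u ∈ A, u.2 = 0) ∧ ∃ u ∈ A, u.2 = m - 1)

/-- A component `D` of the square minus `S` that meets every crossing. -/
structure State (m : ℤ) (S : Finset Cell) (D : Set Cell) : Prop where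
  hits : ∀ s ∈ S, s ∈ Box 0 0 m m
  sub : D ⊆ Box 0 0 m m
  disj : ∀ u ∈ D, u ∉ S
  conn : IsConn D
  closed : ∀ u ∈ D, ∀ v ∈ Box 0 0 m m, v ∉ S → Adj u v → v ∈ D
  cross : ∀ A ⊆ Box 0 0 m m, IsConn A → Crossing m A → ∃ p ∈ A, p ∈ D

/-- A component of the square minus `S` other than `D`. -/
structure Captured (m : ℤ) (S : Finset Cell) (D K : Set Cell) : Prop where
  sub : K ⊆ Box 0 0 m m
  disj : ∀ u ∈ K, u ∉ S
  conn : IsConn K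
  bdry : ∀ u ∈ K, ∀ v ∈ Box 0 0 m m, Adj u v → v ∉ K → v ∈ S
  notD : ∀ u ∈ K, u ∉ D

/-- An involutive symmetry of the `m × m` square. -/
structure Sym (m : ℤ) (φ : Cell → Cell) : Prop where
  inv : ∀ p, φ (φ p) = p
  adj : ∀ a b, Adj a b → Adj (φ a) (φ b)
  box : ∀ p ∈ Box 0 0 m m, φ p ∈ Box 0 0 m m
  cross : ∀ A, Crossing m A → Crossing m {p | φ p ∈ A}

/-- The reflections of the `m × m` square in its axes. -/
def flip (m : ℤ) (α β : Bool) (p : Cell) : Cell :=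
  (if α then m - 1 - p.1 else p.1, if β then m - 1 - p.2 else p.2)

theorem Sym.flip (m : ℤ) (α β : Bool) : Sym m (flip m α β) := by
  have hinv : ∀ p, GridRank.flip m α β (GridRank.flip m α β p) = p := by
    intro p
    cases α <;> cases β <;> simp [GridRank.flip]
  refine ⟨hinv, ?_, ?_, ?_⟩
  · intro a b hab
    cases α <;> cases β <;> simp only [GridRank.flip, Adj, if_true, if_false, Bool.false_eq_true] at * <;>
      omega
  · intro p hp
    cases α <;> cases β <;>
      simp only [GridRank.flip, mem_Box, if_true, if_false, Bool.false_eq_true] at * <;> omega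
  · have hm : ∀ (A : Set Cell) (u : Cell), u ∈ A → GridRank.flip m α β u ∈
        {p | GridRank.flip m α β p ∈ A} := fun A u hu => by
      rw [Set.mem_ofPred_eq, hinv]; exact hu
    rintro A (⟨⟨u, hu, hu'⟩, v, hv, hv'⟩ | ⟨⟨u, hu, hu'⟩, v, hv, hv'⟩)
    · left
      cases α
      · exact ⟨⟨_, hm A u hu, by simpa [GridRank.flip] using hu'⟩, _, hm A v hv,
          by simpa [GridRank.flip] using hv'⟩
      · exact ⟨⟨_, hm A v hv, by simp [GridRank.flip]; omega⟩, _, hm A u hu,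
          by simp [GridRank.flip]; omega⟩
    · right
      cases β
      · exact ⟨⟨_, hm A u hu, by simpa [GridRank.flip] using hu'⟩, _, hm A v hv,
          by simpa [GridRank.flip] using hv'⟩
      · exact ⟨⟨_, hm A v hv, by simp [GridRank.flip]; omega⟩, _, hm A u hu,
          by simp [GridRank.flip]; omega⟩

theorem Sym.swap (m : ℤ) : Sym m Prod.swap := by
  refine ⟨Prod.swap_swap, fun _ _ h => h.swap, fun p hp => tr_box.2 hp, ?_⟩
  rintro A (⟨⟨u, hu, hu'⟩, v, hv, hv'⟩ | ⟨⟨u, hu, hu'⟩, v, hv, hv'⟩)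
  · exact Or.inr ⟨⟨u.swap, hu, hu'⟩, v.swap, hv, hv'⟩
  · exact Or.inl ⟨⟨u.swap, hu, hu'⟩, v.swap, hv, hv'⟩

variable {m : ℤ} {S : Finset Cell} {D K : Set Cell} {φ : Cell → Cell}

theorem Sym.injective (hφ : Sym m φ) : Function.Injective φ :=
  Function.LeftInverse.injective hφ.inv

theorem Sym.mem_image (hφ : Sym m φ) {p : Cell} : p ∈ S.image φ ↔ φ p ∈ S := by
  simp only [Finset.mem_image]
  constructor
  · rintro ⟨a, ha, rfl⟩
    rwa [hφ.inv]
  · exact fun h => ⟨_, h, hφ.inv p⟩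

theorem Sym.card_image (hφ : Sym m φ) : (S.image φ).card = S.card :=
  Finset.card_image_of_injective _ hφ.injective

theorem Sym.card_filter (hφ : Sym m φ) (P : Cell → Prop) [DecidablePred P] :
    ((S.image φ).filter P).card = (S.filter fun p => P (φ p)).card := by
  rw [Finset.filter_image, hφ.card_image]

theorem State.map (h : State m S D) (hφ : Sym m φ) : State m (S.image φ) {p | φ p ∈ D} where
  hits s hs := by
    have := hφ.box _ (h.hits _ (hφ.mem_image.1 hs))
    rwa [hφ.inv] at this
  sub p hp := by
    have := hφ.box _ (h.sub hp)
    rwa [hφ.inv] at this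
  disj u hu hs := h.disj _ hu (hφ.mem_image.1 hs)
  conn := h.conn.preimage φ hφ.inv hφ.adj
  closed u hu v hv hvS huv := h.closed _ hu _ (hφ.box v hv)
    (fun h => hvS (hφ.mem_image.2 h)) (hφ.adj _ _ huv)
  cross A hA hc hcr := by
    obtain ⟨p, hp, hpD⟩ := h.cross {p | φ p ∈ A} (fun p hp => by
      have := hφ.box _ (hA hp)
      rwa [hφ.inv] at this) (hc.preimage φ hφ.inv hφ.adj) (hφ.cross A hcr)
    refine ⟨φ p, hp, ?_⟩
    rw [Set.mem_ofPred_eq, hφ.inv]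
    exact hpD

theorem Captured.map (h : Captured m S D K) (hφ : Sym m φ) :
    Captured m (S.image φ) {p | φ p ∈ D} {p | φ p ∈ K} where
  sub p hp := by
    have := hφ.box _ (h.sub hp)
    rwa [hφ.inv] at this
  disj u hu hs := h.disj _ hu (hφ.mem_image.1 hs)
  conn := h.conn.preimage φ hφ.inv hφ.adj
  bdry u hu v hv huv hvK := hφ.mem_image.2 (h.bdry _ hu _ (hφ.box v hv) (hφ.adj _ _ huv) hvK)
  notD u hu := h.notD _ hu

theorem Sym.rk (hφ : Sym m φ) {k : ℕ} {A : Set Cell} (h : Rk k A) : Rk k {p | φ p ∈ A} :=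
  h.comap φ (fun _ ha => ha) (fun _ _ _ _ h => hφ.injective h) hφ.adj

theorem Sym.preimage_preimage (hφ : Sym m φ) (A : Set Cell) : {p | φ p ∈ {p | φ p ∈ A}} = A := by
  ext p
  simp only [Set.mem_ofPred_eq, hφ.inv]

theorem Sym.image_image (hφ : Sym m φ) : (S.image φ).image φ = S := by
  ext p
  rw [hφ.mem_image, hφ.mem_image, hφ.inv]

/-- A square with few hits whose free lines do not belong to `D`. -/
theorem exists_captured {S' : Finset Cell} {ρ : ℕ} {x₀ y₀ : ℤ} {c : ℕ} (hSS : S' ⊆ S)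
    (hD : State m S' D) (hρ : Rk ρ (D \ S)) (hQ : Box x₀ y₀ c c ⊆ Box 0 0 m m) (hc : 0 < c)
    [DecidablePred (· ∈ Box x₀ y₀ c c)]
    (hq : 3 * (S.filter (· ∈ Box x₀ y₀ c c)).card ≤ 2 * c)
    (hlt : ρ + (S.filter (· ∈ Box x₀ y₀ c c)).card < gridRank c c) :
    ∃ K, Captured m S' D K ∧
      (∀ y, y₀ ≤ y → y < y₀ + c → (∀ s ∈ S, s ∈ Box x₀ y₀ c c → s.2 ≠ y) →
        ∀ x, x₀ ≤ x → x < x₀ + c → (x, y) ∈ K) ∧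
      (∀ x, x₀ ≤ x → x < x₀ + c → (∀ s ∈ S, s ∈ Box x₀ y₀ c c → s.1 ≠ x) →
        ∀ y, y₀ ≤ y → y < y₀ + c → (x, y) ∈ K) := by
  classical
  set F := S.filter (· ∈ Box x₀ y₀ c c) with hF
  have hmF : ∀ s, s ∈ F ↔ s ∈ S ∧ s ∈ Box x₀ y₀ c c := fun s => Finset.mem_filter
  obtain ⟨γ, hγ1, hγ2, hγ⟩ := exists_free (F.image Prod.fst) x₀ c (by
    have : (F.image Prod.fst).card ≤ F.card := Finset.card_image_le
    omega)
  obtain ⟨ϱ, hϱ1, hϱ2, hϱ⟩ := exists_free (F.image Prod.snd) y₀ c (by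
    have : (F.image Prod.snd).card ≤ F.card := Finset.card_image_le
    omega)
  have hγ' : ∀ s ∈ S, s ∈ Box x₀ y₀ c c → s.1 ≠ γ := fun s hs hs' he =>
    hγ (Finset.mem_image.2 ⟨s, (hmF s).2 ⟨hs, hs'⟩, he⟩)
  have hϱ' : ∀ s ∈ S, s ∈ Box x₀ y₀ c c → s.2 ≠ ϱ := fun s hs hs' he =>
    hϱ (Finset.mem_image.2 ⟨s, (hmF s).2 ⟨hs, hs'⟩, he⟩)
  set X := comp (Box x₀ y₀ c c \ S) (γ, ϱ) with hX
  have hin : ∀ x, x₀ ≤ x → x < x₀ + c → ∀ y, y₀ ≤ y → y < y₀ + c →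
      ((∀ s ∈ S, s ∈ Box x₀ y₀ c c → s.1 ≠ x) ∨ (∀ s ∈ S, s ∈ Box x₀ y₀ c c → s.2 ≠ y)) →
      (x, y) ∈ Box x₀ y₀ c c \ S := by
    intro x h1 h2 y h3 h4 h
    refine ⟨⟨h1, h2, h3, h4⟩, fun hs => ?_⟩
    rcases h with h | h
    · exact h _ hs ⟨h1, h2, h3, h4⟩ rfl
    · exact h _ hs ⟨h1, h2, h3, h4⟩ rfl
  have hrowX : ∀ y, y₀ ≤ y → y < y₀ + c → (∀ s ∈ S, s ∈ Box x₀ y₀ c c → s.2 ≠ y) →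
      ∀ x, x₀ ≤ x → x < x₀ + c → (x, y) ∈ X := by
    intro y h1 h2 h x h3 h4
    refine ⟨hin x h3 h4 y h1 h2 (Or.inr h), Conn.trans (q := (γ, y)) (conn_col fun z hz => ?_)
      (conn_row fun z hz => ?_)⟩
    · exact hin γ hγ1 hγ2 z (by omega) (by omega) (Or.inl hγ')
    · exact hin z (by omega) (by omega) y h1 h2 (Or.inr h)
  have hcolX : ∀ x, x₀ ≤ x → x < x₀ + c → (∀ s ∈ S, s ∈ Box x₀ y₀ c c → s.1 ≠ x) →
      ∀ y, y₀ ≤ y → y < y₀ + c → (x, y) ∈ X := by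
    intro x h1 h2 h y h3 h4
    refine ⟨hin x h1 h2 y h3 h4 (Or.inl h), Conn.trans (q := (x, ϱ)) (conn_row fun z hz => ?_)
      (conn_col fun z hz => ?_)⟩
    · exact hin z (by omega) (by omega) ϱ hϱ1 hϱ2 (Or.inr hϱ')
    · exact hin x h1 h2 z (by omega) (by omega) (Or.inl h)
  have hpX := hin γ hγ1 hγ2 ϱ hϱ1 hϱ2 (Or.inl hγ')
  have hsub : Box x₀ y₀ c c \ (S : Set Cell) ⊆ Box 0 0 m m \ S' := fun v hv =>
    ⟨hQ hv.1, fun h => hv.2 (hSS h)⟩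
  have hXK : X ⊆ comp (Box 0 0 m m \ S') (γ, ϱ) := fun u hu => ⟨hsub hu.1, hu.2.mono hsub⟩
  refine ⟨comp (Box 0 0 m m \ S') (γ, ϱ), ⟨fun u hu => hu.1.1, fun u hu => hu.1.2,
    isConn_comp _ _, ?_, ?_⟩, fun y h1 h2 h x h3 h4 => hXK (hrowX y h1 h2 h x h3 h4),
    fun x h1 h2 h y h3 h4 => hXK (hcolX x h1 h2 h y h3 h4)⟩
  · intro u hu v hv huv hvK
    by_contra hvS
    exact hvK (comp_closed hu huv ⟨hv, hvS⟩)
  -- If the component met `D`, it would contain the free lines as part of `D \ S`, which needs only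
  -- `ρ` labels, and the main estimate would rank the square with fewer than `gridRank c c` labels.
  · intro u hu huD
    have hstay : ∀ p q, Conn (Box 0 0 m m \ S') p q → p ∈ D → q ∈ D := by
      intro p q hpq hp
      by_contra hq
      obtain ⟨c, d, hcd, -, hd, hc', hd'⟩ := hpq.exit hp hq
      exact hd' (hD.closed c hc' d hd.1 hd.2 hcd)
    have hpD := hstay _ _ hu.2.symm huD
    have hXD : X ⊆ D \ S := fun v hv => ⟨hstay _ _ (hXK hv).2 hpD, hv.1.2⟩
    have := rk_square (k := ρ) (X := X) (S := F) (x₀ := x₀) (y₀ := y₀) (b := c) (by exact_mod_cast hq)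
      (by exact_mod_cast hc) (fun x h1 h2 h => hcolX x h1 h2 fun s hs hs' => h s ((hmF s).2 ⟨hs, hs'⟩))
      (fun y h1 h2 h => hrowX y h1 h2 fun s hs hs' => h s ((hmF s).2 ⟨hs, hs'⟩))
      (fun u hu v hv hvF huv => comp_closed hu huv ⟨hv, fun hvS => hvF ((hmF v).2 ⟨hvS, hv⟩)⟩)
      (hρ.mono_set hXD)
    have := gridRank_le_of_rk (this.translate 0 0)
    omega

/-- The hits adjacent to `K`. -/
noncomputable def nb (S : Finset Cell) (K : Set Cell) : Finset Cell :=
  @Finset.filter _ (fun s => ∃ u ∈ K, Adj u s) (Classical.decPred _) S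

theorem mem_nb {s : Cell} : s ∈ nb S K ↔ s ∈ S ∧ ∃ u ∈ K, Adj u s := by
  classical
  unfold nb
  simp only [Finset.mem_filter]

theorem Above.mem_nb {s : Cell} (h : Above S K s) : s ∈ nb S K :=
  GridRank.mem_nb.2 ⟨h.1, _, h.2.1, by simp [Adj]⟩

theorem Below.mem_nb {s : Cell} (h : Below S K s) : s ∈ nb S K :=
  GridRank.mem_nb.2 ⟨h.1, _, h.2.1, by simp [Adj]⟩

theorem RightOf.mem_nb {s : Cell} (h : RightOf S K s) : s ∈ nb S K :=
  GridRank.mem_nb.2 ⟨h.1, _, h.2.1, by simp [Adj]⟩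

theorem Sym.card_nb (hφ : Sym m φ) : (nb (S.image φ) {p | φ p ∈ K}).card = (nb S K).card := by
  rw [← hφ.card_image (S := nb S K)]
  congr 1
  ext p
  rw [hφ.mem_image, mem_nb, mem_nb, hφ.mem_image]
  refine and_congr_right fun _ => ⟨?_, ?_⟩
  · rintro ⟨u, hu, hup⟩
    exact ⟨_, hu, hφ.adj _ _ hup⟩
  · rintro ⟨u, hu, hup⟩
    refine ⟨φ u, by rwa [Set.mem_ofPred_eq, hφ.inv], ?_⟩
    have := hφ.adj _ _ hup
    rwa [hφ.inv] at this

theorem Captured.not_crossing (hK : Captured m S D K) (h : State m S D) : ¬ Crossing m K := by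
  intro hc
  obtain ⟨p, hp, hpD⟩ := h.cross K hK.sub hK.conn hc
  exact hK.notD p hp hpD

theorem Captured.misses_right (hK : Captured m S D K) (h : State m S D) (hl : ∃ u ∈ K, u.1 = 0) :
    ∀ u ∈ K, u.1 < m - 1 := by
  intro u hu
  have h1 := (hK.sub hu).2.1
  rcases lt_or_eq_of_le (show u.1 ≤ m - 1 by omega) with h2 | h2
  · exact h2
  · exact (hK.not_crossing h (Or.inl ⟨hl, u, hu, h2⟩)).elim

theorem Captured.misses_top (hK : Captured m S D K) (h : State m S D) (hl : ∃ u ∈ K, u.2 = 0) :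
    ∀ u ∈ K, u.2 < m - 1 := by
  intro u hu
  have h1 := (hK.sub hu).2.2.2
  rcases lt_or_eq_of_le (show u.2 ≤ m - 1 by omega) with h2 | h2
  · exact h2
  · exact (hK.not_crossing h (Or.inr ⟨hl, u, hu, h2⟩)).elim

/-- A captured set through all rows and columns of a square on the left side has many
neighbouring hits. -/
theorem Captured.two_mul_le (hK : Captured m S D K) (h : State m S D) {y₀ c : ℤ} (hc : 0 < c)
    (hrows : ∀ y, y₀ ≤ y → y < y₀ + c → ∃ x, (x, y) ∈ K) (hcols : ∀ x, 0 ≤ x → x < c → ∃ y, (x, y) ∈ K)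
    [DecidablePred (· ∈ Box 0 y₀ c c)] :
    2 * c ≤ (nb S K).card + (S.filter (· ∈ Box 0 y₀ c c)).card := by
  classical
  obtain ⟨y₁, hy₁⟩ := hcols 0 le_rfl hc
  have hr := hK.misses_right h ⟨_, hy₁, rfl⟩
  set F := (nb S K).filter fun s => 0 ≤ s.1 ∧ s.1 < c
  set G := (nb S K).filter fun s => y₀ ≤ s.2 ∧ s.2 < y₀ + c
  have hG := card_ge_of_rows G y₀ (y₀ + c) fun y h1 h2 => by
    obtain ⟨x, hx⟩ := hrows y h1 h2
    obtain ⟨z, hz⟩ := exists_rightOf hK.sub hK.bdry (fun u hu => by have := hr u hu; omega) hx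
    exact ⟨z, Finset.mem_filter.2 ⟨hz.mem_nb, h1, h2⟩⟩
  have hF := card_ge_of_cols F 0 c fun x h1 h2 => by
    obtain ⟨y, hy⟩ := hcols x h1 h2
    by_cases hb : ∃ u ∈ K, u.2 = 0
    · have ht := hK.misses_top h hb
      obtain ⟨z, hz⟩ := exists_above hK.sub hK.bdry (fun u hu => by have := ht u hu; omega) hy
      exact ⟨z, Finset.mem_filter.2 ⟨hz.mem_nb, h1, h2⟩⟩
    · push Not at hb
      obtain ⟨z, hz⟩ := exists_below hK.sub hK.bdry
        (fun u hu => lt_of_le_of_ne (hK.sub hu).2.2.1 (hb u hu).symm) hy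
      exact ⟨z, Finset.mem_filter.2 ⟨hz.mem_nb, h1, h2⟩⟩
  -- The hits closing the columns and those closing the rows overlap only inside the square.
  have h1 : (F ∪ G).card ≤ (nb S K).card := Finset.card_le_card
    (Finset.union_subset (Finset.filter_subset _ _) (Finset.filter_subset _ _))
  have h2 : (F ∩ G).card ≤ (S.filter (· ∈ Box 0 y₀ c c)).card := by
    refine Finset.card_le_card fun s hs => ?_
    rw [Finset.mem_inter, Finset.mem_filter, Finset.mem_filter, mem_nb] at hs
    exact Finset.mem_filter.2 ⟨hs.1.1.1, hs.1.2.1, by omega, hs.2.2.1, hs.2.2.2⟩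
  have h3 := Finset.card_union_add_card_inter F G
  omega

/-- Captured sets at opposite sides have no common neighbouring hit. -/
theorem Captured.card_nb_add_card_nb_le {K' : Set Cell} (hK : Captured m S D K)
    (hK' : Captured m S D K') (h : State m S D)
    (hc : ((∃ u ∈ K, u.1 = 0) ∧ ∃ u ∈ K', u.1 = m - 1) ∨ ((∃ u ∈ K, u.2 = 0) ∧ ∃ u ∈ K', u.2 = m - 1)) :
    (nb S K).card + (nb S K').card ≤ S.card := by
  have := card_add_le_of_disjoint (F := nb S K) (G := nb S K') (S := S)
    (fun s hs => (mem_nb.1 hs).1) (fun s hs => (mem_nb.1 hs).1) fun w hw hw' => by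
      obtain ⟨hwS, u, hu, huw⟩ := mem_nb.1 hw
      obtain ⟨-, v, hv, hvw⟩ := mem_nb.1 hw'
      -- A common hit would glue the two sets into a crossing disjoint from `D`.
      have hconn := (hK.conn.union (isConn_singleton w) hu rfl (Or.inr huw)).union hK'.conn
        (p := w) (q := v) (Or.inr rfl) hv (Or.inr hvw.symm)
      obtain ⟨p, hp, hpD⟩ := h.cross _ (by
        rintro p ((hp | rfl) | hp)
        · exact hK.sub hp
        · exact h.hits _ hwS
        · exact hK'.sub hp) hconn (by
        rcases hc with ⟨⟨u, hu, hu'⟩, v, hv, hv'⟩ | ⟨⟨u, hu, hu'⟩, v, hv, hv'⟩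
        · exact Or.inl ⟨⟨u, Or.inl (Or.inl hu), hu'⟩, v, Or.inr hv, hv'⟩
        · exact Or.inr ⟨⟨u, Or.inl (Or.inl hu), hu'⟩, v, Or.inr hv, hv'⟩)
      rcases hp with (hp | rfl) | hp
      · exact hK.notD p hp hpD
      · exact h.disj _ hpD hwS
      · exact hK'.notD p hp hpD
  exact_mod_cast this

end GridRank

namespace GridRank

variable {m : ℤ} {S : Finset Cell} {D K : Set Cell} {φ : Cell → Cell}

/-! ### Hits in corner squares and the end of the process -/

/-- The number of hits in a region. -/
noncomputable def hitsIn (S : Finset Cell) (A : Set Cell) : ℕ :=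
  (@Finset.filter _ (· ∈ A) (Classical.decPred _) S).card

theorem hitsIn_eq (S : Finset Cell) (A : Set Cell) [DecidablePred (· ∈ A)] :
    hitsIn S A = (S.filter (· ∈ A)).card := by
  unfold hitsIn
  congr

theorem hitsIn_mono {A B : Set Cell} (h : ∀ s ∈ S, s ∈ A → s ∈ B) : hitsIn S A ≤ hitsIn S B := by
  classical
  rw [hitsIn_eq, hitsIn_eq]
  exact Finset.card_le_card fun s hs => by
    rw [Finset.mem_filter] at *
    exact ⟨hs.1, h s hs.1 hs.2⟩

theorem hitsIn_add_le {A B C : Set Cell} (hA : ∀ s ∈ S, s ∈ A → s ∈ C) (hB : ∀ s ∈ S, s ∈ B → s ∈ C)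
    (hAB : ∀ s ∈ S, s ∈ A → s ∉ B) : hitsIn S A + hitsIn S B ≤ hitsIn S C := by
  classical
  rw [hitsIn_eq, hitsIn_eq, hitsIn_eq, ← Finset.card_union_of_disjoint]
  · refine Finset.card_le_card fun s hs => ?_
    simp only [Finset.mem_union, Finset.mem_filter] at *
    rcases hs with hs | hs
    · exact ⟨hs.1, hA s hs.1 hs.2⟩
    · exact ⟨hs.1, hB s hs.1 hs.2⟩
  · rw [Finset.disjoint_left]
    intro s hs hs'
    rw [Finset.mem_filter] at *
    exact hAB s hs.1 hs.2 hs'.2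

theorem hitsIn_le_add {A B C : Set Cell} (h : ∀ s ∈ S, s ∈ A → s ∈ B ∨ s ∈ C) :
    hitsIn S A ≤ hitsIn S B + hitsIn S C := by
  classical
  rw [hitsIn_eq, hitsIn_eq, hitsIn_eq]
  refine (Finset.card_le_card fun s hs => ?_).trans (Finset.card_union_le _ _)
  simp only [Finset.mem_union, Finset.mem_filter] at *
  exact (h s hs.1 hs.2).imp (fun h => ⟨hs.1, h⟩) fun h => ⟨hs.1, h⟩

theorem hitsIn_univ (S : Finset Cell) : hitsIn S Set.univ = S.card := by
  classical
  rw [hitsIn_eq]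
  simp

theorem hitsIn_ge_cols (A : Set Cell) (a b : ℤ)
    (h : ∀ x, a ≤ x → x < b → ∃ y, (x, y) ∈ S ∧ (x, y) ∈ A) : b - a ≤ hitsIn S A := by
  classical
  rw [hitsIn_eq]
  exact card_ge_of_cols _ a b fun x h1 h2 => (h x h1 h2).imp fun y hy => Finset.mem_filter.2 hy

theorem hitsIn_ge_rows (A : Set Cell) (a b : ℤ)
    (h : ∀ y, a ≤ y → y < b → ∃ x, (x, y) ∈ S ∧ (x, y) ∈ A) : b - a ≤ hitsIn S A := by
  classical
  rw [hitsIn_eq]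
  exact card_ge_of_rows _ a b fun x h1 h2 => (h x h1 h2).imp fun y hy => Finset.mem_filter.2 hy

theorem Sym.hitsIn (hφ : Sym m φ) (A : Set Cell) :
    hitsIn (S.image φ) A = hitsIn S {p | φ p ∈ A} := by
  classical
  rw [hitsIn_eq, hitsIn_eq]
  exact hφ.card_filter _

/-- The hits to the left of a set `K` captured in the lower left corner and above its square. -/
theorem left_count {a c t : ℤ} (hS : ∀ s ∈ S, s ∈ Box 0 0 m m) (sub : K ⊆ Box 0 0 m m)
    (conn : IsConn K) (bdry : ∀ u ∈ K, ∀ v ∈ Box 0 0 m m, Adj u v → v ∉ K → v ∈ S)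
    (hr : ∀ u ∈ K, u.1 < m - 1) (ht : ∀ u ∈ K, u.2 < m - 1)
    (hcol : ∀ x, 0 ≤ x → x < c → ∃ y, (x, y) ∈ K) (hbot : ∃ u ∈ K, u.2 = 0) {w : Cell}
    (hw1 : w.1 < c) (hw2 : w.2 < c) (hne : ∀ p ∈ K, ¬ (w.1 ≤ p.1 ∧ w.2 ≤ p.2)) (ha : a ≤ c)
    (hc : 0 ≤ c) (hcm : c ≤ m - a) (hTL : t + 1 ≤ hitsIn S {p | p.1 < a ∧ m - a ≤ p.2}) :
    t + 1 + min (c - hitsIn S (Box 0 0 c c)) (m - a - c) ≤ hitsIn S {p | p.1 < c ∧ c ≤ p.2} := by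
  have h1 : hitsIn S {p | p.1 < c ∧ c ≤ p.2 ∧ p.2 < m - a} + hitsIn S {p | p.1 < a ∧ m - a ≤ p.2} ≤
      hitsIn S {p | p.1 < c ∧ c ≤ p.2} := by
    refine hitsIn_add_le ?_ ?_ ?_ <;> intro s _ hs <;> simp only [Set.mem_ofPred_eq] at * <;> omega
  -- If `K` climbs to the upper corner square, each row in between has a hit to the right of `K`,
  -- still in the first `c` columns because `K` avoids the quadrant at `w`. Otherwise all `c`
  -- columns are closed below that corner square, with at most the hits of the `c × c` box
  -- discounted.
  by_cases hh : ∃ u ∈ K, m - a - 1 ≤ u.2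
  · obtain ⟨u, hu, hu'⟩ := hh
    obtain ⟨v, hv, hv'⟩ := hbot
    have h2 := hitsIn_ge_rows (S := S) {p | p.1 < c ∧ c ≤ p.2 ∧ p.2 < m - a} c (m - a)
      fun y hy hy' => by
        obtain ⟨x, hx⟩ := conn.exists_row hv hu (y := y) (by omega) (by omega)
        obtain ⟨z, hz⟩ := exists_rightOf sub bdry (fun u hu => by have := hr u hu; omega) hx
        have := hne _ hz.2.1
        dsimp only at this
        exact ⟨z, hz.1, by dsimp only; omega, hy, hy'⟩
    omega
  · push Not at hh
    have h2 := hitsIn_ge_cols (S := S) {p | p.1 < c ∧ p.2 < m - a} 0 c fun x hx hx' => by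
      obtain ⟨y, hy⟩ := hcol x hx hx'
      obtain ⟨z, hz⟩ := exists_above sub bdry (fun u hu => by have := ht u hu; omega) hy
      have := hh _ hz.2.1
      dsimp only at this
      exact ⟨z, hz.1, hx', by dsimp only; omega⟩
    have h3 : hitsIn S {p | p.1 < c ∧ p.2 < m - a} ≤ hitsIn S (Box 0 0 c c) +
        hitsIn S {p | p.1 < c ∧ c ≤ p.2 ∧ p.2 < m - a} := by
      refine hitsIn_le_add fun s hs hs' => ?_
      have := hS s hs
      simp only [Set.mem_ofPred_eq, mem_Box] at *
      omega
    omega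

theorem corner_captured {ρ m c : ℕ} (hD : State m S D) (hρ : Rk ρ D) (hc : 0 < c) (hcm : c ≤ m)
    (hq : 3 * hitsIn S (Box 0 0 c c) ≤ 2 * c) (hlt : ρ + hitsIn S (Box 0 0 c c) < gridRank c c) :
    ∃ K, Captured m S D K ∧ (∀ x : ℤ, 0 ≤ x → x < c → ∃ y, (x, y) ∈ K) ∧
      (∀ y : ℤ, 0 ≤ y → y < c → ∃ x, (x, y) ∈ K) ∧ (∃ u ∈ K, u.1 = 0) ∧ (∃ u ∈ K, u.2 = 0) ∧
      2 * c ≤ (nb S K).card + hitsIn S (Box 0 0 c c) := by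
  classical
  rw [hitsIn_eq] at *
  obtain ⟨K, hK, hrow, hcol⟩ := exists_captured (S' := S) (x₀ := 0) (y₀ := 0) (c := c) subset_rfl hD
    (hρ.mono_set Set.sdiff_subset) (by rintro p ⟨h1, h2, h3, h4⟩; exact ⟨h1, by omega, h3, by omega⟩)
    hc hq hlt
  set F := S.filter (· ∈ Box 0 0 c c)
  obtain ⟨γ, hγ1, hγ2, hγ⟩ := exists_free (F.image Prod.fst) 0 c (by
    have : (F.image Prod.fst).card ≤ F.card := Finset.card_image_le
    omega)
  obtain ⟨ϱ, hϱ1, hϱ2, hϱ⟩ := exists_free (F.image Prod.snd) 0 c (by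
    have : (F.image Prod.snd).card ≤ F.card := Finset.card_image_le
    omega)
  have h1 : ∀ x : ℤ, 0 ≤ x → x < c → (x, ϱ) ∈ K := fun x hx hx' =>
    hrow ϱ hϱ1 hϱ2 (fun s hs hs' he => hϱ (Finset.mem_image.2 ⟨s, Finset.mem_filter.2 ⟨hs, hs'⟩, he⟩))
      x hx (by omega)
  have h2 : ∀ y : ℤ, 0 ≤ y → y < c → (γ, y) ∈ K := fun x hx hx' =>
    hcol γ hγ1 hγ2 (fun s hs hs' he => hγ (Finset.mem_image.2 ⟨s, Finset.mem_filter.2 ⟨hs, hs'⟩, he⟩))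
      x hx (by omega)
  have h3 := hK.two_mul_le hD (y₀ := 0) (c := c) (by omega)
    (fun y hy hy' => ⟨γ, h2 y hy (by omega)⟩) (fun x hx hx' => ⟨ϱ, h1 x hx hx'⟩)
  exact ⟨K, hK, fun x hx hx' => ⟨ϱ, h1 x hx hx'⟩, fun y hy hy' => ⟨γ, h2 y hy hy'⟩,
    ⟨_, h1 0 le_rfl (by omega), rfl⟩, ⟨_, h2 0 le_rfl (by omega), rfl⟩, by exact_mod_cast h3⟩

/-- Two different corner squares with few hits. -/
theorem two_corners {ρ m c c' : ℕ} {α β : Bool} (hαβ : α = true ∨ β = true) (hD : State m S D)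
    (hρ : Rk ρ D) (hc : 0 < c) (hcm : c ≤ m)
    (hq : 3 * hitsIn S (Box 0 0 c c) ≤ 2 * c) (hlt : ρ + hitsIn S (Box 0 0 c c) < gridRank c c)
    (hc' : 0 < c') (hcm' : c' ≤ m) (hq' : 3 * hitsIn S {p | flip m α β p ∈ Box 0 0 c' c'} ≤ 2 * c')
    (hlt' : ρ + hitsIn S {p | flip m α β p ∈ Box 0 0 c' c'} < gridRank c' c') :
    2 * c + 2 * c' ≤ S.card + hitsIn S (Box 0 0 c c) +
      hitsIn S {p | flip m α β p ∈ Box 0 0 c' c'} := by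
  have hφ := Sym.flip m α β
  obtain ⟨K, hK, -, -, hl, hb, hn⟩ := corner_captured hD hρ hc hcm hq hlt
  rw [← hφ.hitsIn] at *
  obtain ⟨K', hK', -, -, ⟨u, hu, hu'⟩, ⟨v, hv, hv'⟩, hn'⟩ :=
    corner_captured (hD.map hφ) (hφ.rk hρ) hc' hcm' hq' hlt'
  have hK'' := hK'.map hφ
  rw [hφ.image_image, hφ.preimage_preimage] at hK''
  have hnb : (nb S {p | flip m α β p ∈ K'}).card = (nb (S.image (flip m α β)) K').card := by
    have := hφ.card_nb (S := S.image (flip m α β)) (K := K')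
    rwa [hφ.image_image] at this
  have := hK.card_nb_add_card_nb_le hK'' hD (by
    rcases hαβ with rfl | rfl
    · refine Or.inl ⟨hl, flip m true β u, ?_, ?_⟩
      · rw [Set.mem_ofPred_eq, hφ.inv]; exact hu
      · simp [GridRank.flip, hu']
    · refine Or.inr ⟨hb, flip m α true v, ?_, ?_⟩
      · rw [Set.mem_ofPred_eq, hφ.inv]; exact hv
      · simp [GridRank.flip, hv'])
  omega

/-- The numerical relations between the size of the big square, the size of the small square, and
the bound for the number of excess hits. -/
def Params (m a t : ℕ) : Prop :=
  (∃ j, a = 2 * j + 1 ∧ m = 5 * j + 3 ∧ t = j) ∨ ∃ j, a = 2 * j + 2 ∧ m = 5 * j + 6 ∧ t = j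

/-- A corner square with few hits is captured, so the other corners must hold many. The few hits
left for the two arms along the sides force the captured set into an L shape, whose arms then need
more hits than remain. -/
theorem not_small_corner {ρ m a t : ℕ} (hp : Params m a t) (hD : State m S D) (hρ : Rk ρ D)
    (hS : S.card = m + t) (hρt : ρ + t + 1 = gridRank a a) {b : ℕ} (hab : a ≤ b) (hb : 2 * b ≤ m) :
    t + b < hitsIn S (Box 0 0 b b) + a := by
  by_contra hcon
  have hex : ∃ c, a ≤ c ∧ c ≤ b ∧ hitsIn S (Box 0 0 c c) + a ≤ t + c := ⟨b, hab, le_rfl, by omega⟩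
  classical
  obtain ⟨c, ⟨hac, hcb, hqc⟩, hmin⟩ : ∃ c, (a ≤ c ∧ c ≤ b ∧ hitsIn S (Box 0 0 c c) + a ≤ t + c) ∧
      ∀ c' < c, ¬ (a ≤ c' ∧ c' ≤ b ∧ hitsIn S (Box 0 0 c' c') + a ≤ t + c') :=
    ⟨Nat.find hex, Nat.find_spec hex, fun c' h => Nat.find_min hex h⟩
  have hgr : ∀ d, a ≤ d → gridRank a a + (d - a) ≤ gridRank d d := fun d hd => by
    have := gridRank_add_le a (d - a)
    rwa [Nat.add_sub_cancel' hd] at this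
  have hpar : 3 * t + m < 4 * a ∧ 2 * t + 1 ≤ a ∧ 2 * a ≤ m ∧ 0 < a ∧ m + b ≤ 4 * a + m - 3 * t := by
    rcases hp with ⟨j, rfl, rfl, rfl⟩ | ⟨j, rfl, rfl, rfl⟩ <;> omega
  -- Minimality: the square of side `c - 1` has too many hits, and passing to side `c` loses none.
  have hca : c = a ∨ hitsIn S (Box 0 0 c c) + a = t + c := by
    by_contra hcon
    have h1 := hmin (c - 1) (by omega)
    have h2 : hitsIn S (Box 0 0 (c - 1 : ℕ) (c - 1 : ℕ)) ≤ hitsIn S (Box 0 0 c c) :=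
      hitsIn_mono fun s _ hs => by
        simp only [mem_Box] at *
        omega
    omega
  have hgc := hgr c hac
  have hq3 : 3 * hitsIn S (Box 0 0 c c) ≤ 2 * c := by omega
  have hqlt : ρ + hitsIn S (Box 0 0 c c) < gridRank c c := by omega
  have hTL : t + 1 ≤ hitsIn S {p | flip m false true p ∈ Box 0 0 a a} := by
    by_contra hcon
    have := two_corners (α := false) (β := true) (c := c) (c' := a) (Or.inr rfl) hD hρ (by omega)
      (by omega) hq3 hqlt (by omega) (by omega) (by omega) (by omega)
    omega
  have hBR : t + 1 ≤ hitsIn S {p | flip m true false p ∈ Box 0 0 a a} := by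
    by_contra hcon
    have := two_corners (α := true) (β := false) (c := c) (c' := a) (Or.inl rfl) hD hρ (by omega)
      (by omega) hq3 hqlt (by omega) (by omega) (by omega) (by omega)
    omega
  have hTR : t + m + 1 ≤ hitsIn S {p | flip m true true p ∈ Box 0 0 (m - c : ℕ) (m - c : ℕ)} +
      a + c := by
    by_contra hcon
    have hgd := hgr (m - c) (by omega)
    have := two_corners (α := true) (β := true) (c := c) (c' := m - c) (Or.inl rfl) hD hρ (by omega)
      (by omega) hq3 hqlt (by omega) (by omega) (by omega) (by omega)
    omega
  obtain ⟨K, hK, hcol, hrow, hl, hbt, -⟩ := corner_captured hD hρ (by omega) (by omega) hq3 hqlt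
  have hr := hK.misses_right hD hl
  have ht := hK.misses_top hD hbt
  have hout : hitsIn S {p | flip m true true p ∈ Box 0 0 (m - c : ℕ) (m - c : ℕ)} +
      hitsIn S {p | p.1 < c ∨ p.2 < c} ≤ S.card := by
    rw [← hitsIn_univ]
    refine hitsIn_add_le (fun _ _ _ => trivial) (fun _ _ _ => trivial) fun s _ hs hs' => ?_
    simp only [mem_Box, GridRank.flip, Set.mem_ofPred_eq, if_true] at *
    omega
  have hA := hitsIn_ge_cols (S := S) {s | s.1 < c ∧ Above S K s} 0 c fun x hx hx' => by
    obtain ⟨y, hy⟩ := hcol x hx hx'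
    obtain ⟨z, hz⟩ := exists_above hK.sub hK.bdry (fun u hu => by have := ht u hu; omega) hy
    exact ⟨z, hz.1, hx', hz⟩
  have hB := hitsIn_ge_rows (S := S) {s | s.2 < c ∧ RightOf S K s} 0 c fun x hx hx' => by
    obtain ⟨y, hy⟩ := hrow x hx hx'
    obtain ⟨z, hz⟩ := exists_rightOf hK.sub hK.bdry (fun u hu => by have := hr u hu; omega) hy
    exact ⟨z, hz.1, hx', hz⟩
  -- Outside the opposite square of side `m - c` at most a + c - 1 < 2c hits remain, so some hit
  -- closes both a column and a row.
  obtain ⟨w, hwA, hwB⟩ : ∃ w, w ∈ {s : Cell | s.1 < c ∧ Above S K s} ∧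
      w ∈ {s : Cell | s.2 < c ∧ RightOf S K s} := by
    by_contra hcon
    push Not at hcon
    have : hitsIn S {s | s.1 < c ∧ Above S K s} + hitsIn S {s | s.2 < c ∧ RightOf S K s} ≤
        hitsIn S {p | p.1 < c ∨ p.2 < c} :=
      hitsIn_add_le (fun s _ h => Or.inl h.1) (fun s _ h => Or.inr h.1) fun s _ h => hcon s h
    omega
  have hne : ∀ p ∈ K, ¬ (w.1 ≤ p.1 ∧ w.2 ≤ p.2) := fun p hp =>
    hK.conn.no_upper_right hwA.2.2.1 hwA.2.2.2 hwB.2.2.2 hp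
  have hTL' : hitsIn S {p | flip m false true p ∈ Box 0 0 a a} ≤
      hitsIn S {p | p.1 < a ∧ (m : ℤ) - a ≤ p.2} := hitsIn_mono fun s _ hs => by
    simp only [mem_Box, GridRank.flip, Set.mem_ofPred_eq, if_true, if_false, Bool.false_eq_true] at *
    omega
  have hBR' : hitsIn S {p | flip m true false p ∈ Box 0 0 a a} ≤
      hitsIn S {p | p.2 < a ∧ (m : ℤ) - a ≤ p.1} := hitsIn_mono fun s _ hs => by
    simp only [mem_Box, GridRank.flip, Set.mem_ofPred_eq, if_true, if_false, Bool.false_eq_true] at *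
    omega
  have hleft := left_count (a := a) (c := c) (t := t) hD.hits hK.sub hK.conn hK.bdry hr ht hcol hbt
    hwA.1 hwB.1 hne (by omega) (by omega) (by omega) (by omega)
  have hs := Sym.swap m
  have hbot := left_count (a := a) (c := c) (t := t) (w := w.swap) (hD.map hs).hits (hK.map hs).sub
    (hK.map hs).conn (hK.map hs).bdry (fun u hu => ht _ hu) (fun u hu => hr _ hu)
    (fun x hx hx' => hrow x hx hx') (by
      obtain ⟨u, hu, hu'⟩ := hl
      exact ⟨u.swap, hu, hu'⟩) hwB.1 hwA.1 (fun p hp h => hne _ hp ⟨h.2, h.1⟩)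
    (by omega) (by omega) (by omega) (by
      rw [hs.hitsIn]
      have : hitsIn S {p | p.swap ∈ {p : Cell | p.1 < a ∧ (m : ℤ) - a ≤ p.2}} =
        hitsIn S {p | p.2 < a ∧ (m : ℤ) - a ≤ p.1} := rfl
      rw [this]
      omega)
  rw [hs.hitsIn, hs.hitsIn] at hbot
  have e1 : hitsIn S {p | p.swap ∈ Box 0 0 (c : ℤ) c} ≤ hitsIn S (Box 0 0 c c) :=
    hitsIn_mono fun s _ h => tr_box.1 h
  have e2 : hitsIn S {p | p.swap ∈ {p : Cell | p.1 < c ∧ c ≤ p.2}} =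
    hitsIn S {p | p.2 < c ∧ c ≤ p.1} := rfl
  rw [e2] at hbot
  have e3 : hitsIn S {p | p.2 < c ∧ c ≤ p.1} + hitsIn S {p | p.1 < c ∧ c ≤ p.2} ≤
      hitsIn S {p | (p.2 < c ∧ c ≤ p.1) ∨ (p.1 < c ∧ c ≤ p.2)} :=
    hitsIn_add_le (fun _ _ h => Or.inl h) (fun _ _ h => Or.inr h) fun s _ h h' => by
      simp only [Set.mem_ofPred_eq] at *
      omega
  have e4 : hitsIn S {p | (p.2 < c ∧ c ≤ p.1) ∨ (p.1 < c ∧ c ≤ p.2)} + hitsIn S (Box 0 0 c c) ≤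
      hitsIn S {p | p.1 < c ∨ p.2 < c} := by
    refine hitsIn_add_le ?_ ?_ ?_ <;> intro s _ h <;> simp only [Set.mem_ofPred_eq, mem_Box] at * <;>
      omega
  rcases hp with ⟨j, rfl, rfl, rfl⟩ | ⟨j, rfl, rfl, rfl⟩ <;> omega

/-- Four disjoint corner squares of side ⌊m/2⌋ need at least 4(t + b + 1 - a) hits. This exceeds m +
t except when m is odd and equality holds, so that all hits lie in these squares. -/
theorem not_state {ρ m a t : ℕ} (hp : Params m a t) (hD : State m S D) (hρ : Rk ρ D)
    (hS : S.card = m + t) (hρt : ρ + t + 1 = gridRank a a) : False := by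
  obtain ⟨b, hb, hb'⟩ : ∃ b, 2 * b ≤ m ∧ m ≤ 2 * b + 1 := ⟨m / 2, by omega, by omega⟩
  have hpar : a ≤ b ∧ (4 * (t + b + 1 - a) ≤ m + t → m = 2 * b + 1 ∧
      4 * (t + b + 1 - a) = m + t) ∧ 3 * t + m < 4 * a ∧ b + 1 + a ≤ m := by
    rcases hp with ⟨j, rfl, rfl, rfl⟩ | ⟨j, rfl, rfl, rfl⟩ <;> omega
  have hcorner : ∀ α β, t + b < hitsIn S {p | flip m α β p ∈ Box 0 0 b b} + a := by
    intro α β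
    have hφ := Sym.flip m α β
    have := not_small_corner hp (hD.map hφ) (hφ.rk hρ) (hφ.card_image.trans hS) hρt hpar.1 hb
    rwa [hφ.hitsIn] at this
  have key : ∀ c d : ℕ, c + d ≤ m → c + b ≤ m → d + b ≤ m →
      hitsIn S {p | flip m false false p ∈ Box 0 0 c c} +
      hitsIn S {p | flip m true false p ∈ Box 0 0 b b} +
      hitsIn S {p | flip m false true p ∈ Box 0 0 b b} +
      hitsIn S {p | flip m true true p ∈ Box 0 0 d d} ≤ S.card := by
    intro c d h1 h2 h3
    rw [← hitsIn_univ]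
    set A := {p | flip m false false p ∈ Box 0 0 c c} with hA
    set B := {p | flip m true false p ∈ Box 0 0 b b} with hB
    set C := {p | flip m false true p ∈ Box 0 0 b b} with hC
    set E := {p | flip m true true p ∈ Box 0 0 d d} with hE
    have e1 : hitsIn S A + hitsIn S B ≤ hitsIn S {p | p ∈ A ∨ p ∈ B} :=
      hitsIn_add_le (fun _ _ h => Or.inl h) (fun _ _ h => Or.inr h) fun s _ h h' => by
        simp only [hA, hB, mem_Box, GridRank.flip, Set.mem_ofPred_eq, if_true, if_false,
          Bool.false_eq_true] at h h'
        omega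
    have e2 : hitsIn S {p | p ∈ A ∨ p ∈ B} + hitsIn S C ≤ hitsIn S {p | (p ∈ A ∨ p ∈ B) ∨ p ∈ C} :=
      hitsIn_add_le (fun _ _ h => Or.inl h) (fun _ _ h => Or.inr h) fun s _ h h' => by
        simp only [hA, hB, hC, mem_Box, GridRank.flip, Set.mem_ofPred_eq, if_true, if_false,
          Bool.false_eq_true] at h h'
        omega
    have e3 : hitsIn S {p | (p ∈ A ∨ p ∈ B) ∨ p ∈ C} + hitsIn S E ≤ hitsIn S Set.univ :=
      hitsIn_add_le (fun _ _ _ => trivial) (fun _ _ _ => trivial) fun s _ h h' => by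
        simp only [hA, hB, hC, hE, mem_Box, GridRank.flip, Set.mem_ofPred_eq, if_true, if_false,
          Bool.false_eq_true] at h h'
        omega
    omega
  have h1 := key b b (by omega) (by omega) (by omega)
  have c1 := hcorner false false
  have c2 := hcorner true false
  have c3 := hcorner false true
  have c4 := hcorner true true
  obtain ⟨hm, he⟩ := hpar.2.1 (by omega)
  -- In the equality case, enlarging one corner square to side `b + 1` gains no hit. Two opposite
  -- enlarged squares are then both captured, which costs too many hits.
  have h2 := key (b + 1) b (by omega) (by omega) (by omega)
  have h3 := key b (b + 1) (by omega) (by omega) (by omega)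
  have hgr := gridRank_add_le a (b + 1 - a)
  rw [show a + (b + 1 - a) = b + 1 by omega] at hgr
  have e : {p | flip m false false p ∈ Box 0 0 (b + 1 : ℕ) (b + 1 : ℕ)} =
      Box 0 0 (b + 1 : ℕ) (b + 1 : ℕ) := by
    ext p
    simp [GridRank.flip]
  rw [e] at h2
  have := two_corners (α := true) (β := true) (c := b + 1) (c' := b + 1) (Or.inl rfl) hD hρ (by omega)
    (by omega) (by omega) (by omega) (by omega) (by omega) (by omega) (by omega)
  omega

end GridRank

namespace GridRank

/-! ### Z-shaped paths and blocked sets -/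

/-- The Z-shaped path along row `i`, then column `c`, then row `j`. -/
def zpath (m i c j : ℤ) : Set Cell := {p | p ∈ Box 0 0 m m ∧ ((p.1 ≤ c ∧ p.2 = i) ∨
  (p.1 = c ∧ (i ≤ p.2 ∧ p.2 ≤ j ∨ j ≤ p.2 ∧ p.2 ≤ i)) ∨ (c ≤ p.1 ∧ p.2 = j))}

theorem exists_mem_zpath {m i c j : ℤ} {A : Set Cell} (hA : A ⊆ Box 0 0 m m) (hc : IsConn A)
    (hb : ∃ u ∈ A, u.2 = 0) (ht : ∃ u ∈ A, u.2 = m - 1) (hi : 0 ≤ i) (hi' : i < m) (hj : 0 ≤ j)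
    (hj' : j < m) : ∃ p ∈ A, p ∈ zpath m i c j := by
  by_contra hcon
  push Not at hcon
  have hout : ∀ p ∈ A, 0 ≤ p.1 ∧ p.1 < m ∧ 0 ≤ p.2 ∧ p.2 < m ∧ ¬ ((p.1 ≤ c ∧ p.2 = i) ∨
    (p.1 = c ∧ (i ≤ p.2 ∧ p.2 ≤ j ∨ j ≤ p.2 ∧ p.2 ≤ i)) ∨ (c ≤ p.1 ∧ p.2 = j)) := by
    intro p hp
    have h1 := hA hp
    have h2 := hcon p hp
    simp only [zpath, mem_Box, Set.mem_ofPred_eq, zero_add] at h1 h2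
    exact ⟨h1.1, h1.2.1, h1.2.2.1, h1.2.2.2, fun h => h2 ⟨h1, h⟩⟩
  obtain ⟨u, hu, hu'⟩ := hb
  obtain ⟨v, hv, hv'⟩ := ht
  have e1 := hout u hu
  have e2 := hout v hv
  -- The exited set consists of the cells strictly below the path; a step out of it would have to
  -- land on the path.
  obtain ⟨p, q, hpq, hp, hq, hpB, hqB⟩ := (hc u hu v hv).exit
    (B := {p | (p.1 < c ∧ p.2 < i) ∨ (c < p.1 ∧ p.2 < j) ∨ (p.1 = c ∧ p.2 < i ∧ p.2 < j)})
    (by simp only [Set.mem_ofPred_eq]; omega) (by simp only [Set.mem_ofPred_eq]; omega)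
  have e3 := hout p hp
  have e4 := hout q hq
  simp only [Set.mem_ofPred_eq, Adj] at hpB hqB hpq
  omega

theorem isConn_zpath {m i c j : ℤ} (hi : 0 ≤ i) (hi' : i < m) (hj : 0 ≤ j) (hj' : j < m)
    (hc : 0 ≤ c) (hc' : c < m) : IsConn (zpath m i c j) := by
  have hmem : ∀ x y, (x, y) ∈ zpath m i c j ↔ (0 ≤ x ∧ x < m ∧ 0 ≤ y ∧ y < m) ∧ ((x ≤ c ∧ y = i) ∨
      (x = c ∧ (i ≤ y ∧ y ≤ j ∨ j ≤ y ∧ y ≤ i)) ∨ (c ≤ x ∧ y = j)) := by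
    intro x y
    simp only [zpath, mem_Box, Set.mem_ofPred_eq, zero_add]
  have key : ∀ u ∈ zpath m i c j, Conn (zpath m i c j) u (c, i) := by
    rintro ⟨x, y⟩ hu
    rw [hmem] at hu
    obtain ⟨h0, h1 | h1 | h1⟩ := hu
    · obtain ⟨h1, rfl⟩ := h1
      exact conn_row fun z hz => (hmem _ _).2 (by omega)
    · obtain ⟨rfl, h1⟩ := h1
      exact conn_col fun z hz => (hmem _ _).2 (by omega)
    · obtain ⟨h1, rfl⟩ := h1
      exact Conn.trans (q := (c, y)) (conn_row fun z hz => (hmem _ _).2 (by omega))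
        (conn_col fun z hz => (hmem _ _).2 (by omega))
  exact fun u hu v hv => (key u hu).trans (key v hv).symm

theorem zpath_subset (m i c j : ℤ) : zpath m i c j ⊆ Box 0 0 m m := fun _ h => h.1

/-- All Z-shaped paths meet `S`. -/
def Blocked (m : ℤ) (S : Finset Cell) : Prop :=
  ∀ i c j, 0 ≤ i → i < m → 0 ≤ c → c < m → 0 ≤ j → j < m → ∃ s ∈ S, s ∈ zpath m i c j

variable {m a t s ρ : ℕ} {S' S : Finset Cell} {D : Set Cell}

theorem Blocked.flip {m : ℤ} (h : Blocked m S) : Blocked m (S.image (flip m true false)) := by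
  intro i c j h1 h2 h3 h4 h5 h6
  obtain ⟨s, hs, hs'⟩ := h j (m - 1 - c) i h5 h6 (by omega) (by omega) h1 h2
  refine ⟨_, Finset.mem_image_of_mem _ hs, ?_⟩
  simp only [zpath, mem_Box, Set.mem_ofPred_eq, GridRank.flip, if_true, if_false,
    Bool.false_eq_true] at *
  omega

/-- A Z-path with equal end rows is a full row. -/
theorem Blocked.exists_hit_row {m : ℤ} (h : Blocked m S) {i : ℤ} (hi : 0 ≤ i) (hi' : i < m) :
    ∃ x, (x, i) ∈ S := by
  obtain ⟨s, hs, hs'⟩ := h i 0 i hi hi' le_rfl (by omega) hi hi'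
  have : s.2 = i := by
    simp only [zpath, Set.mem_ofPred_eq] at hs'
    omega
  exact ⟨s.1, this ▸ hs⟩

/-- The hits in a horizontal strip of height `a`. -/
theorem Blocked.hitsIn_strip_le (h : Blocked m S) (hcard : S.card = m + s) {y : ℤ} (hy : 0 ≤ y)
    (hy' : y + a ≤ m) : hitsIn S {p | y ≤ p.2 ∧ p.2 < y + a} ≤ a + s := by
  have h1 := hitsIn_ge_rows (S := S) {p | p.2 < y} 0 y fun i hi hi' => by
    obtain ⟨x, hx⟩ := h.exists_hit_row hi (by omega)
    exact ⟨x, hx, hi'⟩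
  have h2 := hitsIn_ge_rows (S := S) {p | y + a ≤ p.2} (y + a) m fun i hi hi' => by
    obtain ⟨x, hx⟩ := h.exists_hit_row (i := i) (by omega) (by omega)
    exact ⟨x, hx, hi⟩
  have h3 : hitsIn S {p | p.2 < y} + hitsIn S {p | y + a ≤ p.2} ≤
      hitsIn S {p | p.2 < y ∨ y + a ≤ p.2} :=
    hitsIn_add_le (fun _ _ h => Or.inl h) (fun _ _ h => Or.inr h) fun s _ h h' => by
      simp only [Set.mem_ofPred_eq] at h h'
      omega
  have h4 : hitsIn S {p | p.2 < y ∨ y + a ≤ p.2} + hitsIn S {p | y ≤ p.2 ∧ p.2 < y + a} ≤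
      hitsIn S Set.univ :=
    hitsIn_add_le (fun _ _ _ => trivial) (fun _ _ _ => trivial) fun s _ h h' => by
      simp only [Set.mem_ofPred_eq] at h h'
      omega
  rw [hitsIn_univ] at h4
  omega

/-- The hits in the left part of a strip whose right end has many hits. -/
theorem Blocked.hitsIn_left_lt (h : Blocked m S) (hcard : S.card = m + s)
    (hR : ∀ y : ℤ, 0 ≤ y → y + a ≤ m → s + 1 ≤ hitsIn S (Box (m - a) y a a)) {y : ℤ} (hy : 0 ≤ y)
    (hy' : y + a ≤ m) : hitsIn S {p | p.1 < (m : ℤ) - a ∧ y ≤ p.2 ∧ p.2 < y + a} + 1 ≤ a := by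
  have h1 := h.hitsIn_strip_le hcard hy hy'
  have h2 := hR y hy hy'
  have h3 : hitsIn S {p | p.1 < (m : ℤ) - a ∧ y ≤ p.2 ∧ p.2 < y + a} + hitsIn S (Box (m - a) y a a) ≤
      hitsIn S {p | y ≤ p.2 ∧ p.2 < y + a} := by
    refine hitsIn_add_le ?_ ?_ ?_ <;> intro s _ h <;> simp only [Set.mem_ofPred_eq, mem_Box] at * <;>
      omega
  omega

/-- The left part of the strip has fewer than `a` hits for its `a` rows. The same count yields a
free column there, since a ≤ m - a. -/
theorem Blocked.exists_right_row (h : Blocked m S) (hcard : S.card = m + s)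
    (hR : ∀ y : ℤ, 0 ≤ y → y + a ≤ m → s + 1 ≤ hitsIn S (Box (m - a) y a a)) {y : ℤ} (hy : 0 ≤ y)
    (hy' : y + a ≤ m) : ∃ i, y ≤ i ∧ i < y + a ∧ ∀ s ∈ S, s.2 = i → (m : ℤ) - a ≤ s.1 := by
  by_contra hcon
  push Not at hcon
  have h1 := h.hitsIn_left_lt hcard hR hy hy'
  have h2 := hitsIn_ge_rows (S := S) {p | p.1 < (m : ℤ) - a ∧ y ≤ p.2 ∧ p.2 < y + a} y (y + a)
    fun i hi hi' => by
      obtain ⟨⟨x, z⟩, hs, rfl, hs'⟩ := hcon i hi hi'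
      exact ⟨x, hs, hs', hi, hi'⟩
  omega

theorem Blocked.exists_free_col (h : Blocked m S) (hcard : S.card = m + s) (hma : 2 * a ≤ m)
    (hR : ∀ y : ℤ, 0 ≤ y → y + a ≤ m → s + 1 ≤ hitsIn S (Box (m - a) y a a)) {y : ℤ} (hy : 0 ≤ y)
    (hy' : y + a ≤ m) : ∃ x, 0 ≤ x ∧ x < (m : ℤ) - a ∧ ∀ z, y ≤ z → z < y + a → (x, z) ∉ S := by
  by_contra hcon
  push Not at hcon
  have h1 := h.hitsIn_left_lt hcard hR hy hy'
  have h2 := hitsIn_ge_cols (S := S) {p | p.1 < (m : ℤ) - a ∧ y ≤ p.2 ∧ p.2 < y + a} 0 (m - a)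
    fun i hi hi' => by
      obtain ⟨z, hz, hz', hs⟩ := hcon i hi hi'
      exact ⟨z, hs, hi', hz, hz'⟩
  omega

/-- If all squares on the right side have many hits, then there is a vertical crossing through
parts of rows. -/
theorem Blocked.exists_crossing (h : Blocked m S) (hcard : S.card = m + s) (hma : 2 * a ≤ m)
    (ha : 0 < a)
    (hR : ∀ y : ℤ, 0 ≤ y → y + a ≤ m → s + 1 ≤ hitsIn S (Box (m - a) y a a)) :
    ∃ A ⊆ Box 0 0 m m \ (S : Set Cell), IsConn A ∧ Crossing m A ∧ ∀ i : ℤ, 0 ≤ i → i < m →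
      (∀ s ∈ S, s.2 = i → (m : ℤ) - a ≤ s.1) → (0, i) ∈ A := by
  obtain ⟨i₀, hi₀, hi₀', hr₀⟩ := h.exists_right_row hcard hR le_rfl (by omega)
  set T : Set Cell := Box 0 0 m m \ S with hT
  have hrow : ∀ i : ℤ, 0 ≤ i → i < m → (∀ s ∈ S, s.2 = i → (m : ℤ) - a ≤ s.1) → ∀ x, 0 ≤ x →
      x < (m : ℤ) - a → (x, i) ∈ T := by
    intro i h1 h2 hr x h3 h4
    refine ⟨⟨h3, ?_, h1, ?_⟩, fun hs => ?_⟩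
    · dsimp only; omega
    · dsimp only; omega
    · have := hr _ hs rfl
      dsimp only at this
      omega
  have hrc : ∀ i : ℤ, 0 ≤ i → i < m → (∀ s ∈ S, s.2 = i → (m : ℤ) - a ≤ s.1) → ∀ x, 0 ≤ x →
      x < (m : ℤ) - a → Conn T (0, i) (x, i) := by
    intro i h1 h2 hr x h3 h4
    exact conn_row fun z hz => hrow i h1 h2 hr z (by omega) (by omega)
  have hpT : ((0 : ℤ), i₀) ∈ T := hrow i₀ hi₀ (by omega) hr₀ 0 le_rfl (by omega)
  have hcolc : ∀ y : ℤ, 0 ≤ y → y + a ≤ m → ∃ x, 0 ≤ x ∧ x < (m : ℤ) - a ∧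
      ∀ z, y ≤ z → z < y + a → (x, z) ∈ T := by
    intro y hy hy'
    obtain ⟨x, hx, hx', hfree⟩ := h.exists_free_col hcard hma hR hy hy'
    refine ⟨x, hx, hx', fun z hz hz' => ⟨⟨hx, ?_, ?_, ?_⟩, hfree z hz hz'⟩⟩
    · dsimp only; omega
    · dsimp only; omega
    · dsimp only; omega
  -- The strip slides up one row at a time. Each strip shares a right row with what is already
  -- connected, and a free column joins it to the new row.
  have key : ∀ n : ℕ, (n : ℤ) + a ≤ m → ∀ i : ℤ, n ≤ i → i < n + a →
      (∀ s ∈ S, s.2 = i → (m : ℤ) - a ≤ s.1) → (0, i) ∈ comp T (0, i₀) := by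
    intro n
    induction n with
    | zero =>
      intro hn i hi hi' hr
      obtain ⟨x, hx, hx', hfree⟩ := hcolc 0 le_rfl (by omega)
      refine ⟨hrow i (by omega) (by omega) hr 0 le_rfl (by omega), ?_⟩
      exact ((hrc i₀ hi₀ (by omega) hr₀ x hx hx').trans
        (conn_col fun z hz => hfree z (by omega) (by omega))).trans
        (hrc i (by omega) (by omega) hr x hx hx').symm
    | succ n ih =>
      intro hn i hi hi' hr
      push_cast at hn hi hi'
      by_cases hia : i < n + a
      · exact ih (by omega) i (by omega) hia hr
      · obtain ⟨x, hx, hx', hfree⟩ := hcolc n (by omega) (by omega)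
        obtain ⟨j, hj, hj', hrj⟩ := h.exists_right_row hcard hR (y := n) (by omega) (by omega)
        have hjA := ih (by omega) j hj hj' hrj
        refine ⟨hrow i (by omega) (by omega) hr 0 le_rfl (by omega), ?_⟩
        refine ((hjA.2.trans (hrc j (by omega) (by omega) hrj x hx hx')).trans
          (conn_col fun z hz => ?_)).trans
          (hrc i (by omega) (by omega) hr x hx hx').symm
        -- The new row lies just beyond the free column of strip `n`; its own cell in that column is
        -- free because the row has no hits on the left.
        by_cases hzi : z = i
        · rw [hzi]
          exact hrow i (by omega) (by omega) hr x hx hx'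
        · exact hfree z (by omega) (by omega)
  have hall : ∀ i : ℤ, 0 ≤ i → i < m → (∀ s ∈ S, s.2 = i → (m : ℤ) - a ≤ s.1) →
      (0, i) ∈ comp T (0, i₀) := by
    intro i hi hi' hr
    by_cases hia : i + a ≤ m
    · exact key i.toNat (by omega) i (by omega) (by omega) hr
    · exact key (m - a) (by omega) i (by omega) (by omega) hr
  have hcolA : ∀ y : ℤ, 0 ≤ y → y + a ≤ m → ∃ x, ∀ z, y ≤ z → z < y + a →
      (x, z) ∈ comp T (0, i₀) := by
    intro y hy hy'
    obtain ⟨x, hx, hx', hfree⟩ := hcolc y hy hy'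
    obtain ⟨j, hj, hj', hrj⟩ := h.exists_right_row hcard hR hy hy'
    refine ⟨x, fun z hz hz' => ⟨hfree z hz hz', ?_⟩⟩
    exact ((hall j (by omega) (by omega) hrj).2.trans (hrc j (by omega) (by omega) hrj x hx hx')).trans
      (conn_col fun z hz => hfree z (by omega) (by omega))
  refine ⟨comp T (0, i₀), comp_subset _ _, isConn_comp _ _, Or.inr ⟨?_, ?_⟩, hall⟩
  · obtain ⟨x, hx⟩ := hcolA 0 le_rfl (by omega)
    exact ⟨_, hx 0 le_rfl (by omega), rfl⟩
  · obtain ⟨x, hx⟩ := hcolA (m - a) (by omega) (by omega)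
    exact ⟨_, hx (m - 1) (by omega) (by omega), rfl⟩

/-- No row with hits only on the left lies between rows with hits only on the right. -/
theorem Blocked.not_right_left_right (h : Blocked m S) (hcard : S.card = m + s)
    (hma : 5 * a + 1 ≤ 2 * m)
    (hR : ∀ y : ℤ, 0 ≤ y → y + a ≤ m → s + 1 ≤ hitsIn S (Box (m - a) y a a)) {i l j : ℤ}
    (hi : 0 ≤ i) (hil : i < l) (hlj : l < j) (hj : j < m)
    (hri : ∀ s ∈ S, s.2 = i → (m : ℤ) - a ≤ s.1) (hrl : ∀ s ∈ S, s.2 = l → s.1 < a)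
    (hrj : ∀ s ∈ S, s.2 = j → (m : ℤ) - a ≤ s.1) : False := by
  obtain ⟨i, ⟨hi, hil, hri⟩, hmax⟩ := Set.exists_max_image
    {i : ℤ | 0 ≤ i ∧ i < l ∧ ∀ s ∈ S, s.2 = i → (m : ℤ) - a ≤ s.1} id
    ((Set.finite_Icc 0 l).subset fun i hi => ⟨hi.1, hi.2.1.le⟩) ⟨i, hi, hil, hri⟩
  obtain ⟨j, ⟨hj, hlj, hrj⟩, hmin⟩ := Set.exists_min_image
    {j : ℤ | j < m ∧ l < j ∧ ∀ s ∈ S, s.2 = j → (m : ℤ) - a ≤ s.1} id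
    ((Set.finite_Icc l m).subset fun i hi => ⟨hi.2.1.le, hi.1.le⟩) ⟨j, hj, hlj, hrj⟩
  -- With `i` and `j` chosen nearest to `l`, the `a` rows after `i` must contain a right row, and it
  -- cannot come before `j`.
  have hgap : j ≤ i + a := by
    by_contra hcon
    obtain ⟨r, h1, h2, h3⟩ := h.exists_right_row hcard hR (y := i + 1) (by omega) (by omega)
    rcases lt_trichotomy r l with h4 | rfl | h4
    · have := hmax r ⟨by omega, h4, h3⟩
      simp only [id] at this
      omega
    · obtain ⟨x, hx⟩ := h.exists_hit_row (i := r) (by omega) (by omega)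
      have h5 := h3 _ hx rfl
      have h6 := hrl _ hx rfl
      dsimp only at h5 h6
      omega
    · have := hmin r ⟨by omega, h4, h3⟩
      simp only [id] at this
      omega
  -- For a ≤ x < m - a, row `i` is free up to column `x` and row `l` is free from it on, so the
  -- Z-path must be hit strictly between the two rows in column `x`.
  have h1 := hitsIn_ge_cols (S := S) {p | p.1 < (m : ℤ) - a ∧ i < p.2 ∧ p.2 < l} a (m - a)
    fun x hx hx' => by
      obtain ⟨⟨u, v⟩, hs, hsz⟩ := h i x l hi (by omega) (by omega) (by omega) (by omega) (by omega)
      have e1 := hri _ hs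
      have e2 := hrl _ hs
      simp only [zpath, mem_Box, Set.mem_ofPred_eq] at hsz e1 e2
      obtain rfl : u = x := by omega
      exact ⟨v, hs, hx', by dsimp only; omega, by dsimp only; omega⟩
  have h2 := hitsIn_ge_cols (S := S) {p | p.1 < (m : ℤ) - a ∧ l < p.2 ∧ p.2 < j} a (m - a)
    fun x hx hx' => by
      obtain ⟨⟨u, v⟩, hs, hsz⟩ := h j x l (by omega) hj (by omega) (by omega) (by omega) (by omega)
      have e1 := hrj _ hs
      have e2 := hrl _ hs
      simp only [zpath, mem_Box, Set.mem_ofPred_eq] at hsz e1 e2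
      obtain rfl : u = x := by omega
      exact ⟨v, hs, hx', by dsimp only; omega, by dsimp only; omega⟩
  have h3 := h.hitsIn_left_lt hcard hR (y := min i (m - a)) (by omega) (by omega)
  have h4 : hitsIn S {p | p.1 < (m : ℤ) - a ∧ i < p.2 ∧ p.2 < l} +
      hitsIn S {p | p.1 < (m : ℤ) - a ∧ l < p.2 ∧ p.2 < j} ≤
      hitsIn S {p | p.1 < (m : ℤ) - a ∧ min i ((m : ℤ) - a) ≤ p.2 ∧ p.2 < min i ((m : ℤ) - a) + a} := by
    refine hitsIn_add_le ?_ ?_ ?_ <;> intro s _ h <;> simp only [Set.mem_ofPred_eq] at * <;>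
      omega
  omega

theorem left_captured (hD : State m S' D) (hSS : S' ⊆ S) (hρ : Rk ρ (D \ S))
    (hρs : ρ + s + 1 = gridRank a a) (ha : 2 * s + 1 ≤ a) (ham : a ≤ m) {y : ℤ} (hy : 0 ≤ y)
    (hy' : y + a ≤ m) (hL : hitsIn S (Box 0 y a a) ≤ s) :
    ∃ K, Captured m S' D K ∧ (∃ u ∈ K, u.1 = 0) ∧ 2 * a ≤ (nb S' K).card + s ∧
      ∀ i, y ≤ i → i < y + a → (∀ s ∈ S, s.1 < a → s.2 ≠ i) → (0, i) ∈ K := by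
  classical
  have hL' : hitsIn S' (Box 0 y a a) ≤ s := by
    refine le_trans ?_ hL
    rw [hitsIn_eq, hitsIn_eq]
    exact Finset.card_le_card (Finset.filter_subset_filter _ hSS)
  rw [hitsIn_eq] at hL hL'
  obtain ⟨K, hK, hrow, hcol⟩ := exists_captured (S' := S') (x₀ := 0) (y₀ := y) (c := a) hSS hD hρ
    (by rintro p ⟨h1, h2, h3, h4⟩; exact ⟨h1, by omega, by omega, by omega⟩)
    (by omega) (by omega) (by omega)
  set F := S.filter (· ∈ Box 0 y a a)
  obtain ⟨γ, hγ1, hγ2, hγ⟩ := exists_free (F.image Prod.fst) 0 a (by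
    have : (F.image Prod.fst).card ≤ F.card := Finset.card_image_le
    omega)
  obtain ⟨ϱ, hϱ1, hϱ2, hϱ⟩ := exists_free (F.image Prod.snd) y a (by
    have : (F.image Prod.snd).card ≤ F.card := Finset.card_image_le
    omega)
  have h1 : ∀ x : ℤ, 0 ≤ x → x < a → (x, ϱ) ∈ K := fun x hx hx' =>
    hrow ϱ hϱ1 hϱ2 (fun s hs hs' he => hϱ (Finset.mem_image.2 ⟨s, Finset.mem_filter.2 ⟨hs, hs'⟩, he⟩))
      x hx (by omega)
  have h2 : ∀ i : ℤ, y ≤ i → i < y + a → (γ, i) ∈ K := fun x hx hx' =>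
    hcol γ hγ1 hγ2 (fun s hs hs' he => hγ (Finset.mem_image.2 ⟨s, Finset.mem_filter.2 ⟨hs, hs'⟩, he⟩))
      x hx (by omega)
  have h3 := hK.two_mul_le hD (y₀ := y) (c := a) (by omega)
    (fun y hy hy' => ⟨γ, h2 y hy (by omega)⟩) (fun x hx hx' => ⟨ϱ, h1 x hx hx'⟩)
  refine ⟨K, hK, ⟨_, h1 0 le_rfl (by omega), rfl⟩, by omega, fun i hi hi' hfree => ?_⟩
  refine hrow i hi hi' (fun s hs hs' => hfree s hs ?_) 0 le_rfl (by omega)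
  have := hs'.2.1
  omega

/-- The crossing that runs through the right rows avoids `S` and meets `D`, hence lies in `D`. A
left square with few hits would capture the left end of one of these rows. -/
theorem Blocked.left_many (h : Blocked m S) (hcard : S.card = m + s) (hma : 2 * a ≤ m)
    (hD : State m S' D) (hSS : S' ⊆ S) (hρ : Rk ρ (D \ S))
    (hρs : ρ + s + 1 = gridRank a a) (ha : 2 * s + 1 ≤ a)
    (hR : ∀ y : ℤ, 0 ≤ y → y + a ≤ m → s + 1 ≤ hitsIn S (Box (m - a) y a a)) {y : ℤ} (hy : 0 ≤ y)
    (hy' : y + a ≤ m) : s + 1 ≤ hitsIn S (Box 0 y a a) := by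
  by_contra hcon
  obtain ⟨K, hK, -, -, hrow⟩ := left_captured hD hSS hρ hρs ha (by omega) hy hy' (by omega)
  obtain ⟨A, hAT, hA, hcr, hAr⟩ := h.exists_crossing hcard hma (by omega) hR
  obtain ⟨p, hp, hpD⟩ := hD.cross A (fun p hp => (hAT hp).1) hA hcr
  obtain ⟨i, hi, hi', hri⟩ := h.exists_right_row hcard hR hy hy'
  have hiA := hAr i (by omega) (by omega) hri
  have hiK := hrow i hi hi' fun s hs hsa he => by
    have := hri s hs he
    omega
  refine hK.notD _ hiK ?_
  by_contra hiD
  obtain ⟨u, v, huv, -, hv, hu', hv'⟩ := (hA p hp _ hiA).exit hpD hiD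
  exact hv' (hD.closed u hu' v (hAT hv).1 (fun hvS => (hAT hv).2 (hSS hvS)) huv)

/-- `S'` are the hits before the latest deletion, for which `D` is still a state, while the squares
are counted with the new set `S`. -/
theorem not_blocked (hp : Params m a t) (hD : State m S' D) (hSS : S' ⊆ S)
    (hlt : S'.card < S.card) (hρ : Rk ρ (D \ S)) (hcard : S.card = m + s) (hst : s ≤ t)
    (hρs : ρ + s + 1 = gridRank a a) : ¬ Blocked m S := by
  intro h
  have hpar : 3 * t + m < 4 * a ∧ 2 * t + 1 ≤ a ∧ 2 * a ≤ m ∧ 5 * a + 1 ≤ 2 * m := by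
    rcases hp with ⟨j, rfl, rfl, rfl⟩ | ⟨j, rfl, rfl, rfl⟩ <;> omega
  have hφ := Sym.flip m true false
  have hD' := hD.map hφ
  have hSS' : S'.image (flip m true false) ⊆ S.image (flip m true false) :=
    Finset.image_subset_image hSS
  have hρ' : Rk ρ ({p | flip m true false p ∈ D} \ (S.image (flip m true false) : Finset Cell)) := by
    refine (hφ.rk hρ).mono_set ?_
    rintro p ⟨hp, hpS⟩
    exact ⟨hp, fun hs => hpS (Finset.mem_coe.2 (hφ.mem_image.2 hs))⟩
  have hcard' : (S.image (flip m true false)).card = m + s := hφ.card_image.trans hcard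
  have e1 : ∀ y : ℤ, hitsIn (S.image (flip m true false)) (Box 0 y a a) =
      hitsIn S (Box (m - a) y a a) := by
    intro y
    rw [hφ.hitsIn]
    congr 1
    ext p
    simp only [mem_Box, GridRank.flip, Set.mem_ofPred_eq, if_true, if_false, Bool.false_eq_true]
    omega
  have e2 : ∀ y : ℤ, hitsIn (S.image (flip m true false)) (Box (m - a) y a a) =
      hitsIn S (Box 0 y a a) := by
    intro y
    rw [hφ.hitsIn]
    congr 1
    ext p
    simp only [mem_Box, GridRank.flip, Set.mem_ofPred_eq, if_true, if_false, Bool.false_eq_true]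
    omega
  have hLR : (∀ y : ℤ, 0 ≤ y → y + a ≤ m → s + 1 ≤ hitsIn S (Box 0 y a a)) ∨
      ∀ y : ℤ, 0 ≤ y → y + a ≤ m → s + 1 ≤ hitsIn S (Box (m - a) y a a) := by
    by_contra hcon
    push Not at hcon
    obtain ⟨⟨y, hy, hy', hyL⟩, z, hz, hz', hzR⟩ := hcon
    obtain ⟨K, hK, hl, hn, -⟩ := left_captured hD hSS hρ hρs (by omega) (by omega) hy hy' (by omega)
    obtain ⟨K', hK', ⟨u, hu, hu'⟩, hn', -⟩ := left_captured hD' hSS' hρ' hρs (by omega) (by omega)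
      hz hz' (by rw [e1]; omega)
    have hK'' := hK'.map hφ
    rw [hφ.image_image, hφ.preimage_preimage] at hK''
    have hnb : (nb S' {p | flip m true false p ∈ K'}).card =
        (nb (S'.image (flip m true false)) K').card := by
      have := hφ.card_nb (S := S'.image (flip m true false)) (K := K')
      rwa [hφ.image_image] at this
    have := hK.card_nb_add_card_nb_le hK'' hD (Or.inl ⟨hl, flip m true false u, by
      rw [Set.mem_ofPred_eq, hφ.inv]; exact hu, by simp [GridRank.flip, hu']⟩)
    omega
  have hboth : (∀ y : ℤ, 0 ≤ y → y + a ≤ m → s + 1 ≤ hitsIn S (Box 0 y a a)) ∧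
      ∀ y : ℤ, 0 ≤ y → y + a ≤ m → s + 1 ≤ hitsIn S (Box (m - a) y a a) := by
    rcases hLR with hL | hR
    · refine ⟨hL, fun y hy hy' => ?_⟩
      rw [← e1]
      refine h.flip.left_many hcard' (by omega) hD' hSS' hρ' hρs (by omega) (fun z hz hz' => ?_) hy hy'
      rw [e2]
      exact hL z hz hz'
    · exact ⟨fun y hy hy' => h.left_many hcard (by omega) hD hSS hρ hρs (by omega) hR hy hy', hR⟩
  obtain ⟨hL, hR⟩ := hboth
  have hR' : ∀ y : ℤ, 0 ≤ y → y + a ≤ m →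
      s + 1 ≤ hitsIn (S.image (flip m true false)) (Box (m - a) y a a) := fun y hy hy' => by
    rw [e2]; exact hL y hy hy'
  have toR : ∀ i, (∀ s ∈ S, s.2 = i → s.1 < a) →
      ∀ s ∈ S.image (flip m true false), s.2 = i → (m : ℤ) - a ≤ s.1 := by
    intro i hi s hs hsi
    have := hi _ (hφ.mem_image.1 hs) hsi
    simp only [GridRank.flip, if_true] at this
    omega
  have ofR : ∀ i, (∀ s ∈ S.image (flip m true false), s.2 = i → (m : ℤ) - a ≤ s.1) →
      ∀ s ∈ S, s.2 = i → s.1 < a := by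
    intro i hi s hs hsi
    have := hi _ (Finset.mem_image_of_mem _ hs) hsi
    simp only [GridRank.flip, if_true] at this
    omega
  have toL : ∀ i, (∀ s ∈ S, s.2 = i → (m : ℤ) - a ≤ s.1) →
      ∀ s ∈ S.image (flip m true false), s.2 = i → s.1 < a := by
    intro i hi s hs hsi
    have := hi _ (hφ.mem_image.1 hs) hsi
    simp only [GridRank.flip, if_true] at this
    omega
  obtain ⟨i, hi, hi', hri⟩ := h.exists_right_row hcard hR le_rfl (by omega)
  obtain ⟨l, hl, hl', hrl⟩ := h.flip.exists_right_row hcard' hR' le_rfl (by omega)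
  obtain ⟨j, hj, hj', hrj⟩ := h.exists_right_row hcard hR (y := a) (by omega) (by omega)
  obtain ⟨k, hk, hk', hrk⟩ := h.flip.exists_right_row hcard' hR' (y := a) (by omega) (by omega)
  -- The first strip has a right row `i` and a left row `l`; the second strip supplies a third row
  -- `j` or `k` that completes an alternation.
  rcases lt_trichotomy i l with hil | rfl | hil
  · exact h.not_right_left_right hcard (by omega) hR hi hil (by omega) (by omega) hri (ofR l hrl) hrj
  · obtain ⟨x, hx⟩ := h.exists_hit_row (i := i) (by omega) (by omega)
    have h1 := hri _ hx rfl
    have h2 := ofR _ hrl _ hx rfl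
    dsimp only at h1 h2
    omega
  · exact h.flip.not_right_left_right hcard' (by omega) hR' hl hil (by omega) (by omega) hrl
      (toL i hri) hrk

/-- Adding a hit to a state gives a state unless all Z-shaped paths of one direction get blocked. -/
theorem State.step {m : ℤ} (hD : State m S' D) (hSS : S' ⊆ S) (hS : ∀ s ∈ S, s ∈ Box 0 0 m m)
    (h1 : ¬ Blocked m S) (h2 : ¬ Blocked m (S.image Prod.swap)) : ∃ D₂ ⊆ D \ S, State m S D₂ := by
  unfold Blocked at h1 h2
  push Not at h1 h2
  obtain ⟨i, c, j, hi, hi', hc, hc', hj, hj', hZ⟩ := h1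
  obtain ⟨k, e, l, hk, hk', he, he', hl, hl', hN⟩ := h2
  have hs := Sym.swap m
  have hZc := isConn_zpath (m := m) hi hi' hj hj' hc hc'
  have hNc := (isConn_zpath (m := m) hk hk' hl hl' he he').tr
  have mem_left : ∀ i c j : ℤ, 0 ≤ i → i < m → 0 ≤ c → c < m → (0, i) ∈ zpath m i c j := by
    intro i c j hi hi' hc hc'
    exact ⟨⟨le_rfl, by dsimp only; omega, hi, by dsimp only; omega⟩, Or.inl ⟨hc, rfl⟩⟩
  have mem_right : ∀ i c j : ℤ, 0 ≤ j → j < m → 0 ≤ c → c < m → (m - 1, j) ∈ zpath m i c j := by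
    intro i c j hi hi' hc hc'
    exact ⟨⟨by dsimp only; omega, by dsimp only; omega, hi, by dsimp only; omega⟩,
      Or.inr (Or.inr ⟨by dsimp only; omega, rfl⟩)⟩
  have hNB : tr (zpath m k e l) ⊆ Box 0 0 m m := fun p hp => tr_box.1 (zpath_subset _ _ _ _ hp)
  obtain ⟨p, hpN, hpZ⟩ := exists_mem_zpath (i := i) (c := c) (j := j) hNB hNc
    ⟨(k, 0), mem_left k e l hk hk' he he', rfl⟩ ⟨(l, m - 1), mem_right k e l hl hl' he he', rfl⟩
    hi hi' hj hj'
  have hZT : zpath m i c j ⊆ Box 0 0 m m \ (S : Set Cell) := fun q hq =>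
    ⟨zpath_subset _ _ _ _ hq, fun hqS => hZ q hqS hq⟩
  have hNT : tr (zpath m k e l) ⊆ Box 0 0 m m \ (S : Set Cell) := fun q hq =>
    ⟨hNB hq, fun hqS => hN q.swap (Finset.mem_image_of_mem _ hqS) hq⟩
  -- The free Z-paths of the two directions intersect, so they share a component, and every crossing
  -- meets one of them.
  have hZD := hZc.subset_comp hZT hpZ
  have hND := hNc.subset_comp hNT hpN
  obtain ⟨q, hqZ, hqD⟩ := hD.cross _ (zpath_subset m i c j) hZc
    (Or.inl ⟨⟨(0, i), mem_left i c j hi hi' hc hc', rfl⟩, (m - 1, j), mem_right i c j hj hj' hc hc', rfl⟩)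
  refine ⟨comp (Box 0 0 m m \ S) p, fun r hr => ⟨?_, hr.1.2⟩, hS, fun r hr => hr.1.1,
    fun r hr => hr.1.2, isConn_comp _ _, fun u hu v hv hvS huv => comp_closed hu huv ⟨hv, hvS⟩, ?_⟩
  · by_contra hrD
    obtain ⟨u, v, huv, -, hv, hu', hv'⟩ := ((hZD hqZ).2.symm.trans hr.2).exit hqD hrD
    exact hv' (hD.closed u hu' v hv.1 (fun hvS => hv.2 (hSS hvS)) huv)
  · rintro A hA hAc (⟨⟨u, hu, hu'⟩, v, hv, hv'⟩ | ⟨hb, ht⟩)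
    · obtain ⟨r, hr, hrZ⟩ := exists_mem_zpath (i := k) (c := e) (j := l) (A := tr A)
        (fun p hp => tr_box.1 (hA hp)) hAc.tr ⟨u.swap, hu, hu'⟩ ⟨v.swap, hv, hv'⟩ hk hk' hl hl'
      exact ⟨r.swap, hr, hND hrZ⟩
    · obtain ⟨r, hr, hrZ⟩ := exists_mem_zpath (i := i) (c := c) (j := j) hA hAc hb ht hi hi' hj hj'
      exact ⟨r, hr, hZD hrZ⟩

/-! ### Running the process -/

theorem state_box (m : ℤ) : State m ∅ (Box 0 0 m m) where
  hits := by simp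
  sub := subset_rfl
  disj := by simp
  conn := isConn_box _ _ _ _
  closed _ _ v hv _ _ := hv
  cross A hA _ hc := by
    obtain ⟨u, hu⟩ : A.Nonempty := by
      rcases hc with ⟨⟨u, hu, -⟩, -⟩ | ⟨⟨u, hu, -⟩, -⟩ <;> exact ⟨u, hu⟩
    exact ⟨u, hu, hA hu⟩

/-- The invariant ρ + n + 1 = m + r(a,a) records one saved label per hit. It becomes ρ + s + 1 =
r(a,a) as soon as |S| = m + s, which is what both contradictions use. -/
theorem gridRank_ge_of_params (hp : Params m a t) : m + gridRank a a ≤ gridRank m m := by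
  by_contra hcon
  have hm : 0 < m ∧ 0 < a := by rcases hp with ⟨j, rfl, rfl, rfl⟩ | ⟨j, rfl, rfl, rfl⟩ <;> omega
  have hh : 0 < gridRank a a := (rk_gridRank a).pos (p := (0, 0)) ⟨le_rfl, by simp; omega, le_rfl, by
    simp; omega⟩
  have key : ∀ n, n ≤ m + t → ∃ S D ρ, State m S D ∧ S.card = n ∧ ρ + n + 1 = m + gridRank a a ∧
      Rk ρ D := by
    intro n
    induction n with
    | zero =>
      exact fun _ => ⟨∅, _, m + gridRank a a - 1, state_box m, rfl, by omega,
        (rk_gridRank m).mono (by omega)⟩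
    | succ n ih =>
      intro hn
      obtain ⟨S', D, ρ, hD, hcard, hρ, hrk⟩ := ih (by omega)
      obtain ⟨p, -, hpD⟩ := hD.cross _ subset_rfl (isConn_box 0 0 m m) (Or.inl
        ⟨⟨(0, 0), by simp [mem_Box]; omega, rfl⟩, (m - 1, 0), by simp [mem_Box]; omega, rfl⟩)
      have hpos := hrk.pos hpD
      obtain ⟨ρ, rfl⟩ : ∃ ρ', ρ = ρ' + 1 := ⟨ρ - 1, by omega⟩
      obtain ⟨v, hv, hrk⟩ := hrk.exists_top hD.conn ⟨p, hpD⟩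
      have hvS : v ∉ S' := hD.disj v hv
      have hSS : S' ⊆ insert v S' := Finset.subset_insert _ _
      have hc : (insert v S').card = n + 1 := by rw [Finset.card_insert_of_notMem hvS, hcard]
      have hrk' : Rk ρ (D \ (insert v S' : Finset Cell)) := by
        refine hrk.mono_set ?_
        rintro q ⟨hq, hqS⟩
        exact ⟨hq, fun hqv => hqS (Finset.mem_coe.2 (by rw [hqv]; exact Finset.mem_insert_self _ _))⟩
      have hnb : ∀ S' S D, State m S' D → S' ⊆ S → S'.card < S.card → Rk ρ (D \ S) →
          S.card = n + 1 → ¬ Blocked m S := by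
        intro S' S D hD hSS hlt hrk hc hb
        have hrows := card_ge_of_rows S 0 m fun y hy hy' => hb.exists_hit_row hy hy'
        -- The subtraction is exact: a blocked set has a hit in every row, so `m ≤ n + 1`.
        exact not_blocked (s := n + 1 - m) hp hD hSS hlt hrk (by omega) (by omega) (by omega) hb
      have hs := Sym.swap m
      obtain ⟨D₂, hD₂, hst⟩ := hD.step hSS (by
        intro s hs
        rcases Finset.mem_insert.1 hs with rfl | hs
        · exact hD.sub hv
        · exact hD.hits s hs) (hnb S' _ D hD hSS (by omega) hrk' hc)
        (hnb (S'.image Prod.swap) _ _ (hD.map hs) (Finset.image_subset_image hSS)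
          (by rw [hs.card_image, hs.card_image]; omega) (by
            refine (hs.rk hrk').mono_set ?_
            rintro q ⟨hq, hqS⟩
            exact ⟨hq, fun hqv => hqS (Finset.mem_coe.2 (hs.mem_image.2 hqv))⟩)
          (hs.card_image.trans hc))
      exact ⟨_, D₂, ρ, hst, hc, by omega, hrk'.mono_set hD₂⟩
  obtain ⟨S, D, ρ, hD, hcard, hρ, hrk⟩ := key (m + t) le_rfl
  exact not_state hp hD hrk hcard (by omega)

end GridRank

open GridRank in
theorem theorem2 (m : ℕ) (hm : 5 ≤ m) :
    m + gridRank (⌈(2 * m / 5 : ℚ)⌉₊ - 1) (⌈(2 * m / 5 : ℚ)⌉₊ - 1) ≤ gridRank m m := by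
  have hceil : ⌈(2 * m / 5 : ℚ)⌉₊ = (2 * m + 4) / 5 := by
    rw [Nat.ceil_eq_iff (by omega)]
    have h1 : (2 * m + 4) / 5 * 5 ≤ 2 * m + 4 := Nat.div_mul_le_self _ _
    have h2 : 2 * m ≤ (2 * m + 4) / 5 * 5 := by omega
    have h3 : ((2 * m + 4) / 5 - 1) * 5 + 1 ≤ 2 * m := by omega
    constructor
    · rw [lt_div_iff₀ (by norm_num)]
      have : (((2 * m + 4) / 5 - 1 : ℕ) : ℚ) * 5 + 1 ≤ 2 * m := by exact_mod_cast h3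
      linarith
    · rw [div_le_iff₀ (by norm_num)]
      exact_mod_cast h2
  rw [hceil]
  -- The side `a` is constant for m = 5j + 3, 5j + 4, 5j + 5 and for m = 5j + 6, 5j + 7; `n` is the
  -- first value of the group, and `gridRank_add_le` covers the others.
  obtain ⟨a, n, t, ha, hn, hp⟩ : ∃ a n t, (2 * m + 4) / 5 - 1 = a ∧ n ≤ m ∧
      Params n a t := by
    obtain ⟨j, hj⟩ : ∃ j, j = m / 5 := ⟨_, rfl⟩
    by_cases hr : m % 5 ≤ 2 ∧ 1 ≤ m % 5
    · exact ⟨2 * j, 5 * j + 1, j - 1, by omega, by omega, Or.inr ⟨j - 1, by omega, by omega, rfl⟩⟩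
    · by_cases hr0 : m % 5 = 0
      · exact ⟨2 * j - 1, 5 * j - 2, j - 1, by omega, by omega,
          Or.inl ⟨j - 1, by omega, by omega, rfl⟩⟩
      · exact ⟨2 * j + 1, 5 * j + 3, j, by omega, by omega, Or.inl ⟨j, rfl, rfl, rfl⟩⟩
  rw [ha]
  have h1 := gridRank_ge_of_params hp
  have h2 := gridRank_add_le n (m - n)
  rw [Nat.add_sub_cancel' hn] at h2
  omega
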